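/- Work in the oriented sphere $S$. A disc configuration $\mathbb D=(D_0;(D_i)_{i\in I})$ consists of a closed disc $D_0\subset S$ and a finite family of pairwise disjoint closed discs $D_i\subset \mathrm{int}\,D_0$, each with a marked point on its boundary; put $\Sigma=D_0\setminus\bigcup_i \mathrm{int}\,D_i$. A planar diagram $P$ subordinate to $\mathbb D$ with signature $(n_0;(n_i)_{i\in I})$ is a finite set of disjoint arcs and circles properly embedded in $\Sigma$ that meets each $\partial D_i$ ($i\in I$ or $i=0$) in exactly $2n_i$ points, none of them marked; these points are ordered along $\partial D_i$, in the positive direction, starting at the marked point. A cleaved link with $2n$ points is (up to isotopy) a link in $S$ that meets a fixed oriented equator with a marked point transversally in $2n$ points, every component meeting the equator, together with a decoration of its components by signs $\pm$; equivalently, it is a pair of crossingless perfect matchings (inside and outside) of the $2n$ ordered points together with signs on the components. Let $\mathcal I_{2n}$ be the free $\mathbb Z[q^{1/2},q^{-1/2}]$-module on the cleaved links with $2n$ points, with generators $I_L$. Let $\mathcal M(P)$ be the set of decorated links $(M,\sigma)$ obtained by completing $P$ by a crossingless matching in each disc $D_i$, $i\in I$, and in the disc $S\setminus \mathrm{int}\,D_0$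 and by decorating every circle of the resulting link by a sign. The boundary $\partial_i(M,\sigma)$ is the cleaved link with equator $\partial D_i$ formed by the circles of $M$ that meet $\partial D_i$, with their decorations. The weight is $$W(M,\sigma)=\prod_{\sigma(C)=+}q^{1-N(C)/2}\prod_{\sigma(C)=-}q^{-1+N(C)/2},$$ where $C$ runs through the circles of $M$ and $N(C)$ is the number of circles $\partial D_i$ ($i\in I$ or $i=0$) that meet $C$. The partition map $Z_P:\bigotimes_{i\in I}\mathcal I_{2n_i}\to\mathcal I_{2n_0}$ is the linear map with $$Z_P\Big(\bigotimes_{i\in I} I_{L_i}\Big)=\sum_{(M,\sigma)\in\mathcal M(P),\ \partial_i(M,\sigma)=L_i\ (i\in I)}W(M,\sigma)\,I_{\partial_0(M,\sigma)} .$$ **Theorem (Composition).** Let $P$ be a planar diagram with signature $(n_0;(n_k)_{k\in I})$ and $R$ a planar diagram with signature $(n'_0;(n'_j)_{j\in I'})$, and let $i\in I'$ be such that $n_0=n'_i$. Let $R\circ_i P$ be a planar diagram obtained by replacing the disc $D'_i$ of $R$ by the disc $D_0$ of $P$, glued by an orientation preserving homeomorphism $D_0\to D'_i$ that carries the marked point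 to the marked point and the $k$-th point of $P\cap\partial D_0$ to the $k$-th point of $R\cap\partial D'_i$ for all $k$; its inner discs are the discs $D'_j$, $j\ne i$, and the images of the discs $D_k$, $k\in I$. Then $$Z_{R\circ_i P}=Z_R\circ_i Z_P,$$ where the right-hand side is the linear map that inserts the value of $Z_P$ into the $i$-th tensor factor of $Z_R$: $$(Z_R\circ_i Z_P)\Big(\bigotimes_{j\neq i}a_j\otimes\bigotimes_{k}b_k\Big)=Z_R\Big(\bigotimes_{j\ne i}a_j\otimes Z_P\big(\textstyle\bigotimes_k b_k\big)\Big),$$ with $Z_P(\bigotimes_k b_k)$ in position $i$. -/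

import Mathlib

open Set LaurentPolynomial
open scoped TensorProduct

/-! ### Discs in the plane

The oriented sphere is `ℂ ∪ {∞}`, where `∞` is a point outside the outer disc `D₀`; so all closed
discs of a configuration lie in `ℂ`.  The category is the topological one. -/

/-- The loop `t ↦ e (exp (2πit))` winds exactly once, counterclockwise, around `e 0`. -/
def IsPositive (e : ℂ → ℂ) : Prop :=
  ∃ g : ℝ → ℂ, Continuous g ∧
    (∀ t : ℝ, Complex.exp (g t) = e (Complex.exp (2 * Real.pi * Complex.I * t)) - e 0) ∧
    g 1 = g 0 + 2 * Real.pi * Complex.I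

/-- An embedded closed disc with a marked point on its boundary, given by an orientation preserving
embedding of the closed unit disc that sends `1` to the marked point. -/
structure MarkedDisc where
  toFun : ℂ → ℂ
  continuousOn : ContinuousOn toFun (Metric.closedBall 0 1)
  injOn : InjOn toFun (Metric.closedBall 0 1)
  positive : IsPositive toFun

namespace MarkedDisc

/-- The closed disc. -/
def carrier (D : MarkedDisc) : Set ℂ := D.toFun '' Metric.closedBall 0 1

/-- The interior of the disc. -/
def interior (D : MarkedDisc) : Set ℂ := D.toFun '' Metric.ball 0 1

/-- The boundary circle of the disc. -/
def boundary (D : MarkedDisc) : Set ℂ := D.toFun '' Metric.sphere 0 1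

/-- The marked point. -/
def base (D : MarkedDisc) : ℂ := D.toFun 1

/-- The boundary circle, run through once in the positive direction for `0 ≤ t < 1`, starting at
the marked point. -/
noncomputable def bd (D : MarkedDisc) (t : ℝ) : ℂ :=
  D.toFun (Complex.exp (2 * Real.pi * Complex.I * t))

theorem exp_mem_sphere (t : ℝ) :
    Complex.exp (2 * Real.pi * Complex.I * t) ∈ Metric.sphere (0 : ℂ) 1 := by
  have : (2 * Real.pi * Complex.I * t : ℂ) = ((2 * Real.pi * t : ℝ) : ℂ) * Complex.I := by
    push_cast; ring
  rw [this, mem_sphere_zero_iff_norm, Complex.norm_exp_ofReal_mul_I]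

theorem bd_mem (D : MarkedDisc) (t : ℝ) : D.bd t ∈ D.boundary :=
  mem_image_of_mem _ (exp_mem_sphere t)

theorem carrier_eq (D : MarkedDisc) : D.carrier = D.interior ∪ D.boundary := by
  rw [carrier, interior, boundary, ← image_union, Metric.ball_union_sphere]

theorem disjoint_interior_boundary (D : MarkedDisc) : Disjoint D.interior D.boundary := by
  rw [Set.disjoint_left]
  rintro _ ⟨z, hz, rfl⟩ ⟨w, hw, h⟩
  have := D.injOn (Metric.sphere_subset_closedBall hw) (Metric.ball_subset_closedBall hz) h
  subst this
  simp only [mem_sphere_zero_iff_norm, mem_ball_zero_iff] at hw hz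
  exact absurd hw hz.ne

theorem interior_subset (D : MarkedDisc) : D.interior ⊆ D.carrier := by
  rw [carrier_eq]; exact subset_union_left

theorem boundary_subset (D : MarkedDisc) : D.boundary ⊆ D.carrier := by
  rw [carrier_eq]; exact subset_union_right

end MarkedDisc

/-- A disc configuration: an outer disc `D₀` and pairwise disjoint discs in the interior of `D₀`,
labelled by `ι` (an order of the labels would only fix the order of tensor factors). -/
structure DiscConfiguration (ι : Type*) where
  outer : MarkedDisc
  inner : ι → MarkedDisc
  inner_subset : ∀ i, (inner i).carrier ⊆ outer.interior
  inner_disjoint : Pairwise fun i j => Disjoint (inner i).carrier (inner j).carrier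

namespace DiscConfiguration

variable {ι : Type*}

/-- All discs of the configuration; `none` stands for the outer disc. -/
def disc (D : DiscConfiguration ι) : Option ι → MarkedDisc
  | none => D.outer
  | some i => D.inner i

/-- The planar surface `Σ = D₀ ∖ ⋃ i, int Dᵢ`. -/
def surface (D : DiscConfiguration ι) : Set ℂ := D.outer.carrier \ ⋃ i, (D.inner i).interior

/-- The union of the boundary circles of `Σ`. -/
def boundary (D : DiscConfiguration ι) : Set ℂ := ⋃ o, (D.disc o).boundary

end DiscConfiguration

/-! ### Planar diagrams -/

/-- `s` is an embedded arc with end points `a` and `b`. -/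
def IsArc (s : Set ℂ) (a b : ℂ) : Prop :=
  ∃ γ : Path a b, Function.Injective γ ∧ range γ = s

/-- `s` is an embedded circle. -/
def IsSimpleClosedCurve (s : Set ℂ) : Prop :=
  ∃ (a : ℂ) (γ : Path a a), InjOn γ {t | t < 1} ∧ range γ = s

/-- `s` is an arc or a circle properly embedded in the surface of `D`: an arc meets the boundary of
the surface exactly in its end points, a circle does not meet it. -/
def IsStrand {ι : Type*} (D : DiscConfiguration ι) (s : Set ℂ) : Prop :=
  s ⊆ D.surface ∧
    ((∃ a b, a ≠ b ∧ IsArc s a b ∧ s ∩ D.boundary = {a, b}) ∨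
      (IsSimpleClosedCurve s ∧ s ∩ D.boundary = ∅))

/-- The signature `(n₀; nᵢ)` as one family over all discs. -/
abbrev sig {ι : Type*} (n₀ : ℕ) (n : ι → ℕ) : Option ι → ℕ
  | none => n₀
  | some i => n i

/-- A planar diagram with signature `(n₀; nᵢ)` subordinate to `D`: a finite set of pairwise disjoint
arcs and circles, properly embedded in the surface, that meets the boundary of the `i`-th disc in
`2nᵢ` points, away from the marked point.  These points are enumerated by `pos` (which is determined
by the strands), in their order along the boundary circle cut open at the marked point. -/
structure PlanarDiagram {ι : Type*} (D : DiscConfiguration ι) (n₀ : ℕ) (n : ι → ℕ) where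
  strands : Set (Set ℂ)
  finite_strands : strands.Finite
  isStrand : ∀ s ∈ strands, IsStrand D s
  disjoint_strands : strands.PairwiseDisjoint id
  pos : ∀ o : Option ι, Fin (2 * sig n₀ n o) → ℝ
  pos_strictMono : ∀ o, StrictMono (pos o)
  pos_mem : ∀ o k, pos o k ∈ Ioo (0 : ℝ) 1
  bd_mem_iff : ∀ o, ∀ t ∈ Ico (0 : ℝ) 1, (D.disc o).bd t ∈ ⋃₀ strands ↔ ∃ k, pos o k = t

namespace PlanarDiagram

variable {ι : Type*} {D : DiscConfiguration ι} {n₀ : ℕ} {n : ι → ℕ}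

/-- The diagram as a subset of the plane. -/
def carrier (P : PlanarDiagram D n₀ n) : Set ℂ := ⋃₀ P.strands

/-- The `k`-th point of the diagram on the boundary circle of the disc `o`. -/
noncomputable def pt (P : PlanarDiagram D n₀ n) (o : Option ι) (k : Fin (2 * sig n₀ n o)) : ℂ :=
  (D.disc o).bd (P.pos o k)

end PlanarDiagram

/-! ### Joining arcs -/

namespace IsArc

theorem left_mem {s : Set ℂ} {a b : ℂ} (h : IsArc s a b) : a ∈ s := by
  obtain ⟨γ, -, rfl⟩ := h
  exact ⟨0, γ.source⟩

theorem symm {s : Set ℂ} {a b : ℂ} (h : IsArc s a b) : IsArc s b a := by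
  obtain ⟨γ, hγ, rfl⟩ := h
  refine ⟨γ.symm, ?_, γ.symm_range⟩
  intro x y hxy
  simpa using hγ hxy

theorem right_mem {s : Set ℂ} {a b : ℂ} (h : IsArc s a b) : b ∈ s := h.symm.left_mem

theorem image {s : Set ℂ} {a b : ℂ} (h : IsArc s a b) {f : ℂ → ℂ} (hf : ContinuousOn f s)
    (hi : InjOn f s) : IsArc (f '' s) (f a) (f b) := by
  obtain ⟨γ, hγ, rfl⟩ := h
  refine ⟨γ.map' hf, ?_, ?_⟩
  · intro x y hxy
    exact hγ (hi (mem_range_self x) (mem_range_self y) hxy)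
  · rw [← range_comp]; rfl

theorem union {s t : Set ℂ} {a b c : ℂ} (hs : IsArc s a b) (ht : IsArc t b c)
    (hst : s ∩ t ⊆ {b}) : IsArc (s ∪ t) a c := by
  obtain ⟨γ, hγ, rfl⟩ := hs
  obtain ⟨δ, hδ, rfl⟩ := ht
  have key : ∀ x y : unitInterval, γ x = δ y → x = 1 ∧ y = 0 := by
    intro x y hxy
    have hb : γ x = b := hst ⟨mem_range_self x, hxy ▸ mem_range_self y⟩
    exact ⟨hγ (hb.trans γ.target.symm), hδ ((hxy.symm.trans hb).trans δ.source.symm)⟩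
  refine ⟨γ.trans δ, ?_, Path.trans_range γ δ⟩
  intro x y hxy
  rw [Path.trans_apply, Path.trans_apply] at hxy
  split_ifs at hxy with h1 h2 h2
  · have := congrArg Subtype.val (hγ hxy)
    ext; simpa using this
  · have := congrArg Subtype.val (key _ _ hxy).2
    simp only [Set.Icc.coe_zero] at this
    exact absurd (by linarith) h2
  · have := congrArg Subtype.val (key _ _ hxy.symm).2
    simp only [Set.Icc.coe_zero] at this
    exact absurd (by linarith) h1
  · have := congrArg Subtype.val (hδ hxy)
    ext; simpa using this

theorem closeUp {s t : Set ℂ} {a b : ℂ} (hs : IsArc s a b) (ht : IsArc t b a)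
    (hst : s ∩ t ⊆ {a, b}) : IsSimpleClosedCurve (s ∪ t) := by
  obtain ⟨γ, hγ, rfl⟩ := hs
  obtain ⟨δ, hδ, rfl⟩ := ht
  have key : ∀ x y : unitInterval, γ x = δ y → y = 0 ∨ y = 1 := by
    intro x y hxy
    rcases hst ⟨mem_range_self x, hxy ▸ mem_range_self y⟩ with hb | hb
    · exact Or.inr (hδ ((hxy.symm.trans hb).trans δ.target.symm))
    · exact Or.inl (hδ ((hxy.symm.trans hb).trans δ.source.symm))
  refine ⟨a, γ.trans δ, ?_, Path.trans_range γ δ⟩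
  intro x hx y hy hxy
  have hx' : (x : ℝ) < 1 := hx
  have hy' : (y : ℝ) < 1 := hy
  rw [Path.trans_apply, Path.trans_apply] at hxy
  split_ifs at hxy with h1 h2 h2
  · have := congrArg Subtype.val (hγ hxy)
    ext; simpa using this
  · rcases key _ _ hxy with h | h <;> have := congrArg Subtype.val h <;>
      simp only [Set.Icc.coe_zero, Set.Icc.coe_one] at this
    · exact absurd (by linarith) h2
    · linarith
  · rcases key _ _ hxy.symm with h | h <;> have := congrArg Subtype.val h <;>
      simp only [Set.Icc.coe_zero, Set.Icc.coe_one] at this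
    · exact absurd (by linarith) h1
    · linarith
  · have := congrArg Subtype.val (hδ hxy)
    ext; simpa using this

end IsArc

theorem IsSimpleClosedCurve.image {s : Set ℂ} (h : IsSimpleClosedCurve s) {f : ℂ → ℂ}
    (hf : ContinuousOn f s) (hi : InjOn f s) : IsSimpleClosedCurve (f '' s) := by
  obtain ⟨a, γ, hγ, rfl⟩ := h
  refine ⟨f a, γ.map' hf, ?_, ?_⟩
  · intro x hx y hy hxy
    exact hγ hx hy (hi (mem_range_self x) (mem_range_self y) hxy)
  · rw [← range_comp]; rfl

/-- A finite family of disjoint arcs and circles; `E` is the set of all end points of the arcs. -/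
structure IsCurveFamily (E : Set ℂ) (K : Set (Set ℂ)) : Prop where
  finite : K.Finite
  disjoint : K.PairwiseDisjoint id
  isCurve : ∀ s ∈ K, (∃ a b, a ≠ b ∧ IsArc s a b ∧ s ∩ E = {a, b}) ∨
    (IsSimpleClosedCurve s ∧ s ∩ E = ∅)
  subset : E ⊆ ⋃₀ K

namespace IsCurveFamily

variable {E : Set ℂ} {K : Set (Set ℂ)}

theorem isCurve_congr {E E' s : Set ℂ} (h : ∀ x ∈ s, x ∈ E ↔ x ∈ E') : s ∩ E = s ∩ E' := by
  ext x
  simp only [mem_inter_iff]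
  exact and_congr_right (h x)

theorem insert (hK : IsCurveFamily E K) {s F : Set ℂ} (hd : Disjoint (⋃₀ K) s) (hF : F ⊆ s)
    (hs : (∃ a b, a ≠ b ∧ IsArc s a b ∧ F = {a, b}) ∨ (IsSimpleClosedCurve s ∧ F = ∅)) :
    IsCurveFamily (E ∪ F) (Insert.insert s K) := by
  have hE : s ∩ (E ∪ F) = F := by
    ext x
    have h1 : x ∈ E → x ∉ s := fun hx => Set.disjoint_left.1 hd (hK.subset hx)
    have h2 := @hF x
    simp only [mem_inter_iff, mem_union]
    tauto
  refine ⟨hK.finite.insert s, ?_, ?_, ?_⟩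
  · refine hK.disjoint.insert fun t ht _ => ?_
    exact (hd.mono_left (subset_sUnion_of_mem ht)).symm
  · rintro t (rfl | ht)
    · rw [hE]; exact hs
    · have : t ∩ (E ∪ F) = t ∩ E := isCurve_congr fun x hx => by
        have : x ∉ F := fun h => Set.disjoint_left.1 hd ⟨t, ht, hx⟩ (hF h)
        simp [this]
      rw [this]; exact hK.isCurve t ht
  · rw [sUnion_insert]
    exact union_subset (hK.subset.trans subset_union_right) (hF.trans subset_union_left)

theorem remove (hK : IsCurveFamily E K) {s : Set ℂ} (hs : s ∈ K) :
    IsCurveFamily (E \ s) (K \ {s}) ∧ Disjoint (⋃₀ (K \ {s})) s ∧ ⋃₀ (K \ {s}) ∪ s = ⋃₀ K := by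
  have hd : ∀ t ∈ K \ {s}, Disjoint t s := fun t ht => hK.disjoint ht.1 hs ht.2
  have hU : ⋃₀ (K \ {s}) ∪ s = ⋃₀ K := by
    rw [union_comm, ← sUnion_insert, insert_sdiff_singleton, insert_eq_of_mem hs]
  refine ⟨⟨hK.finite.subset sdiff_subset, hK.disjoint.subset sdiff_subset, ?_, ?_⟩, ?_, hU⟩
  · intro t ht
    have : t ∩ (E \ s) = t ∩ E := isCurve_congr fun x hx => by
      have : x ∉ s := Set.disjoint_left.1 (hd t ht) hx
      simp [this]
    rw [this]; exact hK.isCurve t ht.1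
  · rintro x ⟨hx, hxs⟩
    have := hK.subset hx
    rw [← hU] at this
    exact this.resolve_right hxs
  · rw [disjoint_sUnion_left]; exact hd

/-- The curve of the family through a given end point is an arc that ends there. -/
theorem exists_arc (hK : IsCurveFamily E K) {b : ℂ} (hb : b ∈ E) :
    ∃ s ∈ K, ∃ c, c ≠ b ∧ IsArc s b c ∧ s ∩ E = {b, c} := by
  obtain ⟨s, hs, hbs⟩ := hK.subset hb
  rcases hK.isCurve s hs with ⟨x, y, hxy, h, hE⟩ | ⟨-, hE⟩
  · have : b ∈ ({x, y} : Set ℂ) := hE ▸ ⟨hbs, hb⟩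
    rcases this with rfl | rfl
    · exact ⟨s, hs, y, hxy.symm, h, hE⟩
    · exact ⟨s, hs, x, hxy, h.symm, by rw [hE, pair_comm]⟩
  · exact absurd (show b ∈ s ∩ E from ⟨hbs, hb⟩) (by simp [hE])

theorem addArc_of_notMem (hK : IsCurveFamily E K) {β : Set ℂ} {a b : ℂ} (hab : a ≠ b)
    (hβ : IsArc β a b) (h : ∀ x ∈ β, x ∈ ⋃₀ K → x = b ∧ x ∈ E) :
    ∃ K', IsCurveFamily (symmDiff E {a, b}) K' ∧ ⋃₀ K' = ⋃₀ K ∪ β := by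
  by_cases hb : b ∈ E
  · obtain ⟨s, hs, c, hcb, harc, hsE⟩ := hK.exists_arc hb
    obtain ⟨hK', hd, hU⟩ := hK.remove hs
    have haK : a ∉ ⋃₀ K := fun ha => hab (h a hβ.left_mem ha).1
    have hac : a ≠ c := by
      rintro rfl; exact haK ⟨s, hs, harc.right_mem⟩
    have hcE : c ∈ E := by
      have : c ∈ s ∩ E := by rw [hsE]; simp
      exact this.2
    refine ⟨Insert.insert (β ∪ s) (K \ {s}), ?_, ?_⟩
    · have := hK'.insert (s := β ∪ s) (F := {a, c}) ?_ ?_ (Or.inl ⟨a, c, hac, ?_, rfl⟩)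
      · convert this using 1
        ext x
        have h1 : x ∈ s ∧ x ∈ E ↔ x = b ∨ x = c := by
          have := Set.ext_iff.1 hsE x
          simpa using this
        have h2 : x = a → x ∉ E := by rintro rfl hx; exact haK (hK.subset hx)
        have h3 : x = c → x ∈ E := by rintro rfl; exact hcE
        have h4 : x = b → x ∈ E := by rintro rfl; exact hb
        have h5 : x = b → x ≠ a ∧ x ≠ c := by rintro rfl; exact ⟨hab.symm, hcb.symm⟩
        have h6 : x = a → x ≠ c := by rintro rfl; exact hac
        simp only [mem_symmDiff, mem_insert_iff, mem_singleton_iff, mem_union, mem_sdiff]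
        clear h hK hβ harc hd hU hK' hs hab hcb hsE this haK hac
        grind
      · rw [disjoint_union_right]
        refine ⟨?_, hd⟩
        rw [Set.disjoint_left]
        intro x hx hxβ
        have hxb := (h x hxβ (hU ▸ Or.inl hx)).1
        exact Set.disjoint_left.1 hd hx (hxb ▸ harc.left_mem)
      · rintro x (rfl | rfl)
        · exact Or.inl hβ.left_mem
        · exact Or.inr harc.right_mem
      · refine hβ.union harc ?_
        rintro x ⟨hx, hxs⟩
        exact (h x hx ⟨s, hs, hxs⟩).1
    · rw [sUnion_insert, ← hU]
      ext x; simp only [mem_union]; tauto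
  · have hd : Disjoint (⋃₀ K) β := by
      rw [Set.disjoint_left]
      intro x hx hxβ
      obtain ⟨rfl, hE⟩ := h x hxβ hx
      exact hb hE
    have haE : a ∉ E := fun ha => Set.disjoint_left.1 hd (hK.subset ha) hβ.left_mem
    refine ⟨Insert.insert β K, ?_, ?_⟩
    · have := hK.insert (F := {a, b}) hd ?_ (Or.inl ⟨a, b, hab, hβ, rfl⟩)
      · convert this using 1
        ext x
        have h2 : x = a → x ∉ E := by rintro rfl; exact haE
        have h4 : x = b → x ∉ E := by rintro rfl; exact hb
        simp only [mem_symmDiff, mem_insert_iff, mem_singleton_iff, mem_union]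
        tauto
      · rintro x (rfl | rfl)
        · exact hβ.left_mem
        · exact hβ.right_mem
    · rw [sUnion_insert, union_comm]

theorem addArc (hK : IsCurveFamily E K) {β : Set ℂ} {a b : ℂ} (hab : a ≠ b)
    (hβ : IsArc β a b) (h : ∀ x ∈ β, x ∈ ⋃₀ K → (x = a ∨ x = b) ∧ x ∈ E) :
    ∃ K', IsCurveFamily (symmDiff E {a, b}) K' ∧ ⋃₀ K' = ⋃₀ K ∪ β := by
  by_cases ha : a ∈ E
  · obtain ⟨s, hs, c, hca, harc, hsE⟩ := hK.exists_arc ha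
    obtain ⟨hK', hd, hU⟩ := hK.remove hs
    have hcE : c ∈ E := by
      have : c ∈ s ∩ E := by rw [hsE]; simp
      exact this.2
    have h1 : ∀ x, x ∈ s ∧ x ∈ E ↔ x = a ∨ x = c := fun x => by
      have := Set.ext_iff.1 hsE x
      simpa using this
    by_cases hcb : c = b
    · subst hcb
      refine ⟨Insert.insert (s ∪ β) (K \ {s}), ?_, ?_⟩
      · have := hK'.insert (s := s ∪ β) (F := ∅) ?_ (empty_subset _) (Or.inr ⟨?_, rfl⟩)
        · convert this using 1
          ext x
          have h1 := h1 x
          have h3 : x = c → x ∈ E := by rintro rfl; exact hcE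
          have h4 : x = a → x ∈ E := by rintro rfl; exact ha
          simp only [mem_symmDiff, mem_insert_iff, mem_singleton_iff, mem_union, mem_sdiff,
            mem_empty_iff_false]
          tauto
        · rw [disjoint_union_right]
          refine ⟨hd, ?_⟩
          rw [Set.disjoint_left]
          intro x hx hxβ
          refine Set.disjoint_left.1 hd hx ?_
          rcases (h x hxβ (hU ▸ Or.inl hx)).1 with rfl | rfl
          · exact harc.left_mem
          · exact harc.right_mem
        · refine harc.closeUp hβ.symm ?_
          rintro x ⟨hxs, hx⟩
          exact (h x hx ⟨s, hs, hxs⟩).1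
      · rw [sUnion_insert, ← hU]
        ext x; simp only [mem_union]; tauto
    · have hbs : b ∉ s := by
        intro hbs
        have := (h1 b).1 ⟨hbs, (h b hβ.right_mem ⟨s, hs, hbs⟩).2⟩
        rcases this with h | h
        · exact hab h.symm
        · exact hcb h.symm
      have hcK : c ∉ ⋃₀ (K \ {s}) := fun hc => Set.disjoint_left.1 hd hc harc.right_mem
      have hint : s ∩ β ⊆ {a} := by
        rintro x ⟨hxs, hx⟩
        rcases (h x hx ⟨s, hs, hxs⟩).1 with rfl | rfl
        · rfl
        · exact absurd hxs hbs
      have hmeet : ∀ x ∈ s ∪ β, x ∈ ⋃₀ (K \ {s}) → x = b ∧ x ∈ E \ s := by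
        rintro x (hxs | hx) hxK
        · exact absurd hxs (Set.disjoint_left.1 hd hxK)
        · have hxs : x ∉ s := Set.disjoint_left.1 hd hxK
          obtain ⟨rfl | rfl, hE⟩ := h x hx (hU ▸ Or.inl hxK)
          · exact absurd harc.left_mem hxs
          · exact ⟨rfl, hE, hxs⟩
      obtain ⟨K'', hK'', hU''⟩ := hK'.addArc_of_notMem hcb (harc.symm.union hβ hint) hmeet
      refine ⟨K'', ?_, ?_⟩
      · convert hK'' using 1
        ext x
        have h1 := h1 x
        have h2 : x = b → x ∉ s := by rintro rfl; exact hbs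
        have h3 : x = c → x ∈ E := by rintro rfl; exact hcE
        have h4 : x = a → x ∈ E := by rintro rfl; exact ha
        have h5 : x = a → x ≠ b ∧ x ≠ c := by rintro rfl; exact ⟨hab, hca.symm⟩
        have h6 : x = b → x ≠ c := by rintro rfl; exact fun h => hcb h.symm
        simp only [mem_symmDiff, mem_insert_iff, mem_singleton_iff, mem_sdiff]
        clear h hK hβ harc hd hU hK' hK'' hU'' hs hcK hint hmeet hab hca hcb hsE
        grind
      · rw [hU'', ← hU, union_assoc]
  · refine hK.addArc_of_notMem hab hβ fun x hx hxK => ?_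
    obtain ⟨rfl | rfl, hE⟩ := h x hx hxK
    · exact absurd hE ha
    · exact ⟨rfl, hE⟩

/-- Two families that meet only in common end points can be joined. -/
theorem join (hK : IsCurveFamily E K) {F : Set ℂ} {L : Set (Set ℂ)} (hL : IsCurveFamily F L)
    (h : ∀ x ∈ ⋃₀ L, x ∈ ⋃₀ K → x ∈ F ∧ x ∈ E) :
    ∃ K', IsCurveFamily (symmDiff E F) K' ∧ ⋃₀ K' = ⋃₀ K ∪ ⋃₀ L := by
  have main : ∀ T : Set (Set ℂ), T.Finite → T ⊆ L →
      ∃ K', IsCurveFamily (symmDiff E (F ∩ ⋃₀ T)) K' ∧ ⋃₀ K' = ⋃₀ K ∪ ⋃₀ T := by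
    intro T hT
    induction T, hT using Set.Finite.induction_on with
    | empty => intro _; exact ⟨K, by rwa [sUnion_empty, inter_empty, ← bot_eq_empty, symmDiff_bot], by simp⟩
    | @insert s T hsT _ ih =>
      intro hTL
      obtain ⟨K', hK', hU⟩ := ih ((subset_insert _ _).trans hTL)
      have hsL : s ∈ L := hTL (mem_insert _ _)
      have hd : Disjoint s (⋃₀ T) := by
        rw [disjoint_sUnion_right]
        intro t ht
        refine hL.disjoint hsL (hTL (mem_insert_of_mem _ ht)) ?_
        rintro rfl; exact hsT ht
      have hE : symmDiff E (F ∩ ⋃₀ Insert.insert s T)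
          = symmDiff (symmDiff E (F ∩ ⋃₀ T)) (s ∩ F) := by
        ext x
        have : x ∈ s → x ∉ ⋃₀ T := fun hx => Set.disjoint_left.1 hd hx
        simp only [mem_symmDiff, sUnion_insert, mem_inter_iff, mem_union]
        tauto
      have hm : ∀ x ∈ s, x ∈ ⋃₀ K' → x ∈ F ∧ x ∈ symmDiff E (F ∩ ⋃₀ T) := by
        intro x hx hxK
        have hxT : x ∉ ⋃₀ T := Set.disjoint_left.1 hd hx
        rw [hU] at hxK
        have := h x ⟨s, hsL, hx⟩ (hxK.resolve_right hxT)
        simp only [mem_symmDiff, mem_inter_iff]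
        tauto
      rw [hE, sUnion_insert]
      rcases hL.isCurve s hsL with ⟨a, b, hab, hs, hF⟩ | ⟨hs, hF⟩
      · rw [hF]
        obtain ⟨K'', hK'', hU''⟩ := hK'.addArc hab hs fun x hx hxK => by
          have := hm x hx hxK
          have h1 : x ∈ s ∩ F := ⟨hx, this.1⟩
          rw [hF] at h1
          exact ⟨h1, this.2⟩
        exact ⟨K'', hK'', by rw [hU'', hU]; ext x; simp only [mem_union]; tauto⟩
      · rw [hF]
        refine ⟨Insert.insert s K', ?_, ?_⟩
        · have := hK'.insert (s := s) (F := ∅) ?_ (empty_subset _) (Or.inr ⟨hs, rfl⟩)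
          · convert this using 1
            ext x
            simp [mem_symmDiff]
          · rw [Set.disjoint_left]
            intro x hxK hx
            have : x ∈ s ∩ F := ⟨hx, (hm x hx hxK).1⟩
            rw [hF] at this
            exact this
        · rw [sUnion_insert, hU]; ext x; simp only [mem_union]; tauto
  obtain ⟨K', hK', hU⟩ := main L hL.finite subset_rfl
  rw [inter_eq_left.2 hL.subset] at hK'
  exact ⟨K', hK', hU⟩

end IsCurveFamily

/-! ### Gluing planar diagrams -/

namespace MarkedDisc

/-- The image of a disc under an orientation preserving embedding. -/
def map (e : MarkedDisc) (h : ℂ → ℂ) (hc : ContinuousOn h e.carrier) (hi : InjOn h e.carrier)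
    (hp : IsPositive (h ∘ e.toFun)) : MarkedDisc where
  toFun := h ∘ e.toFun
  continuousOn := hc.comp e.continuousOn (mapsTo_image _ _)
  injOn := hi.comp e.injOn (mapsTo_image _ _)
  positive := hp

end MarkedDisc

section Gluing

variable {ι ι' : Type*} {D : DiscConfiguration ι} {D' : DiscConfiguration ι'}
  {n : ι → ℕ} {n₀' : ℕ} {n' : ι' → ℕ}

/-- An orientation preserving homeomorphism from the outer disc of `P` to the `i`-th inner disc of
`R` that carries the marked point to the marked point and the `k`-th point of `P` on the boundary to
the `k`-th point of `R`.  (The outer signature of `P` is the `i`-th inner signature of `R`.) -/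
structure GluingMap (R : PlanarDiagram D' n₀' n') (i : ι') (P : PlanarDiagram D (n' i) n) where
  toFun : ℂ → ℂ
  continuousOn : ContinuousOn toFun D.outer.carrier
  injOn : InjOn toFun D.outer.carrier
  image_interior : toFun '' D.outer.interior = (D'.inner i).interior
  image_boundary : toFun '' D.outer.boundary = (D'.inner i).boundary
  positive : ∀ e : MarkedDisc, e.carrier ⊆ D.outer.carrier → IsPositive (toFun ∘ e.toFun)
  map_base : toFun D.outer.base = (D'.inner i).base
  map_pt : ∀ k : Fin (2 * n' i), toFun (P.pt none k) = R.pt (some i) k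

variable {R : PlanarDiagram D' n₀' n'} {i : ι'} {P : PlanarDiagram D (n' i) n}

/-- The glued disc configuration: the `i`-th disc of `D'` is replaced by the images of the inner
discs of `D`.  Its inner discs are labelled by `{j // j ≠ i} ⊕ ι`. -/
def GluingMap.config (G : GluingMap R i P) : DiscConfiguration ({j : ι' // j ≠ i} ⊕ ι) where
  outer := D'.outer
  inner := Sum.elim (fun j => D'.inner j) fun j =>
    have hj := (D.inner_subset j).trans D.outer.interior_subset
    (D.inner j).map G.toFun (G.continuousOn.mono hj) (G.injOn.mono hj) (G.positive _ hj)
  inner_subset := by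
    rintro (j | j)
    · exact D'.inner_subset j
    · refine Subset.trans ?_ (D'.inner_subset i)
      refine Subset.trans ?_ (D'.inner i).interior_subset
      rw [← G.image_interior]
      change (G.toFun ∘ (D.inner j).toFun) '' _ ⊆ _
      rw [image_comp]
      exact image_mono (D.inner_subset j)
  inner_disjoint := by
    have hsub : ∀ j, ((G.toFun ∘ (D.inner j).toFun) '' Metric.closedBall 0 1) ⊆
        (D'.inner i).carrier := by
      intro j
      refine Subset.trans ?_ (D'.inner i).interior_subset
      rw [← G.image_interior, image_comp]
      exact image_mono (D.inner_subset j)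
    rintro (j | j) (k | k) hjk
    · exact D'.inner_disjoint fun h => hjk (congrArg Sum.inl (Subtype.ext h))
    · exact (D'.inner_disjoint j.2).mono_right (hsub k)
    · exact ((D'.inner_disjoint k.2).mono_right (hsub j)).symm
    · change Disjoint ((G.toFun ∘ (D.inner j).toFun) '' _) ((G.toFun ∘ (D.inner k).toFun) '' _)
      rw [image_comp, image_comp, Set.disjoint_left]
      rintro _ ⟨x, hx, rfl⟩ ⟨y, hy, hxy⟩
      have := G.injOn (D.outer.interior_subset (D.inner_subset k hy))
        (D.outer.interior_subset (D.inner_subset j hx)) hxy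
      subst this
      exact Set.disjoint_left.1 (D.inner_disjoint fun h => hjk (congrArg Sum.inr h)) hx hy

/-- The inner signature of a glued diagram. -/
abbrev compSig {ι ι' : Type*} (n' : ι' → ℕ) (i : ι') (n : ι → ℕ) : {j : ι' // j ≠ i} ⊕ ι → ℕ
  | Sum.inl j => n' j
  | Sum.inr k => n k

namespace PlanarDiagram

variable {n₀ : ℕ}

theorem isCurveFamily (P : PlanarDiagram D n₀ n) :
    IsCurveFamily (P.carrier ∩ D.boundary) P.strands := by
  refine ⟨P.finite_strands, P.disjoint_strands, fun s hs => ?_, inter_subset_left⟩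
  have : s ∩ (P.carrier ∩ D.boundary) = s ∩ D.boundary := by
    rw [← inter_assoc, inter_eq_left.2 (show s ⊆ P.carrier from subset_sUnion_of_mem hs)]
  rw [this]
  exact (P.isStrand s hs).2

theorem carrier_subset (P : PlanarDiagram D n₀ n) : P.carrier ⊆ D.surface :=
  sUnion_subset fun s hs => (P.isStrand s hs).1

/-- Every point of the boundary circle is `bd t` for some `t ∈ [0, 1)`. -/
theorem _root_.MarkedDisc.exists_bd (e : MarkedDisc) {x : ℂ} (hx : x ∈ e.boundary) :
    ∃ t ∈ Ico (0 : ℝ) 1, e.bd t = x := by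
  obtain ⟨z, hz, rfl⟩ := hx
  have hz1 : ‖z‖ = 1 := by simpa using hz
  refine ⟨toIcoMod one_pos 0 (Complex.arg z / (2 * Real.pi)), ?_, ?_⟩
  · simpa using toIcoMod_mem_Ico one_pos (0 : ℝ) (Complex.arg z / (2 * Real.pi))
  · unfold MarkedDisc.bd
    congr 1
    rw [toIcoMod]
    have hpi : (Real.pi : ℂ) ≠ 0 := by exact_mod_cast Real.pi_ne_zero
    have : (2 * Real.pi * Complex.I * ((Complex.arg z / (2 * Real.pi)
        - toIcoDiv one_pos 0 (Complex.arg z / (2 * Real.pi)) • (1 : ℝ) : ℝ) : ℂ) : ℂ)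
        = Complex.arg z * Complex.I - (toIcoDiv one_pos 0 (Complex.arg z / (2 * Real.pi)) : ℤ)
          * (2 * Real.pi * Complex.I) := by
      push_cast
      simp only [zsmul_eq_mul, mul_one]
      field_simp
    rw [this, Complex.exp_sub, Complex.exp_int_mul_two_pi_mul_I, div_one]
    have := Complex.norm_mul_exp_arg_mul_I z
    rwa [hz1, Complex.ofReal_one, one_mul] at this

/-- The points of a diagram on the boundary circles are the points `pt o k`. -/
theorem mem_boundary_iff (P : PlanarDiagram D n₀ n) (o : Option ι) (x : ℂ) :
    x ∈ P.carrier ∧ x ∈ (D.disc o).boundary ↔ ∃ k, P.pt o k = x := by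
  constructor
  · rintro ⟨hx, hxo⟩
    obtain ⟨t, ht, rfl⟩ := (D.disc o).exists_bd hxo
    obtain ⟨k, rfl⟩ := (P.bd_mem_iff o t ht).1 hx
    exact ⟨k, rfl⟩
  · rintro ⟨k, rfl⟩
    exact ⟨(P.bd_mem_iff o _ (Ioo_subset_Ico_self (P.pos_mem o k))).2 ⟨k, rfl⟩,
      (D.disc o).bd_mem _⟩

end PlanarDiagram

namespace GluingMap

variable (G : GluingMap R i P)

theorem image_carrier : G.toFun '' D.outer.carrier = (D'.inner i).carrier := by
  rw [MarkedDisc.carrier_eq, image_union, G.image_interior, G.image_boundary,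
    ← MarkedDisc.carrier_eq]

theorem surface_subset : D.surface ⊆ D.outer.carrier := sdiff_subset

theorem image_subset : G.toFun '' P.carrier ⊆ (D'.inner i).carrier := by
  rw [← G.image_carrier]
  exact image_mono (P.carrier_subset.trans surface_subset)

/-- The image of `P` meets `R` exactly in the points that are glued. -/
theorem glue_iff (x : ℂ) (hx : x ∈ D.outer.carrier) :
    (x ∈ P.carrier ∧ G.toFun x ∈ R.carrier) ↔ x ∈ P.carrier ∧ x ∈ D.outer.boundary := by
  refine and_congr_right fun hxP => ⟨fun h => ?_, fun h => ?_⟩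
  · have h1 : G.toFun x ∉ (D'.inner i).interior := fun h' =>
      (R.carrier_subset h).2 (mem_iUnion.2 ⟨i, h'⟩)
    rw [MarkedDisc.carrier_eq] at hx
    refine hx.resolve_left fun h2 => h1 ?_
    rw [← G.image_interior]
    exact mem_image_of_mem _ h2
  · obtain ⟨k, rfl⟩ := (P.mem_boundary_iff none x).1 ⟨hxP, h⟩
    have := (R.mem_boundary_iff (some i) _).2 ⟨k, rfl⟩
    exact (G.map_pt k).symm ▸ this.1

/-- If `G x` lies in `R`, for a boundary point `x` of the outer disc, then `x` lies in `P`. -/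
theorem mem_of_map_mem {x : ℂ} (hx : x ∈ D.outer.boundary) (h : G.toFun x ∈ R.carrier) :
    x ∈ P.carrier := by
  have hb : G.toFun x ∈ (D'.inner i).boundary := by
    rw [← G.image_boundary]; exact mem_image_of_mem _ hx
  obtain ⟨k, hk⟩ := (R.mem_boundary_iff (some i) _).1 ⟨h, hb⟩
  have h1 := (P.mem_boundary_iff none (P.pt none k)).2 ⟨k, rfl⟩
  have : P.pt none k = x := by
    refine G.injOn (D.outer.boundary_subset h1.2) (D.outer.boundary_subset hx) ?_
    rw [← hk]; exact G.map_pt k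
  exact this ▸ h1.1

theorem mem_config_boundary (x : ℂ) : x ∈ G.config.boundary ↔
    x ∈ D'.outer.boundary ∨ (∃ j, j ≠ i ∧ x ∈ (D'.inner j).boundary) ∨
      ∃ j, x ∈ G.toFun '' (D.inner j).boundary := by
  have : ∀ j, (G.config.disc (some (Sum.inr j))).boundary = G.toFun '' (D.inner j).boundary :=
    fun j => image_comp G.toFun (D.inner j).toFun _
  simp only [DiscConfiguration.boundary, mem_iUnion, Option.exists, Sum.exists, this]
  refine or_congr Iff.rfl (or_congr ?_ Iff.rfl)
  exact ⟨fun ⟨⟨j, hj⟩, h⟩ => ⟨j, hj, h⟩, fun ⟨j, hj, h⟩ => ⟨⟨j, hj⟩, h⟩⟩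

theorem mem_boundary (x : ℂ) : x ∈ D.boundary ↔
    x ∈ D.outer.boundary ∨ ∃ j, x ∈ (D.inner j).boundary := by
  simp only [DiscConfiguration.boundary, mem_iUnion, Option.exists]
  rfl

theorem mem_image_iff {S : Set ℂ} (hS : S ⊆ D.outer.carrier) {y : ℂ} (hy : y ∈ D.outer.carrier) :
    G.toFun y ∈ G.toFun '' S ↔ y ∈ S :=
  ⟨fun ⟨_, hz, h⟩ => G.injOn (hS hz) hy h ▸ hz, fun h => mem_image_of_mem _ h⟩

theorem map_mem_interior {j : ι} {y : ℂ} (hy : y ∈ (D.inner j).carrier) :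
    G.toFun y ∈ (D'.inner i).interior := by
  rw [← G.image_interior]
  exact mem_image_of_mem _ (D.inner_subset j hy)

theorem notMem_interior {x : ℂ} (hx : x ∈ R.carrier) : x ∉ (D'.inner i).interior := fun h =>
  (R.carrier_subset hx).2 (mem_iUnion.2 ⟨i, h⟩)

theorem image_isCurveFamily : IsCurveFamily (G.toFun '' (P.carrier ∩ D.boundary))
    ((fun s => G.toFun '' s) '' P.strands) := by
  have hP := P.isCurveFamily
  have hsub : ∀ s ∈ P.strands, s ⊆ D.outer.carrier := fun s hs =>
    (P.isStrand s hs).1.trans surface_subset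
  have hE : P.carrier ∩ D.boundary ⊆ D.outer.carrier :=
    inter_subset_left.trans (P.carrier_subset.trans surface_subset)
  refine ⟨hP.finite.image _, ?_, ?_, ?_⟩
  · rintro _ ⟨s, hs, rfl⟩ _ ⟨t, ht, rfl⟩ hst
    change Disjoint (G.toFun '' s) (G.toFun '' t)
    rw [Set.disjoint_left]
    rintro _ ⟨y, hy, rfl⟩ hyt
    rw [G.mem_image_iff (hsub t ht) (hsub s hs hy)] at hyt
    exact Set.disjoint_left.1 (hP.disjoint hs ht fun h => hst (congrArg _ h)) hy hyt
  · rintro _ ⟨s, hs, rfl⟩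
    have h1 : G.toFun '' s ∩ G.toFun '' (P.carrier ∩ D.boundary)
        = G.toFun '' (s ∩ (P.carrier ∩ D.boundary)) := by
      rw [(G.injOn).image_inter (hsub s hs) hE]
    rw [h1]
    rcases hP.isCurve s hs with ⟨a, b, hab, h, h2⟩ | ⟨h, h2⟩
    · refine Or.inl ⟨G.toFun a, G.toFun b, ?_, h.image (G.continuousOn.mono (hsub s hs))
        (G.injOn.mono (hsub s hs)), by rw [h2, image_pair]⟩
      exact fun h' => hab (G.injOn (hsub s hs h.left_mem) (hsub s hs h.right_mem) h')
    · exact Or.inr ⟨h.image (G.continuousOn.mono (hsub s hs)) (G.injOn.mono (hsub s hs)),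
        by rw [h2, image_empty]⟩
  · rw [← image_sUnion]
    exact image_mono inter_subset_left

theorem union_subset_surface : R.carrier ∪ G.toFun '' P.carrier ⊆ G.config.surface := by
  rintro x hx
  have hi : ∀ x ∈ (D'.inner i).carrier, ∀ j, j ≠ i → x ∉ (D'.inner j).carrier := fun x hx j hj =>
    Set.disjoint_left.1 (D'.inner_disjoint hj.symm) hx
  refine ⟨?_, ?_⟩
  · rcases hx with hx | hx
    · exact surface_subset (D := D') (R.carrier_subset hx)
    · exact D'.outer.interior_subset (D'.inner_subset i (G.image_subset hx))
  · rw [mem_iUnion]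
    rintro ⟨j | j, hj⟩
    · have hj' : x ∈ (D'.inner j).interior := hj
      rcases hx with hx | hx
      · exact (R.carrier_subset hx).2 (mem_iUnion.2 ⟨j, hj'⟩)
      · exact hi x (G.image_subset hx) j j.2 ((D'.inner j).interior_subset hj')
    · have hj' : x ∈ G.toFun '' (D.inner j).interior := by
        rw [← show _ = G.toFun '' (D.inner j).interior from
          image_comp G.toFun (D.inner j).toFun _]
        exact hj
      obtain ⟨y, hy, rfl⟩ := hj'
      have hyc := (D.inner j).interior_subset hy
      rcases hx with hx | hx
      · exact notMem_interior hx (G.map_mem_interior hyc)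
      · rw [G.mem_image_iff (P.carrier_subset.trans surface_subset)
          (D.outer.interior_subset (D.inner_subset j hyc))] at hx
        exact (P.carrier_subset hx).2 (mem_iUnion.2 ⟨j, hy⟩)

theorem mem_boundary_iff {x : ℂ} (hx : x ∈ R.carrier ∪ G.toFun '' P.carrier) :
    x ∈ G.config.boundary ↔
      x ∈ symmDiff (R.carrier ∩ D'.boundary) (G.toFun '' (P.carrier ∩ D.boundary)) := by
  rw [G.mem_config_boundary, mem_symmDiff]
  have hU : (x ∈ D'.outer.boundary ∨ ∃ j, j ≠ i ∧ x ∈ (D'.inner j).boundary) →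
      x ∉ (D'.inner i).carrier := by
    rintro (h | ⟨j, hj, h⟩) hxi
    · exact Set.disjoint_left.1 D'.outer.disjoint_interior_boundary (D'.inner_subset i hxi) h
    · exact Set.disjoint_left.1 (D'.inner_disjoint hj) ((D'.inner j).boundary_subset h) hxi
  have hV : (∃ j, x ∈ G.toFun '' (D.inner j).boundary) → x ∈ (D'.inner i).interior := by
    rintro ⟨j, y, hy, rfl⟩
    exact G.map_mem_interior ((D.inner j).boundary_subset hy)
  have hR : x ∈ D'.boundary ↔ x ∈ D'.outer.boundary ∨ (∃ j, j ≠ i ∧ x ∈ (D'.inner j).boundary) ∨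
      x ∈ (D'.inner i).boundary := by
    rw [mem_boundary]
    refine or_congr Iff.rfl ⟨fun ⟨j, hj⟩ => ?_, ?_⟩
    · by_cases h : j = i
      · subst h; exact Or.inr hj
      · exact Or.inl ⟨j, h, hj⟩
    · rintro (⟨j, -, hj⟩ | hj)
      exacts [⟨j, hj⟩, ⟨i, hj⟩]
  have hP : x ∈ G.toFun '' (P.carrier ∩ D.boundary) ↔ x ∈ G.toFun '' P.carrier ∧
      (x ∈ (D'.inner i).boundary ∨ ∃ j, x ∈ G.toFun '' (D.inner j).boundary) := by
    have hPc := P.carrier_subset.trans surface_subset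
    have hb : ∀ j, (D.inner j).boundary ⊆ D.outer.carrier := fun j =>
      (D.inner j).boundary_subset.trans ((D.inner_subset j).trans D.outer.interior_subset)
    constructor
    · rintro ⟨y, ⟨hyP, hy⟩, rfl⟩
      refine ⟨mem_image_of_mem _ hyP, ?_⟩
      rcases (mem_boundary y).1 hy with h | ⟨j, h⟩
      · rw [← G.image_boundary]; exact Or.inl (mem_image_of_mem _ h)
      · exact Or.inr ⟨j, mem_image_of_mem _ h⟩
    · rintro ⟨⟨y, hyP, rfl⟩, h⟩
      refine mem_image_of_mem _ ⟨hyP, (mem_boundary y).2 ?_⟩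
      rw [← G.image_boundary, G.mem_image_iff D.outer.boundary_subset (hPc hyP)] at h
      refine h.imp id ?_
      rintro ⟨j, hj⟩
      exact ⟨j, (G.mem_image_iff (hb j) (hPc hyP)).1 hj⟩
  have hC : x ∈ (D'.inner i).boundary → (x ∈ R.carrier ↔ x ∈ G.toFun '' P.carrier) := by
    intro h
    rw [← G.image_boundary] at h
    obtain ⟨y, hy, rfl⟩ := h
    rw [G.mem_image_iff (P.carrier_subset.trans surface_subset) (D.outer.boundary_subset hy)]
    refine ⟨G.mem_of_map_mem hy, fun hyP => ?_⟩
    exact ((G.glue_iff y (D.outer.boundary_subset hy)).2 ⟨hyP, hy⟩).2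
  have h1 : x ∈ (D'.inner i).boundary → x ∈ (D'.inner i).carrier :=
    fun h => (D'.inner i).boundary_subset h
  have h2 : x ∈ (D'.inner i).interior → x ∈ (D'.inner i).carrier :=
    fun h => (D'.inner i).interior_subset h
  have h3 : x ∈ (D'.inner i).interior → x ∉ (D'.inner i).boundary :=
    fun h => Set.disjoint_left.1 (D'.inner i).disjoint_interior_boundary h
  have h4 : x ∈ G.toFun '' P.carrier → x ∈ (D'.inner i).carrier := fun h => G.image_subset h
  have h5 : x ∈ R.carrier → x ∉ (D'.inner i).interior := notMem_interior
  rw [mem_inter_iff, hR, hP]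
  rw [mem_union] at hx
  clear hR hP
  generalize (∃ j, j ≠ i ∧ x ∈ (D'.inner j).boundary) = U at *
  generalize (∃ j, x ∈ G.toFun '' (D.inner j).boundary) = V at *
  generalize (x ∈ G.toFun '' P.carrier) = p at *
  generalize (x ∈ R.carrier) = a at *
  generalize (x ∈ (D'.inner i).boundary) = C at *
  generalize (x ∈ (D'.inner i).interior) = I at *
  generalize (x ∈ (D'.inner i).carrier) = B at *
  generalize (x ∈ D'.outer.boundary) = O at *
  grind

/-- The glued diagram is a family of disjoint arcs and circles, whose end points lie on the
boundary of the glued configuration. -/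
theorem exists_strands : ∃ K : Set (Set ℂ), K.Finite ∧ (∀ s ∈ K, IsStrand G.config s) ∧
    K.PairwiseDisjoint id ∧ ⋃₀ K = R.carrier ∪ G.toFun '' P.carrier := by
  have himg : ⋃₀ ((fun s => G.toFun '' s) '' P.strands) = G.toFun '' P.carrier :=
    image_sUnion.symm
  have hmeet : ∀ x ∈ ⋃₀ ((fun s => G.toFun '' s) '' P.strands), x ∈ ⋃₀ R.strands →
      x ∈ G.toFun '' (P.carrier ∩ D.boundary) ∧ x ∈ R.carrier ∩ D'.boundary := by
    intro x hx hxR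
    rw [himg] at hx
    obtain ⟨y, hy, rfl⟩ := hx
    have hyb := ((G.glue_iff y (surface_subset (P.carrier_subset hy))).1 ⟨hy, hxR⟩).2
    refine ⟨mem_image_of_mem _ ⟨hy, (mem_boundary y).2 (Or.inl hyb)⟩, hxR, ?_⟩
    refine (mem_boundary _).2 (Or.inr ⟨i, ?_⟩)
    rw [← G.image_boundary]
    exact mem_image_of_mem _ hyb
  obtain ⟨K, hK, hU⟩ := R.isCurveFamily.join G.image_isCurveFamily hmeet
  rw [himg] at hU
  refine ⟨K, hK.finite, fun s hs => ?_, hK.disjoint, hU⟩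
  have hsub : s ⊆ R.carrier ∪ G.toFun '' P.carrier := by
    have := subset_sUnion_of_mem hs
    rwa [hU] at this
  refine ⟨hsub.trans G.union_subset_surface, ?_⟩
  rw [IsCurveFamily.isCurve_congr fun x hx => G.mem_boundary_iff (hsub hx)]
  exact hK.isCurve s hs

end GluingMap

/-- The glued planar diagram `R ∘ᵢ P`: as a subset of the plane it is the union of `R` and of the
image of `P`. -/
noncomputable def PlanarDiagram.comp (R : PlanarDiagram D' n₀' n') (i : ι')
    (P : PlanarDiagram D (n' i) n) (G : GluingMap R i P) :
    PlanarDiagram G.config n₀' (compSig n' i n) where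
  strands := G.exists_strands.choose
  finite_strands := G.exists_strands.choose_spec.1
  isStrand := G.exists_strands.choose_spec.2.1
  disjoint_strands := G.exists_strands.choose_spec.2.2.1
  pos
    | none => R.pos none
    | some (Sum.inl j) => R.pos (some j)
    | some (Sum.inr j) => P.pos (some j)
  pos_strictMono := by
    rintro (_ | j | j)
    exacts [R.pos_strictMono none, R.pos_strictMono (some j), P.pos_strictMono (some j)]
  pos_mem := by
    rintro (_ | j | j)
    exacts [R.pos_mem none, R.pos_mem (some j), P.pos_mem (some j)]
  bd_mem_iff := by
    intro o t ht
    rw [G.exists_strands.choose_spec.2.2.2]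
    have hi : ∀ x ∈ (D'.inner i).carrier, ∀ j, j ≠ i → x ∉ (D'.inner j).carrier :=
      fun x hx j hj => Set.disjoint_left.1 (D'.inner_disjoint hj.symm) hx
    rcases o with _ | j | j
    · refine Iff.trans ?_ (R.bd_mem_iff none t ht)
      refine ⟨fun h => h.resolve_right fun h' => ?_, Or.inl⟩
      exact Set.disjoint_left.1 D'.outer.disjoint_interior_boundary
        (D'.inner_subset i (G.image_subset h')) (D'.outer.bd_mem t)
    · refine Iff.trans ?_ (R.bd_mem_iff (some j) t ht)
      refine ⟨fun h => h.resolve_right fun h' => ?_, Or.inl⟩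
      exact hi _ (G.image_subset h') j j.2
        ((D'.inner j).boundary_subset ((D'.inner j).bd_mem t))
    · refine Iff.trans ?_ (P.bd_mem_iff (some j) t ht)
      have hbd := (D.inner j).boundary_subset ((D.inner j).bd_mem t)
      change G.toFun ((D.inner j).bd t) ∈ _ ↔ _
      refine ⟨fun h => ?_, fun h => Or.inr (mem_image_of_mem _ h)⟩
      rcases h with h | h
      · exact absurd (G.map_mem_interior hbd) (GluingMap.notMem_interior h)
      · exact (G.mem_image_iff (P.carrier_subset.trans GluingMap.surface_subset)
          (D.outer.interior_subset (D.inner_subset j hbd))).1 h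

theorem PlanarDiagram.carrier_comp (R : PlanarDiagram D' n₀' n') (i : ι')
    (P : PlanarDiagram D (n' i) n) (G : GluingMap R i P) :
    (R.comp i P G).carrier = R.carrier ∪ G.toFun '' P.carrier :=
  G.exists_strands.choose_spec.2.2.2

end Gluing

/-! ### Cleaved links -/

/-- A crossingless perfect matching of `m` points on the boundary circle of a disc: the class, up to
isotopy fixing the end points, of a system of disjoint arcs in the disc that ends in these points. -/
structure NCMatching (m : ℕ) where
  toFun : Fin m → Fin m
  involutive : Function.Involutive toFun
  ne : ∀ k, toFun k ≠ k
  noncrossing : ∀ a b, a < b → b < toFun a → toFun a < toFun b → False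

theorem NCMatching.toFun_injective (m : ℕ) :
    Function.Injective (NCMatching.toFun : NCMatching m → Fin m → Fin m) := by
  rintro ⟨f, _, _, _⟩ ⟨g, _, _, _⟩ h
  cases h
  rfl

instance (m : ℕ) : Finite (NCMatching m) := Finite.of_injective _ (NCMatching.toFun_injective m)

/-- The components of the link formed by an inside and an outside matching of the same points. -/
def LinkComponents {m : ℕ} (inside outside : NCMatching m) : Type :=
  Quot fun k l : Fin m => inside.toFun k = l ∨ outside.toFun k = l

instance {m : ℕ} (f g : NCMatching m) : Finite (LinkComponents f g) :=
  inferInstanceAs (Finite (Quot _))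

/-- The (classes of) cleaved links with `2n` points on the equator: the two matchings in which the
link meets the two sides of the equator, and a decoration of the components by signs. -/
structure CleavedLink (n : ℕ) where
  inside : NCMatching (2 * n)
  outside : NCMatching (2 * n)
  deco : LinkComponents inside outside → ℤˣ

noncomputable instance (n : ℕ) : Fintype (CleavedLink n) :=
  have : Finite (CleavedLink n) :=
    Finite.of_injective
      (fun L : CleavedLink n => (⟨L.inside, L.outside, L.deco⟩ :
        Σ f : NCMatching (2 * n), Σ g : NCMatching (2 * n), LinkComponents f g → ℤˣ))
      (by
        rintro ⟨f, g, s⟩ ⟨f', g', s'⟩ h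
        cases h
        rfl)
  Fintype.ofFinite _

/-- The ring `ℤ[q^{1/2}, q^{-1/2}]`, where `T k` stands for `q^{k/2}`. -/
abbrev QRing : Type := LaurentPolynomial ℤ

/-- The free module `I_{2n}` on the cleaved links. -/
abbrev CleavedModule (n : ℕ) : Type := CleavedLink n →₀ QRing

/-! ### Multiply cleaved links -/

section MultiplyCleaved

variable {ι : Type*} {D : DiscConfiguration ι} {n₀ : ℕ} {n : ι → ℕ}

/-- The points of a diagram on the boundary circles. -/
abbrev BoundaryPoint (n₀ : ℕ) (n : ι → ℕ) : Type _ := Σ o : Option ι, Fin (2 * sig n₀ n o)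

/-- A choice of crossingless matchings that complete a diagram to a link in the sphere: one in each
inner disc, and one (for `none`) in the disc outside `D₀`. -/
abbrev Filling (n₀ : ℕ) (n : ι → ℕ) : Type _ := ∀ o : Option ι, NCMatching (2 * sig n₀ n o)

/-- The circles of the link obtained from `P` by a filling: the strands of `P`, where strands are
identified if the filling connects an end point of one to an end point of the other. -/
def PlanarDiagram.Circles (P : PlanarDiagram D n₀ n) (f : Filling n₀ n) : Type :=
  Quot fun s t : P.strands => ∃ o k, P.pt o k ∈ s.1 ∧ P.pt o ((f o).toFun k) ∈ t.1

instance (P : PlanarDiagram D n₀ n) (f : Filling n₀ n) : Finite (P.Circles f) :=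
  have : Finite P.strands := P.finite_strands
  inferInstanceAs (Finite (Quot _))

noncomputable instance (P : PlanarDiagram D n₀ n) (f : Filling n₀ n) : Fintype (P.Circles f) :=
  Fintype.ofFinite _

/-- The set `𝓜(P)` of decorated multiply cleaved links whose planar diagram is `P`.  No component of
such a link lies in an inner disc or outside `D₀`, so it is given by arcs that complete `P`. -/
structure MultiplyCleavedLink (P : PlanarDiagram D n₀ n) where
  filling : Filling n₀ n
  deco : P.Circles filling → ℤˣ

noncomputable instance [Finite ι] (P : PlanarDiagram D n₀ n) : Fintype (MultiplyCleavedLink P) :=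
  have : Finite (MultiplyCleavedLink P) :=
    Finite.of_injective
      (fun M : MultiplyCleavedLink P => (⟨M.filling, M.deco⟩ :
        Σ f : Filling n₀ n, P.Circles f → ℤˣ))
      (by
        rintro ⟨f, s⟩ ⟨f', s'⟩ h
        cases h
        rfl)
  Fintype.ofFinite _

namespace MultiplyCleavedLink

variable {P : PlanarDiagram D n₀ n}

/-- The number of boundary circles `∂Dᵢ`, `i ≥ 0`, that meet the circle `C`. -/
noncomputable def discCount (M : MultiplyCleavedLink P) (C : P.Circles M.filling) : ℕ :=
  {o : Option ι | ∃ (k : _) (s : P.strands), P.pt o k ∈ s.1 ∧ Quot.mk _ s = C}.ncard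

/-- The weight: a circle `C` that meets `N` boundary circles contributes `q^{1 - N/2}` if it is
decorated by `+`, and `q^{-1 + N/2}` if it is decorated by `-`. -/
noncomputable def weight (M : MultiplyCleavedLink P) : QRing :=
  ∏ C : P.Circles M.filling, T ((M.deco C : ℤ) * (2 - (M.discCount C : ℤ)))

/-- Two points on the boundary circles are connected in the part of the link outside the disc `o`
(for `o = none`: in the part inside `D₀`). -/
def ConnectedAwayFrom (M : MultiplyCleavedLink P) (o : Option ι) :
    BoundaryPoint n₀ n → BoundaryPoint n₀ n → Prop :=
  Relation.EqvGen fun x y =>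
    (∃ s ∈ P.strands, P.pt x.1 x.2 ∈ s ∧ P.pt y.1 y.2 ∈ s) ∨
      (x.1 ≠ o ∧ y = ⟨x.1, (M.filling x.1).toFun x.2⟩)

/-- `L` is the boundary `∂ₒ M`: it consists of the circles of `M` that meet the boundary circle of
the disc `o`, with their decorations.  On the side of that circle where `M` was filled in, the
matching of `L` is the filling; on the other side, it matches the points that `M` connects there. -/
def IsBoundary (M : MultiplyCleavedLink P) : ∀ o : Option ι, CleavedLink (sig n₀ n o) → Prop
  | none, L =>
    L.outside = M.filling none ∧
      (∀ k, M.ConnectedAwayFrom none ⟨none, k⟩ ⟨none, L.inside.toFun k⟩) ∧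
      ∀ (k : _) (s : P.strands), P.pt none k ∈ s.1 → L.deco (Quot.mk _ k) = M.deco (Quot.mk _ s)
  | some i, L =>
    L.inside = M.filling (some i) ∧
      (∀ k, M.ConnectedAwayFrom (some i) ⟨some i, k⟩ ⟨some i, L.outside.toFun k⟩) ∧
      ∀ (k : _) (s : P.strands), P.pt (some i) k ∈ s.1 →
        L.deco (Quot.mk _ k) = M.deco (Quot.mk _ s)

end MultiplyCleavedLink

/-! ### Partition maps -/

open Classical in
/-- The value of the partition map on a tensor product of generators: the sum of
`W(M,σ) I_{∂₀(M,σ)}` over all `(M,σ) ∈ 𝓜(P)` with `∂ᵢ(M,σ) = Lᵢ` for all `i`. -/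
noncomputable def PlanarDiagram.genValue [Finite ι] (P : PlanarDiagram D n₀ n)
    (L : ∀ i, CleavedLink (n i)) : CleavedModule n₀ :=
  ∑ M : MultiplyCleavedLink P, ∑ L₀ : CleavedLink n₀,
    if M.IsBoundary none L₀ ∧ ∀ i, M.IsBoundary (some i) (L i) then
      Finsupp.single L₀ M.weight else 0

open Classical in
/-- The partition map `Z_P`, the linear extension of `genValue`. -/
noncomputable def PlanarDiagram.partitionMap [Fintype ι] (P : PlanarDiagram D n₀ n) :
    (⨂[QRing] i, CleavedModule (n i)) →ₗ[QRing] CleavedModule n₀ :=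
  PiTensorProduct.lift (∑ L : ∀ i, CleavedLink (n i),
    ((MultilinearMap.mkPiAlgebra QRing ι QRing).compLinearMap
      fun i => Finsupp.lapply (L i)).smulRight (P.genValue L))

/-- The partition map on generators. -/
theorem PlanarDiagram.partitionMap_tprod_single [Fintype ι] (P : PlanarDiagram D n₀ n)
    (L : ∀ i, CleavedLink (n i)) :
    P.partitionMap (PiTensorProduct.tprod QRing fun i => Finsupp.single (L i) (1 : QRing)) =
      P.genValue L := by
  classical
  rw [partitionMap, PiTensorProduct.lift.tprod, sum_apply]
  rw [Finset.sum_eq_single L]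
  · simp
  · intro L' _ hL'
    obtain ⟨i, hi⟩ := Function.ne_iff.1 hL'
    have : ∏ j, (Finsupp.single (L j) (1 : QRing)) (L' j) = 0 :=
      Finset.prod_eq_zero (Finset.mem_univ i) (Finsupp.single_eq_of_ne hi)
    simp [this]
  · simp

end MultiplyCleaved

/-! ### Composition of multilinear operations -/

section OperadicComp

variable {A : Type*} [CommSemiring A] {ι ι' : Type*} {V : ℕ → Type*} [∀ m, AddCommMonoid (V m)]
  [∀ m, Module A (V m)] {n : ι → ℕ} {n' : ι' → ℕ} {i : ι'}

open Classical in
/-- The family with entry `v` at the index `i`, and the entries of `a` at the other indices. -/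
noncomputable def insertEntry (i : ι') (a : ∀ j : {j : ι' // j ≠ i}, V (n' j)) (v : V (n' i)) :
    ∀ j, V (n' j) :=
  Function.update (fun j => if h : j ≠ i then a ⟨j, h⟩ else 0) i v

open Classical in
theorem insertEntry_update_left (a : ∀ j : {j : ι' // j ≠ i}, V (n' j)) (v : V (n' i))
    (j : {j : ι' // j ≠ i}) (x : V (n' j)) :
    insertEntry i (Function.update a j x) v = Function.update (insertEntry i a v) j x := by
  funext k
  by_cases hk : k = i
  · subst hk
    simp [insertEntry, Function.update_of_ne j.2.symm]
  · by_cases hkj : k = j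
    · subst hkj
      simp [insertEntry, hk]
    · have : (⟨k, hk⟩ : {j : ι' // j ≠ i}) ≠ j := fun h => hkj (congrArg Subtype.val h)
      simp [insertEntry, hk, hkj, this]

open Classical in
theorem insertEntry_update_right (a : ∀ j : {j : ι' // j ≠ i}, V (n' j)) (v w : V (n' i)) :
    insertEntry i a w = Function.update (insertEntry i a v) i w := by
  simp [insertEntry]

section Update

variable {α β : Type*} {W : α ⊕ β → Type*} [DecidableEq (α ⊕ β)]

theorem update_inl_inl [DecidableEq α] (x : ∀ k, W k) (j : α) (v : W (Sum.inl j)) :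
    (fun l => Function.update x (Sum.inl j) v (Sum.inl l)) =
      Function.update (fun l => x (Sum.inl l)) j v := by
  funext l
  by_cases h : l = j
  · subst h; simp
  · simp [h]

theorem update_inr_inr [DecidableEq β] (x : ∀ k, W k) (j : β) (v : W (Sum.inr j)) :
    (fun l => Function.update x (Sum.inr j) v (Sum.inr l)) =
      Function.update (fun l => x (Sum.inr l)) j v := by
  funext l
  by_cases h : l = j
  · subst h; simp
  · simp [h]

theorem update_inl_inr (x : ∀ k, W k) (j : α) (v : W (Sum.inl j)) :
    (fun l => Function.update x (Sum.inl j) v (Sum.inr l)) = fun l => x (Sum.inr l) := by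
  funext l; simp

theorem update_inr_inl (x : ∀ k, W k) (j : β) (v : W (Sum.inr j)) :
    (fun l => Function.update x (Sum.inr j) v (Sum.inl l)) = fun l => x (Sum.inl l) := by
  funext l; simp

end Update

open Classical in
/-- The composite `F ∘ᵢ G`: insert the value of `G` into the `i`-th entry of `F`. -/
noncomputable def operadicComp {m : ℕ} (F : (⨂[A] j, V (n' j)) →ₗ[A] V m) (i : ι')
    (G : (⨂[A] k, V (n k)) →ₗ[A] V (n' i)) :
    (⨂[A] k : {j : ι' // j ≠ i} ⊕ ι, V (compSig n' i n k))
      →ₗ[A] V m :=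
  PiTensorProduct.lift
    { toFun := fun x => F (PiTensorProduct.tprod A
        (insertEntry i (fun j => x (Sum.inl j))
          (G (PiTensorProduct.tprod A fun k => x (Sum.inr k)))))
      map_update_add' := by
        intro inst x k v w
        obtain rfl : inst = Classical.decEq _ := Subsingleton.elim _ _
        rcases k with j | k
        · simp only [update_inl_inl, update_inl_inr, insertEntry_update_left]
          rw [MultilinearMap.map_update_add, map_add]
        · simp only [update_inr_inl, update_inr_inr]
          rw [MultilinearMap.map_update_add, map_add, insertEntry_update_right _ 0,
            MultilinearMap.map_update_add, map_add, ← insertEntry_update_right,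
            ← insertEntry_update_right]
      map_update_smul' := by
        intro inst x k c v
        obtain rfl : inst = Classical.decEq _ := Subsingleton.elim _ _
        rcases k with j | k
        · simp only [update_inl_inl, update_inl_inr, insertEntry_update_left]
          rw [MultilinearMap.map_update_smul, map_smul]
        · simp only [update_inr_inl, update_inr_inr]
          rw [MultilinearMap.map_update_smul, map_smul, insertEntry_update_right _ 0,
            MultilinearMap.map_update_smul, map_smul, ← insertEntry_update_right] }

/-- The composite on a pure tensor:
`(F ∘ᵢ G)(⊗ a ⊗ ⊗ b) = F (⋯ ⊗ a_{i-1} ⊗ G(⊗ b) ⊗ a_{i+1} ⊗ ⋯)`. -/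
theorem operadicComp_tprod {m : ℕ} (F : (⨂[A] j, V (n' j)) →ₗ[A] V m)
    (G : (⨂[A] k, V (n k)) →ₗ[A] V (n' i)) (a : ∀ j : {j : ι' // j ≠ i}, V (n' j))
    (b : ∀ k, V (n k)) :
    operadicComp F i G (PiTensorProduct.tprod A
      (Sum.rec a b : ∀ k, V (compSig n' i n k))) =
    F (PiTensorProduct.tprod A (insertEntry i a (G (PiTensorProduct.tprod A b)))) := by
  rw [operadicComp, PiTensorProduct.lift.tprod]
  rfl

end OperadicComp

/-!
Both sides of the composition formula are sums over decorated links, so it suffices to compare the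
terms for a generator `⨂ⱼ I_{Lⱼ} ⊗ ⨂ₖ I_{Lₖ}`.  On the right there is one term for each pair
`(N, M)` of decorated links on `R` and `P` with the prescribed boundaries at the inner discs and
with `∂₀ M = ∂ᵢ N`; on the left there is one term for each decorated link `Q` on `R ∘ᵢ P` with the
prescribed boundaries.  Cutting `Q` along the glued circle and gluing `N` and `M` along it are
inverse to each other (`GluingMap.exists_parts`, `GluingMap.exists_glues`,
`GluingMap.Glues.unique_comp`, `GluingMap.Glues.unique_parts`), and this bijection preserves the
other boundaries and the weight.

*The cut pieces are links in the sense of the definition.*  When `Q` is cut, the disc `D'ᵢ` of `R`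
has to be filled by the matching that `P` and the fillings of its inner discs induce on the points
of the glued circle, and the outside of `D₀` by the one that `R` induces.  That this is a matching
is combinatorial: strands and fillings are two involutions on the boundary points, and a dihedral
orbit with one end has exactly one other end (`exists_unique_other_fixedPoint`).  That it is
crossingless is the topological core of the proof (`PlanarDiagram.away_of_crossing`).  The fillings
are realized by disjoint arcs outside the surface, so that two crossing connections would be
disjoint paths `α`, `β` in a disc, or in the complement of an embedded disc, with end points that
alternate on the boundary circle.  Then `α s - β t` has no zero on the square, so its winding number
on the boundary of the square is zero; but the positions of the end points give `±1`.  For a round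
disc this is a computation with principal logarithms (`exists_eq_of_crossing_closedBall`).  For the
outside of an embedded disc `δ` the computation is the same, because `(δ x - δ y) / (x - y)` has a
continuous logarithm on the pairs of distinct points (`HasDifferenceLog`); in particular the
Schoenflies theorem is not needed (`exists_eq_of_crossing_compl`).

*Circles.*  The strands of `R ∘ᵢ P` are the strands of `R` and `P`, glued at the points of the glued
circle (`GluingMap.eq_of_toComp_eq`).  The circles of a link that meet a boundary circle are the
components of the cleaved link formed by the filling and the induced matching
(`PlanarDiagram.circle_eq_iff_eqvGen`).  As `N` and `M` have the same cleaved link on the glued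
circle, a circle of `Q` is a circle of `N` or of `M` that does not meet it, or it is the union of
one circle of each (`GluingMap.circleCode`).

*Weights.*  In the last case both pieces meet the glued circle, which does not count for `Q`; so
`N(C) + 2` is the sum of the two disc counts, and `1 - N(C) / 2` is the sum of the two exponents
(`GluingMap.Glues.weight_eq`).
-/

/-! ### Continuous logarithms -/

/-- A homotopy of nowhere vanishing functions lifts through `exp`, starting from a given continuous
logarithm. -/
theorem exists_log_of_homotopy {A : Type*} [TopologicalSpace A] (H : unitInterval × A → ℂ)
    (hH : Continuous H) (h0 : ∀ p, H p ≠ 0) (f : A → ℂ) (hf : Continuous f)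
    (hfH : ∀ a, Complex.exp (f a) = H (0, a)) :
    ∃ l : unitInterval × A → ℂ, Continuous l ∧ (∀ p, Complex.exp (l p) = H p) ∧
      ∀ a, l (0, a) = f a := by
  let H' : C(unitInterval × A, {z : ℂ // z ≠ 0}) :=
    ⟨fun p => ⟨H p, h0 p⟩, by fun_prop⟩
  have h : ∀ a, H' (0, a) = (fun z : ℂ ↦ (⟨_, z.exp_ne_zero⟩ : {z : ℂ // z ≠ 0}))
      ((⟨f, hf⟩ : C(A, ℂ)) a) := fun a => Subtype.ext (hfH a).symm
  refine ⟨Complex.isCoveringMap_exp.liftHomotopy H' ⟨f, hf⟩ h, map_continuous _, fun p => ?_,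
    fun a => Complex.isCoveringMap_exp.liftHomotopy_zero H' ⟨f, hf⟩ h a⟩
  exact congrArg Subtype.val
    (congrFun (Complex.isCoveringMap_exp.liftHomotopy_lifts H' ⟨f, hf⟩ h) p)

/-- A continuous logarithm of the constant `1` on a connected set is constant, as its values lie in
`2πiℤ`. -/
theorem eq_of_exp_eq_one {X : Type*} [TopologicalSpace X] {S : Set X} (hS : IsPreconnected S)
    {f : X → ℂ} (hf : ContinuousOn f S) (h : ∀ x ∈ S, Complex.exp (f x) = 1) {x y : X}
    (hx : x ∈ S) (hy : y ∈ S) : f x = f y := by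
  have h2 : (2 * Real.pi * Complex.I : ℂ) ≠ 0 := Complex.two_pi_I_ne_zero
  have h' : ∀ x : X, ∃ n : ℤ, x ∈ S → f x = n * (2 * Real.pi * Complex.I) := by
    intro x
    by_cases hx : x ∈ S
    · obtain ⟨n, hn⟩ := Complex.exp_eq_one_iff.1 (h x hx)
      exact ⟨n, fun _ => hn⟩
    · exact ⟨0, fun h => absurd h hx⟩
  choose n hn using h'
  have hc : ContinuousOn n S := by
    have h3 : ContinuousOn (fun x => (f x / (2 * Real.pi * Complex.I)).re) S :=
      Complex.continuous_re.comp_continuousOn (hf.div_const _)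
    have h4 : ContinuousOn (fun x => ((n x : ℤ) : ℝ)) S := by
      refine h3.congr fun x hx => ?_
      simp only [hn x hx]
      rw [mul_div_cancel_right₀ _ h2, Complex.intCast_re]
    exact Int.isClosedEmbedding_coe_real.isEmbedding.isInducing.continuousOn_iff.2 h4
  rw [hn x hx, hn y hy, hS.constant hc hx hy]

/-- Two continuous logarithms of the same function on a connected set differ by a constant. -/
theorem log_sub_eq {X : Type*} [TopologicalSpace X] {S : Set X} (hS : IsPreconnected S)
    {f g : X → ℂ} (hf : ContinuousOn f S) (hg : ContinuousOn g S)
    (h : ∀ x ∈ S, Complex.exp (f x) = Complex.exp (g x)) {x y : X}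
    (hx : x ∈ S) (hy : y ∈ S) : f x - f y = g x - g y := by
  have := eq_of_exp_eq_one hS (hf.sub hg) (fun x hx => by
    rw [Pi.sub_apply, Complex.exp_sub, h x hx, div_self (Complex.exp_ne_zero _)]) hx hy
  simp only [Pi.sub_apply] at this
  linear_combination this

theorem log_sub_eq_univ {X : Type*} [TopologicalSpace X] [PreconnectedSpace X]
    {f g : X → ℂ} (hf : Continuous f) (hg : Continuous g)
    (h : ∀ x, Complex.exp (f x) = Complex.exp (g x)) (x y : X) : f x - f y = g x - g y :=
  log_sub_eq isPreconnected_univ hf.continuousOn hg.continuousOn (fun x _ => h x)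
    (mem_univ x) (mem_univ y)

theorem exists_log_interval (f : unitInterval → ℂ) (hf : Continuous f) (h0 : ∀ t, f t ≠ 0) :
    ∃ l : unitInterval → ℂ, Continuous l ∧ ∀ t, Complex.exp (l t) = f t := by
  obtain ⟨l, hl, hlf, -⟩ := exists_log_of_homotopy (A := Unit) (fun p => f p.1) (by fun_prop)
    (fun p => h0 _) (fun _ => Complex.log (f 0)) (by fun_prop)
    (fun _ => Complex.exp_log (h0 0))
  exact ⟨fun t => l (t, ()), by fun_prop, fun t => hlf _⟩

theorem exists_log_square (f : unitInterval × unitInterval → ℂ) (hf : Continuous f)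
    (h0 : ∀ p, f p ≠ 0) :
    ∃ l : unitInterval × unitInterval → ℂ, Continuous l ∧ ∀ p, Complex.exp (l p) = f p := by
  obtain ⟨l, hl, hlf⟩ := exists_log_interval (fun t => f (0, t)) (by fun_prop) (fun t => h0 _)
  obtain ⟨m, hm, hmf, -⟩ := exists_log_of_homotopy f hf h0 l hl hlf
  exact ⟨m, hm, hmf⟩

/-! ### Embedded discs and directions -/

/-- The pairs of distinct points of the closed unit disc. -/
abbrev DistinctPair : Type := {p : ℂ × ℂ // ‖p.1‖ ≤ 1 ∧ ‖p.2‖ ≤ 1 ∧ p.1 ≠ p.2}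

/-- The function `δ` on the closed unit disc is injective with differences `δ x - δ y` that turn in
the same way as `x - y`: their quotient has a continuous logarithm. -/
def HasDifferenceLog (δ : ℂ → ℂ) : Prop :=
  ∃ k : ℂ × ℂ → ℂ, ContinuousOn k {p | ‖p.1‖ ≤ 1 ∧ ‖p.2‖ ≤ 1 ∧ p.1 ≠ p.2} ∧
    ∀ x y : ℂ, ‖x‖ ≤ 1 → ‖y‖ ≤ 1 → x ≠ y → δ x - δ y = (x - y) * Complex.exp (k (x, y))

/-- The hypothesis that the loop winds once around `e 0` says that `(e u - e 0) / u` has a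
continuous logarithm on the unit circle; here it is extended to `u ≠ 0` by a radial projection. -/
theorem IsPositive.exists_log {e : ℂ → ℂ} (he : IsPositive e) :
    ∃ K : ℂ → ℂ, ContinuousOn K {0}ᶜ ∧
      ∀ u : ℂ, u ≠ 0 → Complex.exp (K u) = (e (u / ‖u‖) - e 0) / (u / ‖u‖) := by
  obtain ⟨g, hg, hge, hg1⟩ := he
  have hper : ∀ t, g (t + 1) = g t + 2 * Real.pi * Complex.I := by
    intro t
    have := log_sub_eq_univ (f := fun t => g (t + 1)) (g := g) (by fun_prop) hg (fun t => by
      rw [hge, hge]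
      congr 2
      push_cast
      rw [mul_add, Complex.exp_add]
      simp) t 0
    simp only [zero_add, hg1] at this
    linear_combination this
  let q : ℝ → ℂ := fun s => g (s / (2 * Real.pi)) - s * Complex.I
  have hq : Continuous q := by fun_prop
  have hqp : Function.Periodic q (2 * Real.pi) := by
    intro s
    simp only [q]
    rw [add_div, div_self (by positivity), hper]
    push_cast
    ring
  let Q : Real.Angle → ℂ := hqp.lift
  have hQ : Continuous Q := continuous_coinduced_dom.mpr hq
  refine ⟨fun u => Q (Complex.arg u), ?_, fun u hu => ?_⟩
  · intro u hu
    exact (hQ.continuousAt.comp (Complex.continuousAt_arg_coe_angle hu)).continuousWithinAt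
  · have hn : (‖u‖ : ℂ) ≠ 0 := by exact_mod_cast norm_ne_zero_iff.2 hu
    have h1 : u / ‖u‖ = Complex.exp (Complex.arg u * Complex.I) := by
      rw [div_eq_iff hn, mul_comm, Complex.norm_mul_exp_arg_mul_I]
    have h2 : Q (Complex.arg u) = q (Complex.arg u) := hqp.lift_coe _
    beta_reduce
    rw [h2, h1]
    simp only [q]
    rw [Complex.exp_sub, hge]
    congr 4
    push_cast
    field_simp

/-- On an embedded disc, differences turn in the same way as in the unit disc.  The space of pairs
of distinct points of the unit disc retracts to the pairs `(u, 0)` with `u` on the unit circle: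
slide `(x, y)` to `((x - y) / 2, 0)`, then move the first point out radially.  On these pairs the
logarithm is given by the orientation of the disc. -/
theorem MarkedDisc.hasDifferenceLog (e : MarkedDisc) : HasDifferenceLog e.toFun := by
  obtain ⟨K, hK, hKe⟩ := e.positive.exists_log
  have hmem : ∀ z : ℂ, ‖z‖ ≤ 1 ↔ z ∈ Metric.closedBall (0 : ℂ) 1 := fun z => by simp
  have hne : ∀ x y : ℂ, ‖x‖ ≤ 1 → ‖y‖ ≤ 1 → x ≠ y → e.toFun x - e.toFun y ≠ 0 :=
    fun x y hx hy hxy h => hxy (e.injOn ((hmem x).1 hx) ((hmem y).1 hy) (sub_eq_zero.1 h))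
  -- a logarithm of `(e u - e 0) / u`, by moving `u` radially to the unit circle
  have step1 : ∃ k : {u : ℂ // ‖u‖ ≤ 1 ∧ u ≠ 0} → ℂ, Continuous k ∧
      ∀ u, Complex.exp (k u) = (e.toFun u - e.toFun 0) / u := by
    let s : unitInterval × {u : ℂ // ‖u‖ ≤ 1 ∧ u ≠ 0} → ℂ := fun p =>
      p.2.1 * ((1 - (p.1 : ℝ)) / ‖p.2.1‖ + (p.1 : ℝ))
    have hn0 : ∀ u : {u : ℂ // ‖u‖ ≤ 1 ∧ u ≠ 0}, (‖u.1‖ : ℂ) ≠ 0 := fun u => by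
      exact_mod_cast norm_ne_zero_iff.2 u.2.2
    have hs : Continuous s := by
      have : Continuous fun p : unitInterval × {u : ℂ // ‖u‖ ≤ 1 ∧ u ≠ 0} =>
          (1 - (p.1 : ℝ) : ℂ) / ‖p.2.1‖ :=
        Continuous.div (by fun_prop) (by fun_prop) fun p => hn0 _
      fun_prop
    have hsn : ∀ p, ‖s p‖ = (1 - (p.1 : ℝ)) + p.1 * ‖p.2.1‖ := by
      intro p
      have hp := norm_pos_iff.2 p.2.2.2
      have h1 : (((1 - (p.1 : ℝ)) / ‖p.2.1‖ + (p.1 : ℝ) : ℝ) : ℂ) =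
        ((1 - (p.1 : ℝ)) / ‖p.2.1‖ + (p.1 : ℝ) : ℂ) := by push_cast; rfl
      have h3 := sub_nonneg.2 p.1.2.2
      have h4 := p.1.2.1
      simp only [s]
      rw [← h1, norm_mul, Complex.norm_real, Real.norm_of_nonneg (by positivity)]
      field_simp
    have hs1 : ∀ p, ‖s p‖ ≤ 1 := by
      intro p
      rw [hsn]
      nlinarith [p.1.2.1, p.2.2.1]
    have hs0 : ∀ p, s p ≠ 0 := by
      intro p
      rw [← norm_pos_iff, hsn]
      have hp := norm_pos_iff.2 p.2.2.2
      have h3 := sub_nonneg.2 p.1.2.2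
      rcases h3.eq_or_lt with h | h
      · rw [← h, ← sub_eq_zero.1 h.symm]; simpa using hp
      · have := mul_nonneg p.1.2.1 hp.le
        linarith
    obtain ⟨l, hl, hlH, -⟩ := exists_log_of_homotopy
      (fun p => (e.toFun (s p) - e.toFun 0) / s p)
      (((e.continuousOn.comp_continuous hs fun p => (hmem _).1 (hs1 p)).sub
        continuous_const).div hs hs0)
      (fun p => div_ne_zero (hne _ _ (hs1 p) (by simp) (hs0 p)) (hs0 p))
      (fun u => K u.1) (hK.comp_continuous continuous_subtype_val fun u => u.2.2)
      (fun u => by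
        rw [hKe _ u.2.2]
        have : s (0, u) = u.1 / ‖u.1‖ := by simp [s, div_eq_mul_inv]
        rw [this])
    refine ⟨fun u => l (1, u), by fun_prop, fun u => ?_⟩
    rw [hlH]
    simp [s]
  obtain ⟨k1, hk1, hk1e⟩ := step1
  -- join `((x - y) / 2, 0)` to `(x, y)` through distinct pairs: at time `s` the pair is divided by
  -- `2 - s`, and its difference stays a positive multiple of `x - y`
  let x : unitInterval × DistinctPair → ℂ := fun p =>
    (p.2.1.1 - (1 - (p.1 : ℝ) : ℝ) * p.2.1.2) / (2 - (p.1 : ℝ) : ℝ)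
  let y : unitInterval × DistinctPair → ℂ := fun p =>
    ((p.1 : ℝ) * p.2.1.2) / (2 - (p.1 : ℝ) : ℝ)
  have hd : ∀ p : unitInterval × DistinctPair, 0 < 2 - (p.1 : ℝ) := fun p => by linarith [p.1.2.2]
  have hdc : ∀ p : unitInterval × DistinctPair, ((2 - (p.1 : ℝ) : ℝ) : ℂ) ≠ 0 := fun p => by
    exact_mod_cast (hd p).ne'
  have hx : Continuous x := Continuous.div (by fun_prop) (by fun_prop) hdc
  have hy : Continuous y := Continuous.div (by fun_prop) (by fun_prop) hdc
  have hx1 : ∀ p, ‖x p‖ ≤ 1 := by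
    intro p
    simp only [x]
    rw [norm_div, Complex.norm_real, Real.norm_of_nonneg (hd p).le, div_le_one (hd p)]
    refine (norm_sub_le _ _).trans ?_
    have h3 := sub_nonneg.2 p.1.2.2
    rw [norm_mul, Complex.norm_real, Real.norm_of_nonneg h3]
    nlinarith [p.2.2.1, p.2.2.2.1]
  have hy1 : ∀ p, ‖y p‖ ≤ 1 := by
    intro p
    simp only [y]
    rw [norm_div, Complex.norm_real, Real.norm_of_nonneg (hd p).le, div_le_one (hd p)]
    rw [norm_mul, Complex.norm_real, Real.norm_of_nonneg p.1.2.1]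
    nlinarith [p.2.2.2.1, p.1.2.1, p.1.2.2]
  have hxy : ∀ p, x p - y p = (p.2.1.1 - p.2.1.2) / (2 - (p.1 : ℝ) : ℝ) := by
    intro p
    simp only [x, y]
    rw [← sub_div]
    congr 1
    push_cast
    ring
  have hxy0 : ∀ p, x p - y p ≠ 0 := by
    intro p
    rw [hxy]
    exact div_ne_zero (sub_ne_zero.2 p.2.2.2.2) (hdc p)
  have hu : ∀ a : DistinctPair, ‖(a.1.1 - a.1.2) / 2‖ ≤ 1 ∧ (a.1.1 - a.1.2) / 2 ≠ 0 := by
    intro a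
    refine ⟨?_, div_ne_zero (sub_ne_zero.2 a.2.2.2) two_ne_zero⟩
    rw [norm_div, Complex.norm_ofNat, div_le_one two_pos]
    exact (norm_sub_le _ _).trans (by linarith [a.2.1, a.2.2.1])
  obtain ⟨l, hl, hlH, -⟩ := exists_log_of_homotopy
    (fun p => (e.toFun (x p) - e.toFun (y p)) / (x p - y p))
    (((e.continuousOn.comp_continuous hx fun p => (hmem _).1 (hx1 p)).sub
      (e.continuousOn.comp_continuous hy fun p => (hmem _).1 (hy1 p))).div (hx.sub hy) hxy0)
    (fun p => div_ne_zero (hne _ _ (hx1 p) (hy1 p) (sub_ne_zero.1 (hxy0 p))) (hxy0 p))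
    (fun a => k1 ⟨(a.1.1 - a.1.2) / 2, hu a⟩)
    (hk1.comp (Continuous.subtype_mk (by fun_prop) _))
    (fun a => by
      rw [hk1e, hxy]
      have h1 : x (0, a) = (a.1.1 - a.1.2) / 2 := by simp [x]
      have h2 : y (0, a) = 0 := by simp [y]
      rw [h1, h2]
      simp)
  classical
  refine ⟨fun p => if h : ‖p.1‖ ≤ 1 ∧ ‖p.2‖ ≤ 1 ∧ p.1 ≠ p.2 then l (1, ⟨p, h⟩) else 0, ?_, ?_⟩
  · rw [continuousOn_iff_continuous_domRestrict]
    have : Continuous fun a : DistinctPair => l (1, a) := by fun_prop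
    refine this.congr fun a => ?_
    rw [Set.domRestrict_apply, dif_pos (show ‖a.1.1‖ ≤ 1 ∧ ‖a.1.2‖ ≤ 1 ∧ a.1.1 ≠ a.1.2 from a.2)]
  · intro z w hz hw hzw
    simp only
    rw [dif_pos ⟨hz, hw, hzw⟩, hlH]
    have h1 : x (1, ⟨(z, w), hz, hw, hzw⟩) = z := by simp [x]; norm_num
    have h2 : y (1, ⟨(z, w), hz, hw, hzw⟩) = w := by simp [y]; norm_num
    rw [h1, h2, mul_div_cancel₀ _ (sub_ne_zero.2 hzw)]

/-- If `e` and `e ∘ δ` are positively oriented embedded discs, so is `δ`: the logarithms of the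
difference quotients subtract. -/
theorem HasDifferenceLog.of_comp {e δ : ℂ → ℂ} (he : HasDifferenceLog e)
    (hδ : ContinuousOn δ (Metric.closedBall 0 1)) (hδi : InjOn δ (Metric.closedBall 0 1))
    (hδm : MapsTo δ (Metric.closedBall 0 1) (Metric.closedBall 0 1))
    (h : HasDifferenceLog (e ∘ δ)) : HasDifferenceLog δ := by
  obtain ⟨k, hk, hke⟩ := he
  obtain ⟨m, hm, hme⟩ := h
  have hmem : ∀ z : ℂ, ‖z‖ ≤ 1 ↔ z ∈ Metric.closedBall (0 : ℂ) 1 := fun z => by simp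
  refine ⟨fun p => m p - k (δ p.1, δ p.2),
    hm.sub (hk.comp (f := fun p : ℂ × ℂ => (δ p.1, δ p.2)) ?_ ?_), ?_⟩
  · refine ContinuousOn.prodMk ?_ ?_
    · exact hδ.comp continuousOn_fst fun p hp => (hmem _).1 hp.1
    · exact hδ.comp continuousOn_snd fun p hp => (hmem _).1 hp.2.1
  · rintro p ⟨h1, h2, h3⟩
    exact ⟨(hmem _).2 (hδm ((hmem _).1 h1)), (hmem _).2 (hδm ((hmem _).1 h2)),
      fun h => h3 (hδi ((hmem _).1 h1) ((hmem _).1 h2) h)⟩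
  · intro x y hx hy hxy
    have h1 := hke (δ x) (δ y) ((hmem _).2 (hδm ((hmem _).1 hx))) ((hmem _).2 (hδm ((hmem _).1 hy)))
      fun h => hxy (hδi ((hmem _).1 hx) ((hmem _).1 hy) h)
    have h2 := hme x y hx hy hxy
    simp only [Function.comp_apply] at h2
    rw [Complex.exp_sub, ← mul_div_assoc, ← h2, h1, mul_div_cancel_right₀ _ (Complex.exp_ne_zero _)]

/-! ### Paths with crossing end points -/

/-- The point of the unit circle at `t`, where the circle has length `1`. -/
noncomputable def circlePoint (t : ℝ) : ℂ := Complex.exp (2 * Real.pi * Complex.I * t)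

theorem continuous_circlePoint : Continuous circlePoint := by
  unfold circlePoint; fun_prop

@[simp] theorem norm_circlePoint (t : ℝ) : ‖circlePoint t‖ = 1 := by
  simpa [circlePoint] using MarkedDisc.exp_mem_sphere t

theorem circlePoint_ne_zero (t : ℝ) : circlePoint t ≠ 0 := Complex.exp_ne_zero _

theorem circlePoint_div (s t : ℝ) : circlePoint s / circlePoint t = circlePoint (s - t) := by
  rw [circlePoint, circlePoint, circlePoint, ← Complex.exp_sub]
  congr 1
  push_cast
  ring

theorem circlePoint_add_one (t : ℝ) : circlePoint (t + 1) = circlePoint t := by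
  rw [circlePoint, circlePoint]
  push_cast
  rw [mul_add, Complex.exp_add]
  simp

theorem circlePoint_eq_iff {s t : ℝ} : circlePoint s = circlePoint t ↔ ∃ n : ℤ, s = t + n := by
  rw [circlePoint, circlePoint, Complex.exp_eq_exp_iff_exists_int]
  refine exists_congr fun n => ?_
  have h : (2 * Real.pi * Complex.I : ℂ) ≠ 0 := Complex.two_pi_I_ne_zero
  rw [show 2 * Real.pi * Complex.I * (t : ℂ) + n * (2 * Real.pi * Complex.I)
    = 2 * Real.pi * Complex.I * (t + n) by ring]
  rw [mul_right_inj' h]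
  exact_mod_cast Iff.rfl

theorem circlePoint_ne {s t : ℝ} (h1 : s < t) (h2 : t < s + 1) :
    circlePoint s ≠ circlePoint t := by
  intro h
  obtain ⟨n, hn⟩ := circlePoint_eq_iff.1 h
  have h3 : (n : ℝ) < 0 := by linarith
  have h4 : (-1 : ℝ) < n := by linarith
  have h5 : n < 0 := by exact_mod_cast h3
  have h6 : -1 < n := by exact_mod_cast h4
  omega

theorem circlePoint_injOn : InjOn circlePoint (Ico 0 1) := by
  intro s hs t ht h
  rcases lt_trichotomy s t with h1 | h1 | h1
  · exact absurd h (circlePoint_ne h1 (by linarith [hs.1, ht.2]))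
  · exact h1
  · exact absurd h.symm (circlePoint_ne h1 (by linarith [ht.1, hs.2]))

/-- The chord from a point of the unit circle to `1` is perpendicular to the direction that bisects
them. -/
theorem arg_one_sub_circlePoint {x : ℝ} (h0 : 0 < x) (h1 : x < 1) :
    (Complex.log (1 - circlePoint x)).im = Real.pi * x - Real.pi / 2 := by
  have hpi := Real.pi_pos
  have hs : 0 < Real.sin (Real.pi * x) :=
    Real.sin_pos_of_pos_of_lt_pi (by positivity) (by nlinarith)
  have h : 1 - circlePoint x = ((2 * Real.sin (Real.pi * x) : ℝ) : ℂ) *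
      Complex.exp ((Real.pi * x - Real.pi / 2 : ℝ) * Complex.I) := by
    have e1 : ((Real.pi * x - Real.pi / 2 : ℝ) * Complex.I : ℂ) =
      Real.pi * x * Complex.I - Real.pi / 2 * Complex.I := by push_cast; ring
    have e2 : (2 * Real.pi * Complex.I * x : ℂ) =
      Real.pi * x * Complex.I + Real.pi * x * Complex.I := by ring
    have e3 : (-(Real.pi * x) * Complex.I : ℂ) = -(Real.pi * x * Complex.I) := by ring
    rw [e1, Complex.exp_sub, Complex.exp_pi_div_two_mul_I, circlePoint, e2, Complex.exp_add]
    push_cast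
    rw [Complex.sin, e3, Complex.exp_neg]
    have hne := Complex.exp_ne_zero (Real.pi * x * Complex.I)
    field_simp
  rw [Complex.log_im, h, Complex.arg_real_mul _ (by positivity), Complex.arg_exp_mul_I,
    toIocMod_eq_self]
  constructor <;> nlinarith

theorem arg_one_sub_circlePoint_neg {x : ℝ} (h0 : -1 < x) (h1 : x < 0) :
    (Complex.log (1 - circlePoint x)).im = Real.pi * x + Real.pi / 2 := by
  rw [← circlePoint_add_one, arg_one_sub_circlePoint (by linarith) (by linarith)]
  ring

/-- For two paths in the unit disc from `a` to `c` and from `b` to `d`, this is the total change of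
the logarithm of their difference on the boundary of the square.  Its imaginary part is `-2π` if the
four points are in cyclic order. -/
theorem sum_log_ne_zero {a b c d : ℝ} (hab : a < b) (hbc : b < c) (hcd : c < d) (hda : d < a + 1) :
    Complex.log (1 - circlePoint (c - b)) - Complex.log (1 - circlePoint (a - b)) +
      (Complex.log (1 - circlePoint (d - c)) - Complex.log (1 - circlePoint (b - c))) +
      (Complex.log (1 - circlePoint (a - d)) - Complex.log (1 - circlePoint (c - d))) +
      (Complex.log (1 - circlePoint (b - a)) - Complex.log (1 - circlePoint (d - a))) ≠ 0 := by
  intro h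
  have := congrArg Complex.im h
  simp only [Complex.add_im, Complex.sub_im, Complex.zero_im] at this
  rw [arg_one_sub_circlePoint (by linarith) (by linarith),
    arg_one_sub_circlePoint_neg (by linarith) (by linarith),
    arg_one_sub_circlePoint (by linarith) (by linarith),
    arg_one_sub_circlePoint_neg (by linarith) (by linarith),
    arg_one_sub_circlePoint_neg (by linarith) (by linarith),
    arg_one_sub_circlePoint_neg (by linarith) (by linarith),
    arg_one_sub_circlePoint (by linarith) (by linarith),
    arg_one_sub_circlePoint (by linarith) (by linarith)] at this
  have hpi := Real.pi_pos
  nlinarith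

/-- The corresponding sum for two paths outside the unit disc, where the roles of the moving point
and of the fixed point in each quotient are exchanged; its imaginary part is `2π`. -/
theorem sum_log_ne_zero' {a b c d : ℝ} (hab : a < b) (hbc : b < c) (hcd : c < d) (hda : d < a + 1) :
    Complex.log (1 - circlePoint (b - c)) - Complex.log (1 - circlePoint (b - a)) +
      (Complex.log (1 - circlePoint (c - d)) - Complex.log (1 - circlePoint (c - b))) +
      (Complex.log (1 - circlePoint (d - a)) - Complex.log (1 - circlePoint (d - c))) +
      (Complex.log (1 - circlePoint (a - b)) - Complex.log (1 - circlePoint (a - d))) ≠ 0 := by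
  intro h
  have := congrArg Complex.im h
  simp only [Complex.add_im, Complex.sub_im, Complex.zero_im] at this
  rw [arg_one_sub_circlePoint_neg (by linarith) (by linarith),
    arg_one_sub_circlePoint (by linarith) (by linarith),
    arg_one_sub_circlePoint_neg (by linarith) (by linarith),
    arg_one_sub_circlePoint (by linarith) (by linarith),
    arg_one_sub_circlePoint (by linarith) (by linarith),
    arg_one_sub_circlePoint (by linarith) (by linarith),
    arg_one_sub_circlePoint_neg (by linarith) (by linarith),
    arg_one_sub_circlePoint_neg (by linarith) (by linarith)] at this
  have hpi := Real.pi_pos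
  nlinarith

/-- `x` is the change of a continuous logarithm of `f` along the unit interval. -/
def IsLogChange (f : unitInterval → ℂ) (x : ℂ) : Prop :=
  ∃ l : unitInterval → ℂ, Continuous l ∧ (∀ t, Complex.exp (l t) = f t) ∧ l 1 - l 0 = x

theorem IsLogChange.unique {f : unitInterval → ℂ} {x : ℂ} (h : IsLogChange f x)
    {m : unitInterval → ℂ} (hm : Continuous m) (hmf : ∀ t, Complex.exp (m t) = f t) :
    m 1 - m 0 = x := by
  obtain ⟨l, hl, hlf, rfl⟩ := h
  exact log_sub_eq_univ hm hl (fun t => by rw [hmf, hlf]) 1 0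

theorem IsLogChange.neg {f : unitInterval → ℂ} {x : ℂ} (h : IsLogChange f x) :
    IsLogChange (fun t => -f t) x := by
  obtain ⟨l, hl, hlf, rfl⟩ := h
  refine ⟨fun t => l t + Real.pi * Complex.I, by fun_prop, fun t => ?_, by ring⟩
  rw [Complex.exp_add, hlf, Complex.exp_pi_mul_I]
  ring

/-- If two paths are disjoint, their difference has winding number `0` on the boundary of the
square. -/
theorem logChange_square {α β : unitInterval → ℂ} (hα : Continuous α) (hβ : Continuous β)
    (hαβ : ∀ s t, α s ≠ β t) {x₀ x₁ y₀ y₁ : ℂ} (h1 : IsLogChange (fun s => α s - β 0) x₀)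
    (h2 : IsLogChange (fun s => α s - β 1) x₁) (h3 : IsLogChange (fun t => β t - α 0) y₀)
    (h4 : IsLogChange (fun t => β t - α 1) y₁) : x₀ + y₁ - x₁ - y₀ = 0 := by
  obtain ⟨l, hl, hlf⟩ := exists_log_square (fun p => α p.1 - β p.2) (by fun_prop)
    fun p => sub_ne_zero.2 (hαβ _ _)
  have e1 := h1.unique (m := fun s => l (s, 0)) (by fun_prop) fun s => hlf _
  have e2 := h2.unique (m := fun s => l (s, 1)) (by fun_prop) fun s => hlf _
  have e3 := h3.neg.unique (m := fun t => l (0, t)) (by fun_prop) fun t => by simp [hlf]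
  have e4 := h4.neg.unique (m := fun t => l (1, t)) (by fun_prop) fun t => by simp [hlf]
  rw [← e1, ← e2, ← e3, ← e4]
  ring

theorem one_sub_mem_slitPlane {z : ℂ} (hz : ‖z‖ ≤ 1) (h1 : z ≠ 1) : 1 - z ∈ Complex.slitPlane := by
  rw [Complex.mem_slitPlane_iff]
  by_contra! h
  obtain ⟨h2, h3⟩ := h
  have h4 := Complex.abs_re_le_norm z
  have h5 : z.re = 1 := by
    have := (le_abs_self _).trans (h4.trans hz)
    simp only [Complex.sub_re, Complex.one_re] at h2
    linarith
  exact h1 (Complex.ext h5 (by simpa using h3))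

/-- Seen from a point of the unit circle, the closed unit disc lies in a half plane, so the
principal logarithm computes the turning of a path. -/
theorem isLogChange_closedBall {γ : unitInterval → ℂ} (hγ : Continuous γ) (h1 : ∀ t, ‖γ t‖ ≤ 1)
    {u v w : ℝ} (hv : γ 0 = circlePoint v) (hw : γ 1 = circlePoint w)
    (hu : ∀ t, γ t ≠ circlePoint u) :
    IsLogChange (fun t => γ t - circlePoint u)
      (Complex.log (1 - circlePoint (w - u)) - Complex.log (1 - circlePoint (v - u))) := by
  have hu0 := circlePoint_ne_zero u
  have hs : ∀ t, 1 - γ t / circlePoint u ∈ Complex.slitPlane := fun t =>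
    one_sub_mem_slitPlane (by simpa using h1 t) fun h => hu t ((div_eq_one_iff_eq hu0).1 h)
  refine ⟨fun t => Complex.log (1 - γ t / circlePoint u) + Complex.log (-circlePoint u), ?_, ?_, ?_⟩
  · refine Continuous.add (Continuous.clog ?_ hs) continuous_const
    fun_prop
  · intro t
    rw [Complex.exp_add, Complex.exp_log (Complex.slitPlane_ne_zero (hs t)),
      Complex.exp_log (neg_ne_zero.2 hu0)]
    field_simp
    ring
  · simp only [hv, hw, circlePoint_div]
    ring

/-- Two paths in the closed unit disc with crossing end points on the unit circle meet. -/
theorem exists_eq_of_crossing_closedBall {α β : unitInterval → ℂ} (hα : Continuous α)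
    (hβ : Continuous β) (hα1 : ∀ t, ‖α t‖ ≤ 1) (hβ1 : ∀ t, ‖β t‖ ≤ 1) {a b c d : ℝ}
    (hab : a < b) (hbc : b < c) (hcd : c < d) (hda : d < a + 1)
    (ha : α 0 = circlePoint a) (hb : β 0 = circlePoint b) (hc : α 1 = circlePoint c)
    (hd : β 1 = circlePoint d) : ∃ s t, α s = β t := by
  by_contra! h
  have := logChange_square hα hβ h
    (hb ▸ isLogChange_closedBall hα hα1 ha hc fun t => hb ▸ h t 0)
    (hd ▸ isLogChange_closedBall hα hα1 ha hc fun t => hd ▸ h t 1)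
    (ha ▸ isLogChange_closedBall hβ hβ1 hb hd fun t => ha ▸ (h 0 t).symm)
    (hc ▸ isLogChange_closedBall hβ hβ1 hb hd fun t => hc ▸ (h 1 t).symm)
  refine sum_log_ne_zero hab hbc hcd hda ?_
  linear_combination this

/-- The turning of a path `γ` outside an embedded disc, seen from a boundary point `δ u`, compared
with its turning seen from the centre `δ 0`.  Moving `δ 0` to `δ u` along the image of a radius does
not meet `γ`, and at the end points `δ v` and `δ w` of `γ` the change is determined by the logarithm
`k` of the difference quotient. -/
theorem isLogChange_compl {δ : ℂ → ℂ} (hδ : ContinuousOn δ (Metric.closedBall 0 1))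
    {k : ℂ × ℂ → ℂ} (hk : ContinuousOn k {p | ‖p.1‖ ≤ 1 ∧ ‖p.2‖ ≤ 1 ∧ p.1 ≠ p.2})
    (hkδ : ∀ x y : ℂ, ‖x‖ ≤ 1 → ‖y‖ ≤ 1 → x ≠ y → δ x - δ y = (x - y) * Complex.exp (k (x, y)))
    {γ : unitInterval → ℂ} (hγ : Continuous γ) (h1 : ∀ t, γ t ∉ δ '' Metric.ball 0 1)
    {u v w : ℝ} (hv : γ 0 = δ (circlePoint v)) (hw : γ 1 = δ (circlePoint w))
    (hu : ∀ t, γ t ≠ δ (circlePoint u)) {x : ℂ} (hx : IsLogChange (fun t => γ t - δ 0) x) :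
    IsLogChange (fun t => γ t - δ (circlePoint u))
      (x + (k (circlePoint w, circlePoint u) - k (circlePoint w, 0)
          + Complex.log (1 - circlePoint (u - w)))
        - (k (circlePoint v, circlePoint u) - k (circlePoint v, 0)
          + Complex.log (1 - circlePoint (u - v)))) := by
  obtain ⟨l₀, hl₀, hl₀γ, rfl⟩ := hx
  have hr : ∀ r : unitInterval, ‖((r : ℝ) : ℂ) * circlePoint u‖ ≤ 1 := fun r => by
    rw [norm_mul, Complex.norm_real, Real.norm_of_nonneg r.2.1, norm_circlePoint, mul_one]
    exact r.2.2
  have hne : ∀ (r : unitInterval) t, γ t - δ (((r : ℝ) : ℂ) * circlePoint u) ≠ 0 := by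
    intro r t h
    rcases r.2.2.lt_or_eq with h' | h'
    · refine h1 t ⟨_, ?_, (sub_eq_zero.1 h).symm⟩
      rw [mem_ball_zero_iff, norm_mul, Complex.norm_real, Real.norm_of_nonneg r.2.1,
        norm_circlePoint, mul_one]
      exact h'
    · rw [h'] at h
      exact hu t (by simpa [sub_eq_zero] using h)
  have hne0 : ∀ t, γ t - δ 0 ≠ 0 := fun t => by
    have := hne 0 t
    simpa using this
  have hδr : Continuous fun r : unitInterval => δ (((r : ℝ) : ℂ) * circlePoint u) :=
    hδ.comp_continuous (by fun_prop) fun r => by simpa using hr r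
  obtain ⟨l, hl, hlH, hl0⟩ := exists_log_of_homotopy
    (fun p : unitInterval × unitInterval =>
      (γ p.2 - δ (((p.1 : ℝ) : ℂ) * circlePoint u)) / (γ p.2 - δ 0))
    (((hγ.comp continuous_snd).sub (hδr.comp continuous_fst)).div (by fun_prop) fun p => hne0 _)
    (fun p => div_ne_zero (hne _ _) (hne0 _)) (fun _ => 0) continuous_const
    (fun t => by simp [div_self (hne0 t)])
  -- the value of the lift over an end point of the path
  have hend : ∀ (t : unitInterval) (z : ℝ), γ t = δ (circlePoint z) →
      l (1, t) = k (circlePoint z, circlePoint u) - k (circlePoint z, 0)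
        + Complex.log (1 - circlePoint (u - z)) := by
    intro t z hz
    have hzu : circlePoint z ≠ circlePoint u := fun h => hu t (h ▸ hz)
    have hz0 := circlePoint_ne_zero z
    have hzr : ∀ r : unitInterval, circlePoint z ≠ ((r : ℝ) : ℂ) * circlePoint u := by
      intro r h
      have h2 := congrArg norm h
      rw [norm_mul, Complex.norm_real, Real.norm_of_nonneg r.2.1, norm_circlePoint,
        norm_circlePoint, mul_one] at h2
      rw [← h2] at h
      exact hzu (by simpa using h)
    have hs : ∀ r : unitInterval,
        1 - ((r : ℝ) : ℂ) * circlePoint u / circlePoint z ∈ Complex.slitPlane := fun r =>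
      one_sub_mem_slitPlane (by simpa using hr r) fun h =>
        hzr r ((div_eq_one_iff_eq hz0).1 h).symm
    have hkr : Continuous fun r : unitInterval =>
        k (circlePoint z, ((r : ℝ) : ℂ) * circlePoint u) :=
      hk.comp_continuous (by fun_prop) fun r => ⟨by simp, hr r, hzr r⟩
    have := log_sub_eq_univ (f := fun r => l (r, t))
      (g := fun r : unitInterval => k (circlePoint z, ((r : ℝ) : ℂ) * circlePoint u)
        - k (circlePoint z, 0)
        + Complex.log (1 - ((r : ℝ) : ℂ) * circlePoint u / circlePoint z)) (by fun_prop)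
      ((hkr.sub continuous_const).add (Continuous.clog (by fun_prop) hs))
      (fun r => by
        rw [hlH, hz, Complex.exp_add, Complex.exp_sub,
          Complex.exp_log (Complex.slitPlane_ne_zero (hs r)),
          hkδ _ _ (by simp) (hr r) (hzr r), hkδ _ _ (by simp) (by simp) hz0]
        have := Complex.exp_ne_zero (k (circlePoint z, 0))
        field_simp
        rw [sub_zero, mul_comm]) 1 0
    simp only [hl0] at this
    simpa [circlePoint_div] using this
  refine ⟨fun t => l (1, t) + l₀ t, by fun_prop, fun t => ?_, ?_⟩
  · rw [Complex.exp_add, hlH, hl₀γ, div_mul_cancel₀ _ (hne0 t)]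
    simp
  · simp only
    rw [hend 0 v hv, hend 1 w hw]
    ring

/-- The logarithm of the difference quotient is symmetric on the unit circle.  The antisymmetric
part is a constant multiple of `2πi`, and it changes its sign when the two points are exchanged by
moving them around the circle. -/
theorem differenceLog_symm {δ : ℂ → ℂ} {k : ℂ × ℂ → ℂ}
    (hk : ContinuousOn k {p | ‖p.1‖ ≤ 1 ∧ ‖p.2‖ ≤ 1 ∧ p.1 ≠ p.2})
    (hkδ : ∀ x y : ℂ, ‖x‖ ≤ 1 → ‖y‖ ≤ 1 → x ≠ y → δ x - δ y = (x - y) * Complex.exp (k (x, y)))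
    {s t : ℝ} (hst : s < t) (hts : t < s + 1) :
    k (circlePoint s, circlePoint t) = k (circlePoint t, circlePoint s) := by
  let S : Set (ℝ × ℝ) := {p | p.1 < p.2 ∧ p.2 < p.1 + 1}
  have hS : IsPreconnected S := by
    refine Convex.isPreconnected ?_
    have h1 : Convex ℝ {p : ℝ × ℝ | p.1 < p.2} := by
      have := convex_halfSpace_lt (𝕜 := ℝ) (E := ℝ × ℝ) (f := fun p => p.1 - p.2)
        ((LinearMap.fst ℝ ℝ ℝ - LinearMap.snd ℝ ℝ ℝ).isLinear) 0
      simpa [sub_lt_zero] using this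
    have h2 : Convex ℝ {p : ℝ × ℝ | p.2 < p.1 + 1} := by
      have := convex_halfSpace_lt (𝕜 := ℝ) (E := ℝ × ℝ) (f := fun p => p.2 - p.1)
        ((LinearMap.snd ℝ ℝ ℝ - LinearMap.fst ℝ ℝ ℝ).isLinear) 1
      simpa [sub_lt_iff_lt_add'] using this
    exact h1.inter h2
  let m : ℝ × ℝ → ℂ := fun p =>
    k (circlePoint p.1, circlePoint p.2) - k (circlePoint p.2, circlePoint p.1)
  have hcirc := continuous_circlePoint
  have hm : ContinuousOn m S := by
    refine ContinuousOn.sub ?_ ?_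
    · refine hk.comp (f := fun p : ℝ × ℝ => (circlePoint p.1, circlePoint p.2))
        (by fun_prop) fun p hp => ⟨by simp, by simp, circlePoint_ne hp.1 hp.2⟩
    · refine hk.comp (f := fun p : ℝ × ℝ => (circlePoint p.2, circlePoint p.1))
        (by fun_prop) fun p hp => ⟨by simp, by simp, (circlePoint_ne hp.1 hp.2).symm⟩
  have hexp : ∀ p ∈ S, Complex.exp (m p) = 1 := by
    intro p hp
    have hne := circlePoint_ne hp.1 hp.2
    have h1 := hkδ (circlePoint p.1) (circlePoint p.2) (by simp) (by simp) hne
    have h2 := hkδ (circlePoint p.2) (circlePoint p.1) (by simp) (by simp) hne.symm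
    rw [Complex.exp_sub, div_eq_one_iff_eq (Complex.exp_ne_zero _)]
    refine mul_left_cancel₀ (sub_ne_zero.2 hne) ?_
    rw [← h1]
    linear_combination -h2
  have h := eq_of_exp_eq_one hS hm hexp (x := (s, t)) (y := (t, s + 1)) ⟨hst, hts⟩
    ⟨hts, by simpa using hst⟩
  simp only [m, circlePoint_add_one] at h
  linear_combination h / 2

/-- Two paths outside an embedded disc with crossing end points on its boundary meet.  In the total
turning on the boundary of the square, the contributions of the paths seen from the centre and of
the embedding cancel, so that the same number `±2πi` remains as for the round disc. -/
theorem exists_eq_of_crossing_compl {δ : ℂ → ℂ} (hδ : ContinuousOn δ (Metric.closedBall 0 1))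
    (hδd : HasDifferenceLog δ)
    {α β : unitInterval → ℂ} (hα : Continuous α)
    (hβ : Continuous β) (hα1 : ∀ t, α t ∉ δ '' Metric.ball 0 1)
    (hβ1 : ∀ t, β t ∉ δ '' Metric.ball 0 1) {a b c d : ℝ}
    (hab : a < b) (hbc : b < c) (hcd : c < d) (hda : d < a + 1)
    (ha : α 0 = δ (circlePoint a)) (hb : β 0 = δ (circlePoint b)) (hc : α 1 = δ (circlePoint c))
    (hd : β 1 = δ (circlePoint d)) : ∃ s t, α s = β t := by
  by_contra! h
  obtain ⟨k, hk, hkδ⟩ := hδd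
  have hne0 : ∀ γ : unitInterval → ℂ, (∀ t, γ t ∉ δ '' Metric.ball 0 1) → ∀ t, γ t - δ 0 ≠ 0 :=
    fun γ hγ t h0 => hγ t ⟨0, by simp, (sub_eq_zero.1 h0).symm⟩
  obtain ⟨lα, hlα, hlα'⟩ := exists_log_interval (fun t => α t - δ 0) (by fun_prop) (hne0 α hα1)
  obtain ⟨lβ, hlβ, hlβ'⟩ := exists_log_interval (fun t => β t - δ 0) (by fun_prop) (hne0 β hβ1)
  have hx : IsLogChange (fun t => α t - δ 0) (lα 1 - lα 0) := ⟨lα, hlα, hlα', rfl⟩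
  have hy : IsLogChange (fun t => β t - δ 0) (lβ 1 - lβ 0) := ⟨lβ, hlβ, hlβ', rfl⟩
  have := logChange_square hα hβ h
    (hb ▸ isLogChange_compl hδ hk hkδ hα hα1 ha hc (fun t => hb ▸ h t 0) hx)
    (hd ▸ isLogChange_compl hδ hk hkδ hα hα1 ha hc (fun t => hd ▸ h t 1) hx)
    (ha ▸ isLogChange_compl hδ hk hkδ hβ hβ1 hb hd (fun t => ha ▸ (h 0 t).symm) hy)
    (hc ▸ isLogChange_compl hδ hk hkδ hβ hβ1 hb hd (fun t => hc ▸ (h 1 t).symm) hy)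
  refine sum_log_ne_zero' hab hbc hcd hda ?_
  have s1 := differenceLog_symm hk hkδ hab (by linarith)
  have s2 := differenceLog_symm hk hkδ hbc (by linarith)
  have s3 := differenceLog_symm hk hkδ hcd (by linarith)
  have s4 := differenceLog_symm hk hkδ (hab.trans (hbc.trans hcd)) hda
  linear_combination this + s1 + s2 + s3 - s4

/-! ### Orbits of two involutions -/

/-- Let `τ` and `φ` be involutions of a finite set, and let `τ` have no fixed point.  The orbit of a
fixed point of `φ` under the dihedral group of `τ` and `φ` contains exactly one other fixed point of
`φ`: the orbit is a path from one to the other. -/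
theorem exists_unique_other_fixedPoint {X : Type*} [Finite X] {τ φ : X → X}
    (hτ : Function.Involutive τ) (hφ : Function.Involutive φ) (hτn : ∀ x, τ x ≠ x) {x : X}
    (hx : φ x = x) :
    ∃ y, y ≠ x ∧ φ y = y ∧ Relation.EqvGen (fun u v => τ u = v ∨ φ u = v) x y ∧
      ∀ z, Relation.EqvGen (fun u v => τ u = v ∨ φ u = v) x z → φ z = z → z = x ∨ z = y := by
  let t : Equiv.Perm X := hτ.toPerm
  let f : Equiv.Perm X := hφ.toPerm
  have htt : t * t = 1 := Equiv.ext hτ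
  have hff : f * f = 1 := Equiv.ext hφ
  have hti : t⁻¹ = t := inv_eq_of_mul_eq_one_right htt
  have hfi : f⁻¹ = f := inv_eq_of_mul_eq_one_right hff
  let σ : Equiv.Perm X := f * t
  have hconj : ∀ m : ℤ, f * σ ^ m = σ ^ (-m) * f := by
    intro m
    have h1 : f * σ * f⁻¹ = σ⁻¹ := by
      simp only [σ]
      rw [mul_inv_rev, hti, hfi, ← mul_assoc, hff, one_mul]
    have h2 : f * σ ^ m * f⁻¹ = σ ^ (-m) := by
      rw [← conj_zpow, h1, inv_zpow, zpow_neg]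
    rw [← h2, inv_mul_cancel_right]
  have hfx : ∀ m : ℤ, φ ((σ ^ m) x) = (σ ^ (-m)) x := by
    intro m
    have := congrArg (fun g : Equiv.Perm X => g x) (hconj m)
    simp only [Equiv.Perm.mul_apply] at this
    exact this.trans (congrArg _ hx)
  have htσ : t = f * σ := by simp only [σ]; rw [← mul_assoc, hff, one_mul]
  have htx : ∀ m : ℤ, τ ((σ ^ m) x) = (σ ^ (-m - 1)) x := by
    intro m
    have h1 : τ ((σ ^ m) x) = (t * σ ^ m) x := rfl
    have h2 : t * σ ^ m = f * σ ^ (m + 1) := by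
      rw [htσ, mul_assoc, add_comm, zpow_one_add]
    rw [h1, h2, Equiv.Perm.mul_apply, show (-m - 1 : ℤ) = -(m + 1) by ring]
    exact hfx _
  let N := MulAction.period σ x
  have hN : 0 < N := MulAction.period_pos_of_orderOf_pos (orderOf_pos σ) x
  have hper : ∀ m : ℤ, (σ ^ m) x = x ↔ (N : ℤ) ∣ m := fun m =>
    MulAction.zpow_smul_eq_iff_period_dvd (g := σ) (a := x)
  have hper2 : ∀ m m' : ℤ, (σ ^ m) x = (σ ^ m') x ↔ (N : ℤ) ∣ m - m' := by
    intro m m'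
    rw [← hper, sub_eq_neg_add, zpow_add, Equiv.Perm.mul_apply, zpow_neg,
      Equiv.Perm.inv_eq_iff_eq]
  -- the period is even, as otherwise `τ` fixes the middle of the orbit; the other fixed point of
  -- `φ` is half a period away from `x`
  obtain ⟨j, hj⟩ : ∃ j, N = j + j := by
    rcases Nat.even_or_odd' N with ⟨j, hj | hj⟩
    · exact ⟨j, by omega⟩
    · refine absurd (htx j) fun h => hτn ((σ ^ (j : ℤ)) x) (h.trans ?_)
      rw [hper2]
      exact ⟨-1, by rw [hj]; push_cast; ring⟩
  have hclass : ∀ m : ℕ, Relation.EqvGen (fun u v => τ u = v ∨ φ u = v) x ((σ ^ m) x) := by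
    intro m
    induction m with
    | zero => exact .refl _
    | succ n ih =>
      rw [pow_succ', Equiv.Perm.mul_apply]
      exact ih.trans _ _ _ (.trans _ (τ ((σ ^ n) x)) _ (.rel _ _ (Or.inl rfl))
        (.rel _ _ (Or.inr rfl)))
  have hmem : ∀ z, Relation.EqvGen (fun u v => τ u = v ∨ φ u = v) x z → ∃ m : ℤ, z = (σ ^ m) x := by
    have hstep : ∀ u v, (τ u = v ∨ φ u = v) →
        ((∃ m : ℤ, u = (σ ^ m) x) ↔ ∃ m : ℤ, v = (σ ^ m) x) := by
      have hto : ∀ u, (∃ m : ℤ, u = (σ ^ m) x) →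
          (∃ m : ℤ, τ u = (σ ^ m) x) ∧ ∃ m : ℤ, φ u = (σ ^ m) x := by
        rintro _ ⟨m, rfl⟩
        exact ⟨⟨_, htx m⟩, ⟨_, hfx m⟩⟩
      rintro u v (rfl | rfl)
      · exact ⟨fun h => (hto _ h).1, fun h => by simpa only [hτ u] using (hto _ h).1⟩
      · exact ⟨fun h => (hto _ h).2, fun h => by simpa only [hφ u] using (hto _ h).2⟩
    have key : ∀ u z, Relation.EqvGen (fun u v => τ u = v ∨ φ u = v) u z →
        ((∃ m : ℤ, u = (σ ^ m) x) ↔ ∃ m : ℤ, z = (σ ^ m) x) := by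
      intro u z h
      induction h with
      | rel u v h => exact hstep u v h
      | refl => rfl
      | symm _ _ _ ih => exact ih.symm
      | trans _ _ _ _ _ ih1 ih2 => exact ih1.trans ih2
    exact fun z h => (key x z h).1 ⟨0, rfl⟩
  refine ⟨(σ ^ (j : ℤ)) x, ?_, ?_, hclass j, ?_⟩
  · rw [Ne, hper]
    intro h
    have := Int.le_of_dvd (by omega) h
    omega
  · rw [hfx, hper2]
    exact ⟨-1, by rw [hj]; push_cast; ring⟩
  · intro z hz hzf
    obtain ⟨m, rfl⟩ := hmem z hz
    rw [hfx, hper2] at hzf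
    obtain ⟨c, hc⟩ := hzf
    rw [hper, hper2]
    rcases Int.even_or_odd' c with ⟨d, rfl | rfl⟩
    · left
      refine ⟨-d, ?_⟩
      rw [hj] at hc ⊢
      push_cast at hc ⊢
      linarith
    · right
      refine ⟨-d - 1, ?_⟩
      rw [hj] at hc ⊢
      push_cast at hc ⊢
      linarith

/-- A map that sends generating pairs to equivalent pairs respects the generated equivalences. -/
theorem Relation.EqvGen.map {α β : Type*} {r : α → α → Prop} {s : β → β → Prop} {f : α → β}
    (h : ∀ a b, r a b → Relation.EqvGen s (f a) (f b)) {a b : α} (hab : Relation.EqvGen r a b) :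
    Relation.EqvGen s (f a) (f b) := by
  induction hab with
  | rel _ _ hr => exact h _ _ hr
  | refl => exact .refl _
  | symm _ _ _ ih => exact ih.symm
  | trans _ _ _ _ _ ih1 ih2 => exact ih1.trans _ _ _ ih2

/-! ### Boundary points and strands -/

theorem MarkedDisc.bd_injOn (e : MarkedDisc) : InjOn e.bd (Ico 0 1) := by
  intro s hs t ht h
  exact circlePoint_injOn hs ht (e.injOn (Metric.sphere_subset_closedBall (exp_mem_sphere s))
    (Metric.sphere_subset_closedBall (exp_mem_sphere t)) h)

theorem DiscConfiguration.disjoint_boundary {ι : Type*} (D : DiscConfiguration ι) {o o' : Option ι}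
    (h : o ≠ o') : Disjoint (D.disc o).boundary (D.disc o').boundary := by
  have h1 : ∀ i, Disjoint D.outer.boundary (D.inner i).boundary := fun i =>
    (D.outer.disjoint_interior_boundary.mono_left
      ((D.inner i).boundary_subset.trans (D.inner_subset i))).symm
  rcases o with _ | i <;> rcases o' with _ | j
  · exact absurd rfl h
  · exact h1 j
  · exact (h1 i).symm
  · exact (D.inner_disjoint fun hij => h (congrArg some hij)).mono (D.inner i).boundary_subset
      (D.inner j).boundary_subset

namespace PlanarDiagram

variable {ι : Type*} {D : DiscConfiguration ι} {n₀ : ℕ} {n : ι → ℕ} (P : PlanarDiagram D n₀ n)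

theorem pt_mem_carrier (o : Option ι) (k : Fin (2 * sig n₀ n o)) : P.pt o k ∈ P.carrier :=
  ((P.mem_boundary_iff o _).2 ⟨k, rfl⟩).1

theorem pt_mem_boundary (o : Option ι) (k : Fin (2 * sig n₀ n o)) :
    P.pt o k ∈ (D.disc o).boundary :=
  ((P.mem_boundary_iff o _).2 ⟨k, rfl⟩).2

theorem pt_injective : Function.Injective fun x : BoundaryPoint n₀ n => P.pt x.1 x.2 := by
  rintro ⟨o, k⟩ ⟨o', k'⟩ h
  by_cases ho : o = o'
  · subst ho
    have h1 := (D.disc o).bd_injOn (Ioo_subset_Ico_self (P.pos_mem o k))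
      (Ioo_subset_Ico_self (P.pos_mem o k')) h
    rw [(P.pos_strictMono o).injective h1]
  · refine absurd ?_ (Set.disjoint_left.1 (D.disjoint_boundary ho) (P.pt_mem_boundary o k))
    exact (show P.pt o k = P.pt o' k' from h) ▸ P.pt_mem_boundary o' k'

/-- The strand that ends in a given boundary point. -/
noncomputable def strand (x : BoundaryPoint n₀ n) : P.strands :=
  ⟨(P.pt_mem_carrier x.1 x.2).choose, (P.pt_mem_carrier x.1 x.2).choose_spec.1⟩

theorem pt_mem_strand (x : BoundaryPoint n₀ n) : P.pt x.1 x.2 ∈ (P.strand x).1 :=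
  (P.pt_mem_carrier x.1 x.2).choose_spec.2

theorem strand_eq_of_mem {s t : P.strands} {z : ℂ} (hs : z ∈ s.1) (ht : z ∈ t.1) : s = t := by
  by_contra h
  exact Set.disjoint_left.1 (P.disjoint_strands s.2 t.2 fun h' => h (Subtype.ext h')) hs ht

theorem pt_mem_iff (x : BoundaryPoint n₀ n) (s : P.strands) :
    P.pt x.1 x.2 ∈ s.1 ↔ P.strand x = s :=
  ⟨fun h => P.strand_eq_of_mem (P.pt_mem_strand x) h, fun h => h ▸ P.pt_mem_strand x⟩

/-- The strand that ends in a boundary point is an arc, and it has exactly two ends. -/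
theorem exists_partner (x : BoundaryPoint n₀ n) :
    ∃ y, y ≠ x ∧ ∀ z, P.strand z = P.strand x ↔ z = x ∨ z = y := by
  have hb : ∀ z : BoundaryPoint n₀ n, P.pt z.1 z.2 ∈ D.boundary := fun z =>
    mem_iUnion.2 ⟨z.1, P.pt_mem_boundary z.1 z.2⟩
  have hpt : ∀ a ∈ (P.strand x).1, a ∈ D.boundary →
      ∃ z : BoundaryPoint n₀ n, P.pt z.1 z.2 = a := by
    intro a ha hab
    obtain ⟨o, ho⟩ := mem_iUnion.1 hab
    obtain ⟨k, hk⟩ := (P.mem_boundary_iff o a).1 ⟨⟨_, (P.strand x).2, ha⟩, ho⟩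
    exact ⟨⟨o, k⟩, hk⟩
  have main : ∀ b, b ≠ P.pt x.1 x.2 → (P.strand x).1 ∩ D.boundary = {P.pt x.1 x.2, b} →
      ∃ y, y ≠ x ∧ ∀ z, P.strand z = P.strand x ↔ z = x ∨ z = y := by
    intro b hne heq
    have hbm : b ∈ (P.strand x).1 ∩ D.boundary := by rw [heq]; simp
    obtain ⟨y, rfl⟩ := hpt b hbm.1 hbm.2
    refine ⟨y, fun h => hne (by rw [h]), fun z => ?_⟩
    rw [← P.pt_mem_iff z]
    have h1 : P.pt z.1 z.2 ∈ (P.strand x).1 ↔ P.pt z.1 z.2 ∈ (P.strand x).1 ∩ D.boundary :=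
      ⟨fun h => ⟨h, hb z⟩, fun h => h.1⟩
    rw [h1, heq, mem_insert_iff, mem_singleton_iff]
    exact or_congr (P.pt_injective.eq_iff (a := z) (b := x))
      (P.pt_injective.eq_iff (a := z) (b := y))
  have hx : P.pt x.1 x.2 ∈ (P.strand x).1 ∩ D.boundary := ⟨P.pt_mem_strand x, hb x⟩
  rcases (P.isStrand _ (P.strand x).2).2 with ⟨a, b, hab, -, heq⟩ | ⟨-, heq⟩
  · rw [heq] at hx
    rcases hx with hx | hx
    · exact main b (hx ▸ hab.symm) (hx ▸ heq)
    · rw [mem_singleton_iff] at hx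
      exact main a (hx ▸ hab) (by rw [heq, hx, pair_comm])
  · rw [heq] at hx
    exact absurd hx (notMem_empty _)

/-- The other end of the strand that ends in a given boundary point. -/
noncomputable def partner (x : BoundaryPoint n₀ n) : BoundaryPoint n₀ n :=
  (P.exists_partner x).choose

theorem partner_ne (x : BoundaryPoint n₀ n) : P.partner x ≠ x := (P.exists_partner x).choose_spec.1

theorem strand_eq_iff (x z : BoundaryPoint n₀ n) :
    P.strand z = P.strand x ↔ z = x ∨ z = P.partner x :=
  (P.exists_partner x).choose_spec.2 z

theorem strand_partner (x : BoundaryPoint n₀ n) : P.strand (P.partner x) = P.strand x :=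
  (P.strand_eq_iff x _).2 (Or.inr rfl)

theorem partner_involutive : Function.Involutive P.partner := by
  intro x
  rcases (P.strand_eq_iff (P.partner x) x).1 (P.strand_partner x).symm with h | h
  · exact absurd h.symm (P.partner_ne x)
  · exact h.symm

/-! ### Connections through a filling -/

/-- The filling partner of a boundary point. -/
def _root_.Filling.map (f : Filling n₀ n) (x : BoundaryPoint n₀ n) : BoundaryPoint n₀ n :=
  ⟨x.1, (f x.1).toFun x.2⟩

/-- Two boundary points are connected by strands and by the filling away from the disc `o`. -/
def Away (f : Filling n₀ n) (o : Option ι) : BoundaryPoint n₀ n → BoundaryPoint n₀ n → Prop :=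
  Relation.EqvGen fun x y =>
    (∃ s ∈ P.strands, P.pt x.1 x.2 ∈ s ∧ P.pt y.1 y.2 ∈ s) ∨
      (x.1 ≠ o ∧ y = ⟨x.1, (f x.1).toFun x.2⟩)

/-- Two strands are connected by the filling of the discs in `A`. -/
def StrandRel (f : Filling n₀ n) (A : Set (Option ι)) : P.strands → P.strands → Prop :=
  Relation.EqvGen fun s t =>
    ∃ x : BoundaryPoint n₀ n, x.1 ∈ A ∧ P.strand x = s ∧ P.strand (f.map x) = t

variable {P}

theorem StrandRel.of_eq {f : Filling n₀ n} {A : Set (Option ι)} {s t : P.strands} (h : s = t) :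
    P.StrandRel f A s t := h ▸ .refl _

theorem StrandRel.fill {f : Filling n₀ n} {A : Set (Option ι)} {x : BoundaryPoint n₀ n}
    (h : x.1 ∈ A) : P.StrandRel f A (P.strand x) (P.strand (f.map x)) :=
  .rel _ _ ⟨x, h, rfl, rfl⟩

theorem StrandRel.mono {f : Filling n₀ n} {A B : Set (Option ι)} (h : A ⊆ B) {s t : P.strands}
    (hst : P.StrandRel f A s t) : P.StrandRel f B s t :=
  Relation.EqvGen.map (f := id) (fun _ _ ⟨x, hx, h1, h2⟩ => .rel _ _ ⟨x, h hx, h1, h2⟩) hst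

/-- Connections between boundary points can be computed between strands: a strand without ends
cannot occur in a chain of strands that starts at a boundary point. -/
theorem away_iff {f : Filling n₀ n} {o : Option ι} {x y : BoundaryPoint n₀ n} :
    P.Away f o x y ↔ P.StrandRel f {o}ᶜ (P.strand x) (P.strand y) := by
  constructor
  · refine Relation.EqvGen.map (f := P.strand) fun x y h => ?_
    rcases h with ⟨s, hs, hx, hy⟩ | ⟨hx, rfl⟩
    · exact StrandRel.of_eq (((P.pt_mem_iff x ⟨s, hs⟩).1 hx).trans
        ((P.pt_mem_iff y ⟨s, hs⟩).1 hy).symm)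
    · exact StrandRel.fill hx
  · intro h
    have hsame : ∀ x y : BoundaryPoint n₀ n, P.strand x = P.strand y → P.Away f o x y :=
      fun x y h => .rel _ _ (Or.inl ⟨_, (P.strand y).2, (P.pt_mem_iff x _).2 h, P.pt_mem_strand y⟩)
    have key : ∀ s t, P.StrandRel f {o}ᶜ s t →
        ((∃ x, P.strand x = s) ↔ ∃ x, P.strand x = t) ∧
        ∀ x y, P.strand x = s → P.strand y = t → P.Away f o x y := by
      intro s t hst
      induction hst with
      | rel s t h =>
        obtain ⟨z, hz, rfl, rfl⟩ := h
        refine ⟨⟨fun _ => ⟨_, rfl⟩, fun _ => ⟨_, rfl⟩⟩, fun x y hx hy => ?_⟩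
        exact ((hsame _ _ hx).trans _ _ _ (.rel _ _ (Or.inr ⟨hz, rfl⟩))).trans _ _ _
          (hsame _ _ hy.symm)
      | refl s => exact ⟨Iff.rfl, fun x y hx hy => hsame _ _ (hx.trans hy.symm)⟩
      | symm s t _ ih => exact ⟨ih.1.symm, fun x y hx hy => (ih.2 y x hy hx).symm⟩
      | trans s t u _ _ ih1 ih2 =>
        refine ⟨ih1.1.trans ih2.1, fun x y hx hy => ?_⟩
        obtain ⟨z, hz⟩ := ih1.1.1 ⟨x, hx⟩
        exact (ih1.2 x z hx hz).trans _ _ _ (ih2.2 z y hz hy)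
    exact (key _ _ h).2 x y rfl rfl

variable (P)

/-- Away from the disc `o`, each boundary point of `o` is connected with exactly one other one. -/
theorem exists_away [Finite ι] (f : Filling n₀ n) (o : Option ι) (k : Fin (2 * sig n₀ n o)) :
    ∃ l, l ≠ k ∧ P.Away f o ⟨o, k⟩ ⟨o, l⟩ ∧ ∀ m, P.Away f o ⟨o, k⟩ ⟨o, m⟩ → m = k ∨ m = l := by
  classical
  -- with `φ` the filling, made to fix the points of `o`, this is about the orbits of `partner`
  -- and `φ`
  let φ : BoundaryPoint n₀ n → BoundaryPoint n₀ n := fun x => if x.1 = o then x else f.map x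
  have hφo : ∀ x, x.1 = o → φ x = x := fun x h => if_pos h
  have hφn : ∀ x, x.1 ≠ o → φ x = f.map x := fun x h => if_neg h
  have hφ1 : ∀ x, (φ x).1 = x.1 := by
    intro x
    by_cases h : x.1 = o
    · rw [hφo x h]
    · rw [hφn x h]; rfl
  have hφ : Function.Involutive φ := by
    intro x
    by_cases h : x.1 = o
    · rw [hφo x h, hφo x h]
    · rw [hφn (φ x) (by rwa [hφ1]), hφn x h]
      exact Sigma.ext rfl (heq_of_eq ((f x.1).involutive x.2))
  have hiff : ∀ x y, Relation.EqvGen (fun u v => P.partner u = v ∨ φ u = v) x y ↔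
      P.Away f o x y := by
    intro x y
    constructor
    · refine Relation.EqvGen.map (f := id) ?_
      rintro u v (rfl | rfl)
      · exact away_iff.2 (StrandRel.of_eq (P.strand_partner u).symm)
      · by_cases h : u.1 = o
        · rw [hφo u h]; exact .refl _
        · rw [hφn u h]; exact .rel _ _ (Or.inr ⟨h, rfl⟩)
    · refine Relation.EqvGen.map (f := id) ?_
      rintro u v (⟨s, hs, hu, hv⟩ | ⟨hu, rfl⟩)
      · rcases (P.strand_eq_iff u v).1 (((P.pt_mem_iff v ⟨s, hs⟩).1 hv).trans
          ((P.pt_mem_iff u ⟨s, hs⟩).1 hu).symm) with rfl | rfl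
        · exact .refl _
        · exact .rel _ _ (Or.inl rfl)
      · exact .rel _ _ (Or.inr (hφn u hu))
  obtain ⟨⟨o', l⟩, hne, hfix, hgen, huniq⟩ := exists_unique_other_fixedPoint P.partner_involutive hφ
    P.partner_ne (hφo ⟨o, k⟩ rfl)
  have ho : o' = o := by
    by_contra h
    rw [hφn _ h] at hfix
    exact (f o').ne l (eq_of_heq (Sigma.ext_iff.1 hfix).2)
  subst ho
  refine ⟨l, fun h => hne (by rw [h]), (hiff _ _).1 hgen, fun m hm => ?_⟩
  refine (huniq ⟨o', m⟩ ((hiff _ _).2 hm) (hφo _ rfl)).imp (fun h => ?_) (fun h => ?_) <;>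
  exact eq_of_heq (Sigma.ext_iff.1 h).2

end PlanarDiagram

/-! ### Planarity: the induced matchings are crossingless -/

theorem HasDifferenceLog.congr {δ δ' : ℂ → ℂ} (h : HasDifferenceLog δ)
    (he : EqOn δ' δ (Metric.closedBall 0 1)) : HasDifferenceLog δ' := by
  obtain ⟨k, hk, hkδ⟩ := h
  refine ⟨k, hk, fun x y hx hy hxy => ?_⟩
  rw [he (by simpa using hx), he (by simpa using hy), hkδ x y hx hy hxy]

theorem IsCompact.exists_continuousOn_leftInverse {X Y : Type*} [TopologicalSpace X] [Nonempty X]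
    [TopologicalSpace Y] [T2Space Y] {s : Set X} (hs : IsCompact s) {f : X → Y}
    (hf : ContinuousOn f s) (hi : InjOn f s) :
    ∃ ψ : Y → X, ContinuousOn ψ (f '' s) ∧ ∀ z ∈ s, ψ (f z) = z := by
  classical
  let E := Equiv.Set.imageOfInjOn f s hi
  have : CompactSpace s := isCompact_iff_compactSpace.1 hs
  have hE : Continuous E := Continuous.subtype_mk
    (hf.comp_continuous continuous_subtype_val fun z => z.2) _
  let H := hE.homeoOfEquivCompactToT2
  refine ⟨fun z => if h : z ∈ f '' s then H.symm ⟨z, h⟩ else Classical.arbitrary X, ?_,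
    fun z hz => ?_⟩
  · rw [continuousOn_iff_continuous_domRestrict]
    refine (continuous_subtype_val.comp H.symm.continuous).congr fun a => ?_
    rw [Set.domRestrict_apply, dif_pos a.2]
    rfl
  · have hmem : f z ∈ f '' s := mem_image_of_mem _ hz
    simp only [dif_pos hmem]
    have : (⟨f z, hmem⟩ : f '' s) = H ⟨z, hz⟩ := rfl
    rw [this, H.symm_apply_apply]

/-- A continuous inverse of the parametrization of an embedded disc. -/
structure MarkedDisc.IsChart (e : MarkedDisc) (ψ : ℂ → ℂ) : Prop where
  continuousOn : ContinuousOn ψ e.carrier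
  leftInv : ∀ z ∈ Metric.closedBall (0 : ℂ) 1, ψ (e.toFun z) = z

theorem MarkedDisc.exists_isChart (e : MarkedDisc) : ∃ ψ, e.IsChart ψ :=
  let ⟨ψ, h1, h2⟩ :=
    (isCompact_closedBall (0 : ℂ) 1).exists_continuousOn_leftInverse e.continuousOn e.injOn
  ⟨ψ, h1, h2⟩

/-- Two parabolic arcs over nested intervals are disjoint. -/
theorem parabola_ne {a b c d t : ℝ} (hac : a < c) (hct : c ≤ t) (htd : t ≤ d)
    (hdb : d < b) : (t - a) * (b - t) ≠ (t - c) * (d - t) := by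
  intro h
  have h1 : 0 < (t - a) * (b - d) := mul_pos (by linarith) (by linarith)
  have h2 : 0 ≤ (c - a) * (d - t) := mul_nonneg (by linarith) (by linarith)
  nlinarith

/-- The parameters of the collars: `t` runs through the circle cut open at the marked point, and `r`
is the distance from the circle. -/
def collarDomain : Set (ℝ × ℝ) := {p | p.1 ∈ Ioo 0 1 ∧ 0 ≤ p.2 ∧ p.2 < 1}

/-- Polar coordinates with a radius `u r` are injective on the cut collar. -/
theorem polar_injOn {u : ℝ → ℝ} (hu : ∀ r, 0 ≤ r → r < 1 → 0 < u r)
    (hi : Function.Injective u) {p q : ℝ × ℝ} (hp : p ∈ collarDomain) (hq : q ∈ collarDomain)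
    (h : (u p.2 : ℂ) * circlePoint p.1 = u q.2 * circlePoint q.1) : p = q := by
  have h1 := congrArg norm h
  have hup := hu p.2 hp.2.1 hp.2.2
  have huq := hu q.2 hq.2.1 hq.2.2
  simp only [norm_mul, norm_circlePoint, mul_one, Complex.norm_real,
    Real.norm_of_nonneg hup.le, Real.norm_of_nonneg huq.le] at h1
  rw [h1] at h
  have h2 := mul_left_cancel₀ (by exact_mod_cast huq.ne') h
  exact Prod.ext (circlePoint_injOn (Ioo_subset_Ico_self hp.1) (Ioo_subset_Ico_self hq.1) h2)
    (hi h1)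

theorem norm_polar {r : ℝ} (hr : 0 ≤ r) (t : ℝ) : ‖(r : ℂ) * circlePoint t‖ = r := by
  rw [norm_mul, norm_circlePoint, mul_one, Complex.norm_real, Real.norm_of_nonneg hr]

theorem mem_closedBall_of_collarDomain {p : ℝ × ℝ} (hp : p ∈ collarDomain) :
    ((1 - p.2 : ℝ) : ℂ) * circlePoint p.1 ∈ Metric.closedBall (0 : ℂ) 1 := by
  rw [mem_closedBall_zero_iff, norm_polar (by linarith [hp.2.2])]
  linarith [hp.2.1]

namespace MarkedDisc.IsChart

variable {e : MarkedDisc} {ψ : ℂ → ℂ}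

theorem injOn (hψ : e.IsChart ψ) : InjOn ψ e.carrier := by
  rintro _ ⟨z, hz, rfl⟩ _ ⟨w, hw, rfl⟩ h
  rw [hψ.leftInv z hz, hψ.leftInv w hw] at h
  rw [h]

theorem norm_le (hψ : e.IsChart ψ) {z : ℂ} (hz : z ∈ e.carrier) : ‖ψ z‖ ≤ 1 := by
  obtain ⟨w, hw, rfl⟩ := hz
  rw [hψ.leftInv w hw]
  simpa using hw

theorem norm_lt (hψ : e.IsChart ψ) {z : ℂ} (hz : z ∈ e.interior) : ‖ψ z‖ < 1 := by
  obtain ⟨w, hw, rfl⟩ := hz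
  rw [hψ.leftInv w (Metric.ball_subset_closedBall hw)]
  simpa using hw

theorem bd (hψ : e.IsChart ψ) (t : ℝ) : ψ (e.bd t) = circlePoint t :=
  hψ.leftInv _ (Metric.sphere_subset_closedBall (MarkedDisc.exp_mem_sphere t))

end MarkedDisc.IsChart

namespace DiscConfiguration

variable {ι : Type*} (D : DiscConfiguration ι) {ψ : ℂ → ℂ}

theorem inner_subset_outer (j : ι) : (D.inner j).carrier ⊆ D.outer.carrier :=
  (D.inner_subset j).trans D.outer.interior_subset

/-- In the chart of the outer disc, the inner discs are again embedded discs. -/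
theorem continuousOn_inner (hψ : D.outer.IsChart ψ) (j : ι) :
    ContinuousOn (ψ ∘ (D.inner j).toFun) (Metric.closedBall 0 1) :=
  hψ.continuousOn.comp (D.inner j).continuousOn fun _ hz =>
    D.inner_subset_outer j (mem_image_of_mem _ hz)

theorem hasDifferenceLog_inner (hψ : D.outer.IsChart ψ) (j : ι) :
    HasDifferenceLog (ψ ∘ (D.inner j).toFun) := by
  have hm : ∀ z ∈ Metric.closedBall (0 : ℂ) 1, (D.inner j).toFun z ∈ D.outer.carrier :=
    fun z hz => D.inner_subset_outer j (mem_image_of_mem _ hz)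
  refine D.outer.hasDifferenceLog.of_comp (D.continuousOn_inner hψ j) ?_ ?_ ?_
  · exact hψ.injOn.comp (D.inner j).injOn hm
  · exact fun z hz => by simpa using hψ.norm_le (hm z hz)
  · refine (D.inner j).hasDifferenceLog.congr fun z hz => ?_
    obtain ⟨w, hw, hwz⟩ := hm z hz
    simp only [Function.comp_apply]
    rw [← hwz, hψ.leftInv w hw]

/-- Coordinates near the boundary circle of a disc, on the side that is not in the surface.  The
outer disc is identified with the unit disc by the chart `ψ`, and the outside of the outer disc is
replaced by the outside of the unit disc. -/
noncomputable def collar (ψ : ℂ → ℂ) : Option ι → ℝ × ℝ → ℂ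
  | none, p => (1 + p.2 : ℝ) * circlePoint p.1
  | some j, p => ψ ((D.inner j).toFun ((1 - p.2 : ℝ) * circlePoint p.1))

theorem continuousOn_collar (hψ : D.outer.IsChart ψ) (o : Option ι) :
    ContinuousOn (D.collar ψ o) collarDomain := by
  have := continuous_circlePoint
  rcases o with _ | j
  · have : Continuous fun p : ℝ × ℝ => ((1 + p.2 : ℝ) : ℂ) * circlePoint p.1 := by fun_prop
    exact this.continuousOn
  · exact (D.continuousOn_inner hψ j).comp
      (f := fun p : ℝ × ℝ => ((1 - p.2 : ℝ) : ℂ) * circlePoint p.1)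
      (by fun_prop) fun p hp => mem_closedBall_of_collarDomain hp

theorem collar_zero (hψ : D.outer.IsChart ψ) (o : Option ι) (t : ℝ) :
    D.collar ψ o (t, 0) = ψ ((D.disc o).bd t) := by
  rcases o with _ | j
  · simp only [collar, disc, add_zero, Complex.ofReal_one, one_mul]
    exact (hψ.bd t).symm
  · simp only [collar, disc, sub_zero, Complex.ofReal_one, one_mul]
    rfl

theorem collar_injOn (hψ : D.outer.IsChart ψ) (o : Option ι) :
    InjOn (D.collar ψ o) collarDomain := by
  intro p hp q hq h
  rcases o with _ | j
  · exact polar_injOn (u := fun r => 1 + r) (fun r h0 _ => by positivity)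
      (add_right_injective 1) hp hq h
  · have h1 := mem_closedBall_of_collarDomain hp
    have h2 := mem_closedBall_of_collarDomain hq
    refine polar_injOn (u := fun r => 1 - r) (fun r _ h1 => by linarith)
      sub_right_injective hp hq ?_
    exact (D.inner j).injOn h1 h2 (hψ.injOn (D.inner_subset_outer j (mem_image_of_mem _ h1))
      (D.inner_subset_outer j (mem_image_of_mem _ h2)) h)

theorem one_le_norm_collar_none {p : ℝ × ℝ} (hp : p ∈ collarDomain) :
    1 ≤ ‖D.collar ψ none p‖ := by
  rw [collar, norm_polar (by linarith [hp.2.1])]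
  linarith [hp.2.1]

theorem norm_collar_some_lt (hψ : D.outer.IsChart ψ) {p : ℝ × ℝ} (hp : p ∈ collarDomain) (j : ι) :
    ‖D.collar ψ (some j) p‖ < 1 :=
  hψ.norm_lt (D.inner_subset j (mem_image_of_mem _ (mem_closedBall_of_collarDomain hp)))

theorem collar_ne (hψ : D.outer.IsChart ψ) {o o' : Option ι} (h : o ≠ o') {p q : ℝ × ℝ}
    (hp : p ∈ collarDomain) (hq : q ∈ collarDomain) : D.collar ψ o p ≠ D.collar ψ o' q := by
  intro heq
  rcases o with _ | i <;> rcases o' with _ | j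
  · exact h rfl
  · exact absurd (heq ▸ D.one_le_norm_collar_none hp) (not_le.2 (D.norm_collar_some_lt hψ hq j))
  · exact absurd (heq ▸ D.one_le_norm_collar_none hq) (not_le.2 (D.norm_collar_some_lt hψ hp i))
  · have h1 := mem_image_of_mem (D.inner i).toFun (mem_closedBall_of_collarDomain hp)
    have h2 := mem_image_of_mem (D.inner j).toFun (mem_closedBall_of_collarDomain hq)
    have h3 := hψ.injOn (D.inner_subset_outer i h1) (D.inner_subset_outer j h2) heq
    exact Set.disjoint_left.1 (D.inner_disjoint fun hij => h (congrArg some hij)) h1 (h3 ▸ h2)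

/-- The collars lie outside the surface, except for the boundary circles. -/
theorem eq_zero_of_collar_mem (hψ : D.outer.IsChart ψ) {o : Option ι} {p : ℝ × ℝ}
    (hp : p ∈ collarDomain) {z : ℂ} (hz : z ∈ D.surface) (h : ψ z = D.collar ψ o p) : p.2 = 0 := by
  by_contra h0
  have h0' : 0 < p.2 := lt_of_le_of_ne hp.2.1 (Ne.symm h0)
  rcases o with _ | j
  · have h1 := hψ.norm_le hz.1
    rw [h, collar, norm_polar (by linarith)] at h1
    linarith
  · have h1 := mem_image_of_mem (D.inner j).toFun (mem_closedBall_of_collarDomain hp)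
    have h2 := hψ.injOn hz.1 (D.inner_subset_outer j h1) h
    refine hz.2 (mem_iUnion.2 ⟨j, h2 ▸ mem_image_of_mem _ ?_⟩)
    rw [mem_ball_zero_iff, norm_polar (by linarith [hp.2.2])]
    linarith

theorem collar_notMem_inner (hψ : D.outer.IsChart ψ) {o : Option ι} {i : ι} (h : o ≠ some i)
    {p : ℝ × ℝ} (hp : p ∈ collarDomain) :
    D.collar ψ o p ∉ (ψ ∘ (D.inner i).toFun) '' Metric.ball 0 1 := by
  rintro ⟨w, hw, heq⟩
  have h1 := mem_image_of_mem (D.inner i).toFun (Metric.ball_subset_closedBall hw)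
  rcases o with _ | j
  · have h2 := D.one_le_norm_collar_none (ψ := ψ) hp
    rw [← heq] at h2
    exact absurd h2 (not_le.2 (hψ.norm_lt (D.inner_subset i h1)))
  · have h2 := mem_image_of_mem (D.inner j).toFun (mem_closedBall_of_collarDomain hp)
    have h3 := hψ.injOn (D.inner_subset_outer i h1) (D.inner_subset_outer j h2) heq
    exact Set.disjoint_left.1 (D.inner_disjoint fun hij => h (congrArg some hij.symm)) h1 (h3 ▸ h2)

end DiscConfiguration

namespace PlanarDiagram

variable {ι : Type*} {D : DiscConfiguration ι} {n₀ : ℕ} {n : ι → ℕ} (P : PlanarDiagram D n₀ n)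
  {ψ : ℂ → ℂ}

/-- The position of a boundary point on its circle. -/
def position (x : BoundaryPoint n₀ n) : ℝ := P.pos x.1 x.2

/-- A parabolic arc that realizes the filling at a boundary point. -/
noncomputable def fillArc (ψ : ℂ → ℂ) (f : Filling n₀ n) (x : BoundaryPoint n₀ n) : Set ℂ :=
  (fun t => D.collar ψ x.1 (t, (t - P.position x) * (P.position (f.map x) - t))) ''
    uIcc (P.position x) (P.position (f.map x))

theorem fillArc_param_mem (f : Filling n₀ n) (x : BoundaryPoint n₀ n) {t : ℝ}
    (ht : t ∈ uIcc (P.position x) (P.position (f.map x))) :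
    (t, (t - P.position x) * (P.position (f.map x) - t)) ∈ collarDomain := by
  have h1 := P.pos_mem x.1 x.2
  have h2 := P.pos_mem x.1 ((f x.1).toFun x.2)
  change _ ∈ Ioo (0 : ℝ) 1 at h1
  change P.position x ∈ Ioo (0 : ℝ) 1 at h1
  change P.position (f.map x) ∈ Ioo (0 : ℝ) 1 at h2
  generalize P.position x = a at *
  generalize P.position (f.map x) = b at *
  rw [mem_uIcc] at ht
  refine ⟨?_, ?_, ?_⟩ <;> rcases ht with ⟨h3, h4⟩ | ⟨h3, h4⟩
  · exact ⟨h1.1.trans_le h3, h4.trans_lt h2.2⟩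
  · exact ⟨h2.1.trans_le h3, h4.trans_lt h1.2⟩
  · exact mul_nonneg (by linarith) (by linarith)
  · exact mul_nonneg_of_nonpos_of_nonpos (by linarith) (by linarith)
  · show (t - a) * (b - t) < 1
    nlinarith [h1.1, h1.2, h2.1, h2.2]
  · show (t - a) * (b - t) < 1
    nlinarith [h1.1, h1.2, h2.1, h2.2]

theorem filling_map_map (f : Filling n₀ n) (x : BoundaryPoint n₀ n) : f.map (f.map x) = x :=
  Sigma.ext rfl (heq_of_eq ((f x.1).involutive x.2))

theorem joinedIn_fillArc (hψ : D.outer.IsChart ψ) (f : Filling n₀ n) (x : BoundaryPoint n₀ n) :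
    JoinedIn (P.fillArc ψ f x) (ψ (P.pt x.1 x.2)) (ψ (P.pt (f.map x).1 (f.map x).2)) := by
  have hpc : IsPathConnected (P.fillArc ψ f x) := by
    refine IsPathConnected.image' ?_ ?_
    · rw [uIcc]
      exact (convex_Icc _ _).isPathConnected (nonempty_Icc.2 inf_le_sup)
    · exact (D.continuousOn_collar hψ x.1).comp (by fun_prop) fun t ht =>
        P.fillArc_param_mem f x ht
  refine hpc.joinedIn _ ⟨_, left_mem_uIcc, ?_⟩ _ ⟨_, right_mem_uIcc, ?_⟩
  · simp only [sub_self, zero_mul]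
    exact D.collar_zero hψ _ _
  · simp only [sub_self, mul_zero]
    exact D.collar_zero hψ _ _

/-- The arcs of the filling are disjoint because the matching is crossingless: the intervals over
which they lie in the same collar are disjoint or nested, and over nested intervals the parabolas do
not meet. -/
theorem fillArc_disjoint (hψ : D.outer.IsChart ψ) (f : Filling n₀ n) {x y : BoundaryPoint n₀ n}
    {z : ℂ} (hx : z ∈ P.fillArc ψ f x) (hy : z ∈ P.fillArc ψ f y) : y = x ∨ y = f.map x := by
  have symm : ∀ x, P.fillArc ψ f (f.map x) = P.fillArc ψ f x := by
    intro x
    rw [fillArc, fillArc, filling_map_map, uIcc_comm]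
    refine image_congr fun t _ => ?_
    change D.collar ψ x.1 _ = D.collar ψ x.1 _
    congr 2
    ring
  -- the end points may be taken in increasing order
  have wlog1 : ∀ x, z ∈ P.fillArc ψ f x → ∃ x', (x' = x ∨ x' = f.map x) ∧
      z ∈ P.fillArc ψ f x' ∧ x'.2 < (f x'.1).toFun x'.2 := by
    intro x hx
    rcases lt_or_gt_of_ne ((f x.1).ne x.2) with h | h
    · refine ⟨f.map x, Or.inr rfl, by rwa [symm], ?_⟩
      change (f x.1).toFun x.2 < (f x.1).toFun ((f x.1).toFun x.2)
      rw [(f x.1).involutive x.2]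
      exact h
    · exact ⟨x, Or.inl rfl, hx, h⟩
  obtain ⟨x', hx', hzx, hltx⟩ := wlog1 x hx
  obtain ⟨y', hy', hzy, hlty⟩ := wlog1 y hy
  suffices h : y' = x' by
    subst h
    rcases hx' with h1 | h1 <;> rcases hy' with h2 | h2
    · exact Or.inl (h2.symm.trans h1)
    · right; rw [← h1, h2, filling_map_map]
    · exact Or.inr (h2.symm.trans h1)
    · left
      have := congrArg f.map (h2.symm.trans h1)
      rwa [filling_map_map, filling_map_map] at this
  clear hx' hy' hx hy wlog1
  obtain ⟨t, ht, rfl⟩ := hzx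
  obtain ⟨s, hs, hst⟩ := hzy
  have hpt := P.fillArc_param_mem f x' ht
  have hps := P.fillArc_param_mem f y' hs
  obtain ⟨o, k⟩ := x'
  obtain ⟨o', l⟩ := y'
  have ho : o' = o := by
    by_contra h
    exact D.collar_ne hψ h hps hpt hst
  subst ho
  have h1 := D.collar_injOn hψ o' hps hpt hst
  rw [Prod.mk.injEq] at h1
  obtain ⟨rfl, h2⟩ := h1
  have hmono := P.pos_strictMono o'
  have hk := hmono hltx
  have hl := hmono hlty
  change P.position ⟨o', k⟩ < P.position (f.map ⟨o', k⟩) at hk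
  change P.position ⟨o', l⟩ < P.position (f.map ⟨o', l⟩) at hl
  rw [uIcc_of_le hk.le] at ht
  rw [uIcc_of_le hl.le] at hs
  have hcase : ∀ k l : Fin (2 * sig n₀ n o'), k < (f o').toFun k → l < (f o').toFun l →
      P.position ⟨o', k⟩ ≤ s → s ≤ P.position (f.map ⟨o', k⟩) →
      P.position ⟨o', l⟩ ≤ s → s ≤ P.position (f.map ⟨o', l⟩) →
      (s - P.position ⟨o', l⟩) * (P.position (f.map ⟨o', l⟩) - s)
        = (s - P.position ⟨o', k⟩) * (P.position (f.map ⟨o', k⟩) - s) → ¬ k < l := by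
    intro k l hk hl h1 h2 h3 h4 h5 hkl
    rcases lt_trichotomy ((f o').toFun l) ((f o').toFun k) with h | h | h
    · exact parabola_ne (hmono hkl) h3 h4 (hmono h) h5.symm
    · exact hkl.ne' ((f o').involutive.injective h)
    · rcases lt_trichotomy l ((f o').toFun k) with h' | h' | h'
      · exact (f o').noncrossing k l hkl h' h
      · have := (f o').involutive k
        rw [← h'] at this
        rw [this] at hl
        exact absurd hl (not_lt.2 hkl.le)
      · have : P.position (f.map ⟨o', k⟩) < P.position ⟨o', l⟩ := hmono h'
        linarith
  rcases lt_trichotomy k l with h | h | h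
  · exact absurd h (hcase k l hltx hlty ht.1 ht.2 hs.1 hs.2 h2)
  · rw [h]
  · exact absurd h (hcase l k hlty hltx hs.1 hs.2 ht.1 ht.2 h2.symm)

theorem strand_of_mem_fillArc (hψ : D.outer.IsChart ψ) (f : Filling n₀ n)
    {x : BoundaryPoint n₀ n} {s : P.strands} {z : ℂ} (hs : z ∈ ψ '' s.1)
    (hx : z ∈ P.fillArc ψ f x) : P.strand x = s ∨ P.strand (f.map x) = s := by
  obtain ⟨w, hw, rfl⟩ := hs
  obtain ⟨t, ht, htw⟩ := hx
  have hp := P.fillArc_param_mem f x ht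
  have hws : w ∈ D.surface := (P.isStrand s.1 s.2).1 hw
  have h0 := D.eq_zero_of_collar_mem hψ hp hws htw.symm
  simp only at h0 htw
  rw [h0, D.collar_zero hψ] at htw
  have hbd : (D.disc x.1).bd t ∈ D.outer.carrier := by
    have := (D.disc x.1).boundary_subset ((D.disc x.1).bd_mem t)
    rcases x with ⟨_ | j, k⟩
    · exact this
    · exact D.inner_subset_outer j this
  have hwt := hψ.injOn hbd hws.1 htw
  rw [← P.pt_mem_iff, ← P.pt_mem_iff]
  rcases mul_eq_zero.1 h0 with h | h
  · left
    have : t = P.position x := by linarith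
    rw [← hwt, this] at hw
    exact hw
  · right
    have : t = P.position (f.map x) := by linarith
    rw [← hwt, this] at hw
    exact hw

/-- The part of the completed link at a boundary point: its strand and, away from the disc `o`, the
arc of the filling. -/
def piece (ψ : ℂ → ℂ) (f : Filling n₀ n) (o : Option ι) (x : BoundaryPoint n₀ n) : Set ℂ :=
  ψ '' (P.strand x).1 ∪ {z | x.1 ≠ o ∧ z ∈ P.fillArc ψ f x}

/-- The component of a boundary point in the completed link away from the disc `o`. -/
def component (ψ : ℂ → ℂ) (f : Filling n₀ n) (o : Option ι) (x : BoundaryPoint n₀ n) : Set ℂ :=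
  {z | ∃ y, P.Away f o x y ∧ z ∈ P.piece ψ f o y}

variable {P}

theorem away_of_strand_eq {f : Filling n₀ n} {o : Option ι} {x y : BoundaryPoint n₀ n}
    (h : P.strand x = P.strand y) : P.Away f o x y :=
  away_iff.2 (StrandRel.of_eq h)

theorem away_map {f : Filling n₀ n} {o : Option ι} {x : BoundaryPoint n₀ n} (h : x.1 ≠ o) :
    P.Away f o x (f.map x) := .rel _ _ (Or.inr ⟨h, rfl⟩)

theorem away_of_mem_piece (hψ : D.outer.IsChart ψ) {f : Filling n₀ n} {o : Option ι}
    {x y : BoundaryPoint n₀ n} {z : ℂ} (hx : z ∈ P.piece ψ f o x) (hy : z ∈ P.piece ψ f o y) :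
    P.Away f o x y := by
  have hsf : ∀ x y, z ∈ ψ '' (P.strand x).1 → y.1 ≠ o → z ∈ P.fillArc ψ f y → P.Away f o x y := by
    intro x y hx hyo hy
    rcases P.strand_of_mem_fillArc hψ f hx hy with h | h
    · exact away_of_strand_eq h.symm
    · exact (away_of_strand_eq h.symm).trans _ _ _ (away_map hyo).symm
  rcases hx with hx | ⟨hxo, hx⟩ <;> rcases hy with hy | ⟨hyo, hy⟩
  · obtain ⟨v, hv, rfl⟩ := hx
    obtain ⟨w, hw, hwv⟩ := hy
    have := hψ.injOn ((P.isStrand _ (P.strand y).2).1 hw).1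
      ((P.isStrand _ (P.strand x).2).1 hv).1 hwv
    exact away_of_strand_eq (P.strand_eq_of_mem hv (this ▸ hw))
  · exact hsf x y hx hyo hy
  · exact (hsf y x hy hxo hx).symm
  · rcases P.fillArc_disjoint hψ f hx hy with rfl | rfl
    · exact .refl _
    · exact away_map hxo

/-- Different components of the completed link are disjoint. -/
theorem away_of_mem_component (hψ : D.outer.IsChart ψ) {f : Filling n₀ n} {o : Option ι}
    {x y : BoundaryPoint n₀ n} {z : ℂ} (hx : z ∈ P.component ψ f o x)
    (hy : z ∈ P.component ψ f o y) : P.Away f o x y := by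
  obtain ⟨x', hx', hzx⟩ := hx
  obtain ⟨y', hy', hzy⟩ := hy
  exact (hx'.trans _ _ _ (away_of_mem_piece hψ hzx hzy)).trans _ _ _ hy'.symm

theorem _root_.Path.isPathConnected_range {X : Type*} [TopologicalSpace X] {a b : X}
    (γ : Path a b) :
    IsPathConnected (range γ) := by
  have : PathConnectedSpace unitInterval := isPathConnected_iff_pathConnectedSpace.1
    ((convex_Icc (0 : ℝ) 1).isPathConnected ⟨0, by simp⟩)
  exact _root_.isPathConnected_range γ.continuous

theorem _root_.IsArc.isPathConnected {s : Set ℂ} {a b : ℂ} (h : IsArc s a b) :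
    IsPathConnected s := by
  obtain ⟨γ, -, rfl⟩ := h
  exact γ.isPathConnected_range

theorem isPathConnected_strand (s : P.strands) : IsPathConnected s.1 := by
  rcases (P.isStrand s.1 s.2).2 with ⟨a, b, -, h, -⟩ | ⟨⟨a, γ, -, h⟩, -⟩
  · exact h.isPathConnected
  · exact h ▸ γ.isPathConnected_range

/-- Connected boundary points are joined by a path in their component. -/
theorem joinedIn_component (hψ : D.outer.IsChart ψ) {f : Filling n₀ n} {o : Option ι}
    {x y : BoundaryPoint n₀ n} (h : P.Away f o x y) :
    JoinedIn (P.component ψ f o x) (ψ (P.pt x.1 x.2)) (ψ (P.pt y.1 y.2)) := by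
  suffices key : ∀ w, P.Away f o w x →
      JoinedIn (P.component ψ f o w) (ψ (P.pt x.1 x.2)) (ψ (P.pt y.1 y.2)) from key x (.refl _)
  have hstrand : ∀ w x y, P.Away f o w x → P.strand x = P.strand y →
      JoinedIn (P.component ψ f o w) (ψ (P.pt x.1 x.2)) (ψ (P.pt y.1 y.2)) := by
    intro w x y hw hxy
    have hpc : IsPathConnected (ψ '' (P.strand x).1) :=
      (isPathConnected_strand _).image' (hψ.continuousOn.mono fun z hz =>
        ((P.isStrand _ (P.strand x).2).1 hz).1)
    refine (hpc.joinedIn _ (mem_image_of_mem _ (P.pt_mem_strand x)) _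
      (mem_image_of_mem _ (hxy ▸ P.pt_mem_strand y))).mono ?_
    exact fun z hz => ⟨x, hw, Or.inl hz⟩
  induction h with
  | rel x y h =>
    intro w hw
    rcases h with ⟨s, hs, hx, hy⟩ | ⟨hx, rfl⟩
    · exact hstrand w x y hw (((P.pt_mem_iff x ⟨s, hs⟩).1 hx).trans
        ((P.pt_mem_iff y ⟨s, hs⟩).1 hy).symm)
    · exact (P.joinedIn_fillArc hψ f x).mono fun z hz => ⟨x, hw, Or.inr ⟨hx, hz⟩⟩
  | refl x => exact fun w hw => hstrand w x x hw rfl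
  | symm x y h ih => exact fun w hw => (ih w (hw.trans _ _ _ (Relation.EqvGen.symm _ _ h))).symm
  | trans x y z h _ ih1 ih2 => exact fun w hw => (ih1 w hw).trans (ih2 w (hw.trans _ _ _ h))

theorem component_none_subset (hψ : D.outer.IsChart ψ) {f : Filling n₀ n}
    {x : BoundaryPoint n₀ n} {z : ℂ} (hz : z ∈ P.component ψ f none x) : ‖z‖ ≤ 1 := by
  obtain ⟨y, -, ⟨w, hw, rfl⟩ | ⟨hyo, t, ht, rfl⟩⟩ := hz
  · exact hψ.norm_le ((P.isStrand _ (P.strand y).2).1 hw).1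
  · obtain ⟨j, hj⟩ := Option.ne_none_iff_exists'.1 hyo
    have := D.norm_collar_some_lt hψ (P.fillArc_param_mem f y ht) j
    rw [← hj] at this
    exact this.le

theorem component_some_notMem (hψ : D.outer.IsChart ψ) {f : Filling n₀ n} {i : ι}
    {x : BoundaryPoint n₀ n} {z : ℂ} (hz : z ∈ P.component ψ f (some i) x) :
    z ∉ (ψ ∘ (D.inner i).toFun) '' Metric.ball 0 1 := by
  obtain ⟨y, -, ⟨w, hw, rfl⟩ | ⟨hyo, t, ht, rfl⟩⟩ := hz
  · rintro ⟨v, hv, hvw⟩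
    have hws := (P.isStrand _ (P.strand y).2).1 hw
    have := hψ.injOn (D.inner_subset_outer i
      (mem_image_of_mem _ (Metric.ball_subset_closedBall hv))) hws.1 hvw
    exact hws.2 (mem_iUnion.2 ⟨i, this ▸ mem_image_of_mem _ hv⟩)
  · exact D.collar_notMem_inner hψ hyo (P.fillArc_param_mem f y ht)

/-- Connections with crossing end points on the boundary circle of a disc belong to the same
component of the completed link. -/
theorem away_of_crossing {f : Filling n₀ n} {o : Option ι} {a b c d : Fin (2 * sig n₀ n o)}
    (hab : a < b) (hbc : b < c) (hcd : c < d) (hac : P.Away f o ⟨o, a⟩ ⟨o, c⟩)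
    (hbd : P.Away f o ⟨o, b⟩ ⟨o, d⟩) : P.Away f o ⟨o, a⟩ ⟨o, b⟩ := by
  obtain ⟨ψ, hψ⟩ := D.outer.exists_isChart
  obtain ⟨α, hα⟩ := joinedIn_component hψ hac
  obtain ⟨β, hβ⟩ := joinedIn_component hψ hbd
  have hm := P.pos_strictMono o
  have hda : P.pos o d < P.pos o a + 1 := by linarith [(P.pos_mem o d).2, (P.pos_mem o a).1]
  have : ∃ s t, α s = β t := by
    rcases o with _ | i
    · have hp : ∀ k, ψ (P.pt none k) = circlePoint (P.pos none k) := fun k => hψ.bd _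
      exact exists_eq_of_crossing_closedBall α.continuous β.continuous
        (fun t => component_none_subset hψ (hα t)) (fun t => component_none_subset hψ (hβ t))
        (hm hab) (hm hbc) (hm hcd) hda (α.source.trans (hp a)) (β.source.trans (hp b))
        (α.target.trans (hp c)) (β.target.trans (hp d))
    · exact exists_eq_of_crossing_compl (D.continuousOn_inner hψ i) (D.hasDifferenceLog_inner hψ i)
        α.continuous β.continuous
        (fun t => component_some_notMem hψ (hα t)) (fun t => component_some_notMem hψ (hβ t))
        (hm hab) (hm hbc) (hm hcd) hda α.source β.source α.target β.target
  obtain ⟨s, t, hst⟩ := this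
  exact away_of_mem_component hψ (hα s) (hst ▸ hβ t)

variable (P)

/-- The crossingless matching of the points on the boundary circle of `o` that is induced by the
diagram and the filling of the other discs. -/
noncomputable def induced [Finite ι] (f : Filling n₀ n) (o : Option ι) :
    NCMatching (2 * sig n₀ n o) where
  toFun k := (P.exists_away f o k).choose
  involutive k := by
    have h1 := (P.exists_away f o k).choose_spec
    have h2 := (P.exists_away f o (P.exists_away f o k).choose).choose_spec
    exact ((h2.2.2 k h1.2.1.symm).resolve_left h1.1.symm).symm
  ne k := (P.exists_away f o k).choose_spec.1
  noncrossing a b hab hba hcd := by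
    have h1 := (P.exists_away f o a).choose_spec
    have h2 := (P.exists_away f o b).choose_spec
    rcases h1.2.2 b (away_of_crossing hab hba hcd h1.2.1 h2.2.1) with h | h
    · exact hab.ne' h
    · exact hba.ne h

theorem away_induced [Finite ι] (f : Filling n₀ n) (o : Option ι) (k : Fin (2 * sig n₀ n o)) :
    P.Away f o ⟨o, k⟩ ⟨o, (P.induced f o).toFun k⟩ :=
  (P.exists_away f o k).choose_spec.2.1

theorem eq_or_eq_of_away [Finite ι] {f : Filling n₀ n} {o : Option ι} {k m : Fin (2 * sig n₀ n o)}
    (h : P.Away f o ⟨o, k⟩ ⟨o, m⟩) : m = k ∨ m = (P.induced f o).toFun k :=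
  (P.exists_away f o k).choose_spec.2.2 m h

/-- The induced matching is the only one that connects points as the diagram does. -/
theorem eq_induced [Finite ι] {f : Filling n₀ n} {o : Option ι} {g : NCMatching (2 * sig n₀ n o)}
    (h : ∀ k, P.Away f o ⟨o, k⟩ ⟨o, g.toFun k⟩) : g = P.induced f o :=
  NCMatching.toFun_injective _ (funext fun k =>
    (P.eq_or_eq_of_away (h k)).resolve_left (g.ne k))

end PlanarDiagram

/-! ### The strands of a glued diagram -/

/-- A connected subset of a finite union of disjoint closed sets lies in one of them. -/
theorem IsPreconnected.subset_of_mem_sUnion {X : Type*} [TopologicalSpace X] {K : Set (Set X)}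
    (hf : K.Finite) (hd : K.PairwiseDisjoint id) (hc : ∀ t ∈ K, IsClosed t) {s : Set X}
    (hs : IsPreconnected s) (hsK : s ⊆ ⋃₀ K) {t : Set X} (ht : t ∈ K) {x : X} (hxs : x ∈ s)
    (hxt : x ∈ t) : s ⊆ t := by
  have hcl : IsClosed (⋃₀ (K \ {t})) := by
    rw [sUnion_eq_biUnion]
    exact (hf.subset sdiff_subset).isClosed_biUnion fun u hu => hc u hu.1
  have hdis : Disjoint t (⋃₀ (K \ {t})) := by
    rw [disjoint_sUnion_right]
    exact fun u hu => hd ht hu.1 (Ne.symm hu.2)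
  refine (isPreconnected_iff_subset_of_disjoint_closed.1 hs t _ (hc t ht) hcl ?_ ?_).resolve_right
    fun h => Set.disjoint_left.1 hdis hxt (h hxs)
  · intro y hy
    obtain ⟨u, hu, hyu⟩ := hsK hy
    by_cases h : u = t
    · exact Or.inl (h ▸ hyu)
    · exact Or.inr ⟨u, ⟨hu, h⟩, hyu⟩
  · rw [hdis.inter_eq, inter_empty]

theorem PlanarDiagram.isCompact_strand {ι : Type*} {D : DiscConfiguration ι} {n₀ : ℕ} {n : ι → ℕ}
    {P : PlanarDiagram D n₀ n} (s : P.strands) : IsCompact s.1 := by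
  rcases (P.isStrand s.1 s.2).2 with ⟨a, b, -, ⟨γ, -, h⟩, -⟩ | ⟨⟨a, γ, -, h⟩, -⟩ <;>
  exact h ▸ isCompact_range γ.continuous

namespace GluingMap

variable {ι ι' : Type*} {D : DiscConfiguration ι} {D' : DiscConfiguration ι'}
  {n : ι → ℕ} {n₀' : ℕ} {n' : ι' → ℕ} {R : PlanarDiagram D' n₀' n'} {i : ι'}
  {P : PlanarDiagram D (n' i) n} (G : GluingMap R i P)

/-- The strands of the two diagrams, as subsets of the plane of the glued diagram. -/
def part : R.strands ⊕ P.strands → Set ℂ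
  | Sum.inl s => s.1
  | Sum.inr s => G.toFun '' s.1

theorem strand_subset_outer (s : P.strands) : s.1 ⊆ D.outer.carrier := fun _ hz =>
  ((P.isStrand s.1 s.2).1 hz).1

theorem isPathConnected_part (a : R.strands ⊕ P.strands) : IsPathConnected (G.part a) := by
  rcases a with s | s
  · exact PlanarDiagram.isPathConnected_strand s
  · exact (PlanarDiagram.isPathConnected_strand s).image'
      (G.continuousOn.mono (strand_subset_outer s))

theorem isCompact_part (a : R.strands ⊕ P.strands) : IsCompact (G.part a) := by
  rcases a with s | s
  · exact PlanarDiagram.isCompact_strand s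
  · exact (PlanarDiagram.isCompact_strand s).image_of_continuousOn
      (G.continuousOn.mono (strand_subset_outer s))

theorem iUnion_part : ⋃ a, G.part a = (R.comp i P G).carrier := by
  rw [PlanarDiagram.carrier_comp]
  ext z
  simp only [mem_iUnion, Sum.exists, part, mem_union, PlanarDiagram.carrier, image_sUnion,
    mem_sUnion, Subtype.exists, exists_prop, mem_image, exists_exists_and_eq_and]

theorem exists_strand_part (a : R.strands ⊕ P.strands) :
    ∃ t : (R.comp i P G).strands, G.part a ⊆ t.1 := by
  have hsub : G.part a ⊆ ⋃₀ (R.comp i P G).strands := by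
    have := subset_iUnion G.part a
    rwa [G.iUnion_part] at this
  obtain ⟨z, hz⟩ := (G.isPathConnected_part a).nonempty
  obtain ⟨t, ht, hzt⟩ := hsub hz
  exact ⟨⟨t, ht⟩, (G.isPathConnected_part a).isConnected.isPreconnected.subset_of_mem_sUnion
    (R.comp i P G).finite_strands (R.comp i P G).disjoint_strands
    (fun u hu => (PlanarDiagram.isCompact_strand ⟨u, hu⟩).isClosed) hsub ht hz hzt⟩

/-- The strand of the glued diagram that contains a strand of one of the two diagrams. -/
noncomputable def toComp (a : R.strands ⊕ P.strands) : (R.comp i P G).strands :=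
  (G.exists_strand_part a).choose

theorem part_subset (a : R.strands ⊕ P.strands) : G.part a ⊆ (G.toComp a).1 :=
  (G.exists_strand_part a).choose_spec

theorem toComp_eq_of_mem {a : R.strands ⊕ P.strands} {t : (R.comp i P G).strands} {z : ℂ}
    (hz : z ∈ G.part a) (ht : z ∈ t.1) : G.toComp a = t :=
  (R.comp i P G).strand_eq_of_mem (G.part_subset a hz) ht

theorem toComp_surjective : Function.Surjective G.toComp := by
  intro t
  obtain ⟨z, hz⟩ := (PlanarDiagram.isPathConnected_strand t).nonempty
  have : z ∈ ⋃ a, G.part a := by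
    rw [G.iUnion_part]
    exact ⟨t.1, t.2, hz⟩
  obtain ⟨a, ha⟩ := mem_iUnion.1 this
  exact ⟨a, G.toComp_eq_of_mem ha hz⟩

/-- The strands that are glued at a point. -/
def Glued (_ : GluingMap R i P) (a b : R.strands ⊕ P.strands) : Prop :=
  ∃ k : Fin (2 * n' i), a = Sum.inl (R.strand ⟨some i, k⟩) ∧ b = Sum.inr (P.strand ⟨none, k⟩)

theorem toComp_glue (k : Fin (2 * n' i)) :
    G.toComp (Sum.inl (R.strand ⟨some i, k⟩)) = G.toComp (Sum.inr (P.strand ⟨none, k⟩)) := by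
  refine G.toComp_eq_of_mem (z := R.pt (some i) k) (R.pt_mem_strand ⟨some i, k⟩) ?_
  refine G.part_subset _ ?_
  rw [← G.map_pt k]
  exact mem_image_of_mem _ (P.pt_mem_strand ⟨none, k⟩)

/-- Strands of the two diagrams meet only at the points at which they are glued. -/
theorem eqvGen_glued_of_mem {a b : R.strands ⊕ P.strands} {z : ℂ} (ha : z ∈ G.part a)
    (hb : z ∈ G.part b) : Relation.EqvGen G.Glued a b := by
  have hmix : ∀ (s : R.strands) (t : P.strands), z ∈ s.1 → z ∈ G.toFun '' t.1 →
      G.Glued (Sum.inl s) (Sum.inr t) := by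
    rintro s t hs ⟨w, hw, rfl⟩
    have hwP : w ∈ P.carrier := ⟨t.1, t.2, hw⟩
    have h1 := (G.glue_iff w (strand_subset_outer t hw)).1 ⟨hwP, s.1, s.2, hs⟩
    obtain ⟨k, rfl⟩ := (P.mem_boundary_iff none w).1 h1
    refine ⟨k, ?_, ?_⟩
    · rw [(R.pt_mem_iff ⟨some i, k⟩ s).1 (by rwa [← show _ = R.pt (some i) k from G.map_pt k])]
    · rw [(P.pt_mem_iff ⟨none, k⟩ t).1 hw]
  rcases a with s | s <;> rcases b with t | t
  · rw [R.strand_eq_of_mem ha hb]; exact .refl _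
  · exact .rel _ _ (hmix s t ha hb)
  · exact (Relation.EqvGen.rel _ _ (hmix t s hb ha)).symm
  · obtain ⟨v, hv, rfl⟩ := ha
    obtain ⟨w, hw, hwv⟩ := hb
    have := G.injOn (strand_subset_outer t hw) (strand_subset_outer s hv) hwv
    rw [P.strand_eq_of_mem hv (this ▸ hw)]
    exact .refl _

/-- A strand of the glued diagram consists of strands that are glued to each other. -/
theorem eqvGen_glued_of_toComp_eq {a b : R.strands ⊕ P.strands} (h : G.toComp a = G.toComp b) :
    Relation.EqvGen G.Glued a b := by
  have : Finite R.strands := R.finite_strands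
  have : Finite P.strands := P.finite_strands
  by_contra hab
  -- separate the strand into the parts that are chained to `a` and the others
  let U : Set ℂ := ⋃ c ∈ {c | Relation.EqvGen G.Glued a c}, G.part c
  let V : Set ℂ := ⋃ c ∈ {c | ¬ Relation.EqvGen G.Glued a c}, G.part c
  have hU : IsClosed U := (toFinite _).isClosed_biUnion fun c _ => (G.isCompact_part c).isClosed
  have hV : IsClosed V := (toFinite _).isClosed_biUnion fun c _ => (G.isCompact_part c).isClosed
  have hUV : U ∩ V = ∅ := by
    rw [eq_empty_iff_forall_notMem]
    rintro z ⟨hz1, hz2⟩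
    simp only [U, V, mem_iUnion, mem_ofPred_eq, exists_prop] at hz1 hz2
    obtain ⟨c, hc, hzc⟩ := hz1
    obtain ⟨d, hd, hzd⟩ := hz2
    exact hd (hc.trans _ _ _ (G.eqvGen_glued_of_mem hzc hzd))
  have hcov : (G.toComp a).1 ⊆ U ∪ V := by
    intro z hz
    have : z ∈ ⋃ a, G.part a := by
      rw [G.iUnion_part]
      exact ⟨_, (G.toComp a).2, hz⟩
    obtain ⟨c, hc⟩ := mem_iUnion.1 this
    by_cases h : Relation.EqvGen G.Glued a c
    · exact Or.inl (mem_biUnion h hc)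
    · exact Or.inr (mem_biUnion h hc)
  have hconn : IsPreconnected (G.toComp a).1 :=
    (PlanarDiagram.isPathConnected_strand (G.toComp a)).isConnected.isPreconnected
  obtain ⟨z, hz⟩ := (G.isPathConnected_part a).nonempty
  obtain ⟨w, hw⟩ := (G.isPathConnected_part b).nonempty
  have hzU : z ∈ U := mem_biUnion (Relation.EqvGen.refl a) hz
  have hwV : w ∈ V := mem_biUnion hab hw
  rcases isPreconnected_iff_subset_of_disjoint_closed.1 hconn U V hU hV hcov
    (by rw [hUV, inter_empty]) with h' | h'
  · have : w ∈ U ∩ V := ⟨h' (h ▸ G.part_subset b hw), hwV⟩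
    rw [hUV] at this
    exact this
  · have : z ∈ U ∩ V := ⟨hzU, h' (G.part_subset a hz)⟩
    rw [hUV] at this
    exact this

/-- Functions on the strands of the two diagrams that agree at the glued points descend to the
strands of the glued diagram. -/
theorem eq_of_toComp_eq {Y : Type*} {u : R.strands ⊕ P.strands → Y}
    (hu : ∀ k : Fin (2 * n' i), u (Sum.inl (R.strand ⟨some i, k⟩)) =
      u (Sum.inr (P.strand ⟨none, k⟩))) {a b : R.strands ⊕ P.strands}
    (h : G.toComp a = G.toComp b) : u a = u b := by
  have hab := G.eqvGen_glued_of_toComp_eq h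
  clear h
  induction hab with
  | rel a b h =>
    obtain ⟨k, rfl, rfl⟩ := h
    exact hu k
  | refl => rfl
  | symm _ _ _ ih => exact ih.symm
  | trans _ _ _ _ _ ih1 ih2 => exact ih1.trans ih2

theorem strand_comp_none (k : Fin (2 * n₀')) :
    (R.comp i P G).strand ⟨none, k⟩ = G.toComp (Sum.inl (R.strand ⟨none, k⟩)) :=
  (G.toComp_eq_of_mem (R.pt_mem_strand ⟨none, k⟩) ((R.comp i P G).pt_mem_strand ⟨none, k⟩)).symm

theorem strand_comp_inl (j : {j : ι' // j ≠ i}) (k : Fin (2 * n' j)) :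
    (R.comp i P G).strand ⟨some (Sum.inl j), k⟩ =
      G.toComp (Sum.inl (R.strand ⟨some j.1, k⟩)) :=
  (G.toComp_eq_of_mem (R.pt_mem_strand ⟨some j.1, k⟩)
    ((R.comp i P G).pt_mem_strand ⟨some (Sum.inl j), k⟩)).symm

theorem strand_comp_inr (j : ι) (k : Fin (2 * n j)) :
    (R.comp i P G).strand ⟨some (Sum.inr j), k⟩ =
      G.toComp (Sum.inr (P.strand ⟨some j, k⟩)) :=
  (G.toComp_eq_of_mem (mem_image_of_mem G.toFun (P.pt_mem_strand ⟨some j, k⟩))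
    ((R.comp i P G).pt_mem_strand ⟨some (Sum.inr j), k⟩)).symm

end GluingMap

namespace PlanarDiagram

variable {ι : Type*} {D : DiscConfiguration ι} {n₀ : ℕ} {n : ι → ℕ} (P : PlanarDiagram D n₀ n)

/-! ### Circles and boundaries of decorated links -/

/-- The circle that contains a strand. -/
def circle (f : Filling n₀ n) (s : P.strands) : P.Circles f := Quot.mk _ s

variable {P}

theorem circle_surjective (f : Filling n₀ n) : Function.Surjective (P.circle f) :=
  Quot.mk_surjective

theorem circle_eq_iff {f : Filling n₀ n} {s t : P.strands} :
    P.circle f s = P.circle f t ↔ P.StrandRel f univ s t := by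
  refine Quot.eq.trans ?_
  constructor
  · refine Relation.EqvGen.map (f := id) ?_
    rintro s t ⟨o, k, hs, ht⟩
    exact .rel _ _ ⟨⟨o, k⟩, mem_univ _, (P.pt_mem_iff ⟨o, k⟩ s).1 hs,
      (P.pt_mem_iff (f.map ⟨o, k⟩) t).1 ht⟩
  · refine Relation.EqvGen.map (f := id) ?_
    rintro s t ⟨x, -, hs, ht⟩
    exact .rel _ _ ⟨x.1, x.2, (P.pt_mem_iff x s).2 hs, (P.pt_mem_iff (f.map x) t).2 ht⟩

/-- Connected strands lie on the same circle, whatever discs the connection uses. -/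
theorem circle_eq_of_rel {f : Filling n₀ n} {A : Set (Option ι)} {s t : P.strands}
    (h : P.StrandRel f A s t) : P.circle f s = P.circle f t :=
  circle_eq_iff.2 (h.mono (subset_univ A))

theorem circle_fill (f : Filling n₀ n) (x : BoundaryPoint n₀ n) :
    P.circle f (P.strand x) = P.circle f (P.strand (f.map x)) :=
  circle_eq_of_rel (StrandRel.fill (mem_univ x.1))

variable [Finite ι]

theorem rel_induced (f : Filling n₀ n) (o : Option ι) (k : Fin (2 * sig n₀ n o)) :
    P.StrandRel f {o}ᶜ (P.strand ⟨o, k⟩) (P.strand ⟨o, (P.induced f o).toFun k⟩) :=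
  away_iff.1 (P.away_induced f o k)

/-- The circles that meet the boundary circle of a disc `o` are the components of the link formed by
the filling of `o` and the matching induced on the other side. -/
theorem circle_eq_iff_eqvGen {f : Filling n₀ n} {o : Option ι} {k l : Fin (2 * sig n₀ n o)} :
    P.circle f (P.strand ⟨o, k⟩) = P.circle f (P.strand ⟨o, l⟩) ↔
      Relation.EqvGen (fun k l => (f o).toFun k = l ∨ (P.induced f o).toFun k = l) k l := by
  constructor
  · intro h
    rw [circle_eq_iff] at h
    -- the components attached to a strand are constant along the circle
    let c : Fin (2 * sig n₀ n o) →
        Quot fun k l => (f o).toFun k = l ∨ (P.induced f o).toFun k = l := Quot.mk _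
    let Φ : P.strands → Set (Quot fun k l => (f o).toFun k = l ∨ (P.induced f o).toFun k = l) :=
      fun s => c '' {k | P.StrandRel f {o}ᶜ (P.strand ⟨o, k⟩) s}
    have hΦ : ∀ m, Φ (P.strand ⟨o, m⟩) = {c m} := by
      intro m
      ext z
      constructor
      · rintro ⟨k, hk, rfl⟩
        rcases P.eq_or_eq_of_away (away_iff.2 hk) with rfl | rfl
        · rfl
        · exact Quot.sound (Or.inr rfl)
      · rintro rfl
        exact ⟨m, .refl _, rfl⟩
    have key : ∀ s t, P.StrandRel f univ s t → Φ s = Φ t := by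
      intro s t hst
      induction hst with
      | rel s t h =>
        obtain ⟨⟨o', m⟩, -, rfl, rfl⟩ := h
        by_cases ho : o' = o
        · subst ho
          rw [hΦ m]
          refine Eq.trans ?_ (hΦ ((f o').toFun m)).symm
          exact congrArg _ (Quot.sound (Or.inl rfl))
        · have h1 : P.StrandRel f {o}ᶜ (P.strand ⟨o', m⟩) (P.strand (f.map ⟨o', m⟩)) :=
            StrandRel.fill ho
          refine congrArg (c '' ·) (Set.ext fun k => ⟨fun hk => ?_, fun hk => ?_⟩)
          · exact Relation.EqvGen.trans _ _ _ hk h1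
          · exact Relation.EqvGen.trans _ _ _ hk h1.symm
      | refl => rfl
      | symm _ _ _ ih => exact ih.symm
      | trans _ _ _ _ _ ih1 ih2 => exact ih1.trans ih2
    have := key _ _ h
    rw [hΦ, hΦ, singleton_eq_singleton_iff] at this
    exact Quot.eq.1 this
  · intro h
    induction h with
    | rel k l h =>
      rcases h with rfl | rfl
      · exact circle_fill f ⟨o, k⟩
      · exact circle_eq_of_rel (rel_induced f o k)
    | refl => rfl
    | symm _ _ _ ih => exact ih.symm
    | trans _ _ _ _ _ ih1 ih2 => exact ih1.trans ih2

end PlanarDiagram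

namespace CleavedLink

theorem ext_of_deco {n : ℕ} {L L' : CleavedLink n} (h1 : L.inside = L'.inside)
    (h2 : L.outside = L'.outside)
    (h3 : ∀ k, L.deco (Quot.mk _ k) = L'.deco (Quot.mk _ k)) : L = L' := by
  obtain ⟨f, g, s⟩ := L
  obtain ⟨f', g', s'⟩ := L'
  obtain rfl : f = f' := h1
  obtain rfl : g = g' := h2
  congr 1
  funext z
  obtain ⟨k, rfl⟩ := Quot.mk_surjective z
  exact h3 k

end CleavedLink

namespace MultiplyCleavedLink

open PlanarDiagram

variable {ι : Type*} {D : DiscConfiguration ι} {n₀ : ℕ} {n : ι → ℕ} {P : PlanarDiagram D n₀ n}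

/-- The sign of the circle through a strand. -/
def sign (M : MultiplyCleavedLink P) (s : P.strands) : ℤˣ := M.deco (P.circle M.filling s)

theorem ext_of_sign {M M' : MultiplyCleavedLink P} (h1 : M.filling = M'.filling)
    (h2 : ∀ s, M.sign s = M'.sign s) : M = M' := by
  obtain ⟨f, d⟩ := M
  obtain ⟨f', d'⟩ := M'
  obtain rfl : f = f' := h1
  congr 1
  funext z
  obtain ⟨s, rfl⟩ := Quot.mk_surjective z
  exact h2 s

/-- The decorated link with given signs on the strands. -/
def ofSign (f : Filling n₀ n) (u : P.strands → ℤˣ)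
    (hu : ∀ x, u (P.strand x) = u (P.strand (f.map x))) : MultiplyCleavedLink P where
  filling := f
  deco := Quot.lift u (by
    rintro s t ⟨o, k, hs, ht⟩
    rw [← (P.pt_mem_iff ⟨o, k⟩ s).1 hs, ← (P.pt_mem_iff (f.map ⟨o, k⟩) t).1 ht]
    exact hu ⟨o, k⟩)

theorem sign_eq_of_rel (M : MultiplyCleavedLink P) {A : Set (Option ι)} {s t : P.strands}
    (h : P.StrandRel M.filling A s t) : M.sign s = M.sign t :=
  congrArg M.deco (circle_eq_of_rel h)

theorem sign_fill (M : MultiplyCleavedLink P) (x : BoundaryPoint n₀ n) :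
    M.sign (P.strand x) = M.sign (P.strand (M.filling.map x)) :=
  congrArg M.deco (circle_fill M.filling x)

variable [Finite ι]

/-- The boundary `∂ₒ M`. -/
noncomputable def boundary (M : MultiplyCleavedLink P) :
    ∀ o : Option ι, CleavedLink (sig n₀ n o)
  | none =>
    { inside := P.induced M.filling none
      outside := M.filling none
      deco := Quot.lift (fun k => M.sign (P.strand ⟨none, k⟩)) (by
        rintro k l (rfl | rfl)
        · exact M.sign_eq_of_rel (rel_induced M.filling none k)
        · exact M.sign_fill ⟨none, k⟩) }
  | some i =>
    { inside := M.filling (some i)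
      outside := P.induced M.filling (some i)
      deco := Quot.lift (fun k => M.sign (P.strand ⟨some i, k⟩)) (by
        rintro k l (rfl | rfl)
        · exact M.sign_fill ⟨some i, k⟩
        · exact M.sign_eq_of_rel (rel_induced M.filling (some i) k)) }

/-- The boundary of a decorated link at a disc exists and is unique. -/
theorem isBoundary_iff (M : MultiplyCleavedLink P) (o : Option ι) (L : CleavedLink (sig n₀ n o)) :
    M.IsBoundary o L ↔ L = M.boundary o := by
  rcases o with _ | i
  · constructor
    · rintro ⟨h1, h2, h3⟩
      exact CleavedLink.ext_of_deco (P.eq_induced h2) h1 fun k =>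
        h3 k (P.strand ⟨none, k⟩) (P.pt_mem_strand ⟨none, k⟩)
    · rintro rfl
      refine ⟨rfl, P.away_induced M.filling none, fun k s hs => ?_⟩
      rw [← (P.pt_mem_iff ⟨none, k⟩ s).1 hs]
      rfl
  · constructor
    · rintro ⟨h1, h2, h3⟩
      exact CleavedLink.ext_of_deco h1 (P.eq_induced h2) fun k =>
        h3 k (P.strand ⟨some i, k⟩) (P.pt_mem_strand ⟨some i, k⟩)
    · rintro rfl
      refine ⟨rfl, P.away_induced M.filling (some i), fun k s hs => ?_⟩
      rw [← (P.pt_mem_iff ⟨some i, k⟩ s).1 hs]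
      rfl

end MultiplyCleavedLink

namespace GluingMap

open PlanarDiagram

variable {ι ι' : Type*} {D : DiscConfiguration ι} {D' : DiscConfiguration ι'}
  {n : ι → ℕ} {n₀' : ℕ} {n' : ι' → ℕ} {R : PlanarDiagram D' n₀' n'} {i : ι'}
  {P : PlanarDiagram D (n' i) n} (G : GluingMap R i P)

/-! ### Fillings and circles of a glued diagram -/

/-- The fillings of `R`, `P` and `R ∘ᵢ P` agree on the common discs, and on the glued circle each of
`R` and `P` is filled with the matching that the other one induces. -/
structure Compatible [Finite ι] [Finite ι'] (R : PlanarDiagram D' n₀' n') (i : ι')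
    (P : PlanarDiagram D (n' i) n) (f : Filling n₀' n') (g : Filling (n' i) n)
    (h : Filling n₀' (compSig n' i n)) : Prop where
  fill_none : h none = f none
  fill_inl : ∀ j : {j : ι' // j ≠ i}, h (some (Sum.inl j)) = f (some j.1)
  fill_inr : ∀ k, h (some (Sum.inr k)) = g (some k)
  left : f (some i) = P.induced g none
  right : g none = R.induced f (some i)

variable {G}

/-- Connections in `R` persist in `R ∘ᵢ P` if those through the `i`-th disc do.  At this stage the
filling of the `i`-th disc need not be induced by `P`. -/
theorem strandRel_inl_of_fill {f : Filling n₀' n'} {h : Filling n₀' (compSig n' i n)}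
    (h0 : h none = f none) (hl : ∀ j : {j : ι' // j ≠ i}, h (some (Sum.inl j)) = f (some j.1))
    {A : Set (Option ι')} {B : Set (Option ({j : ι' // j ≠ i} ⊕ ι))}
    (hB0 : none ∈ A → none ∈ B) (hBl : ∀ j : {j : ι' // j ≠ i}, some j.1 ∈ A → some (Sum.inl j) ∈ B)
    (hi : some i ∈ A → ∀ k, (R.comp i P G).StrandRel h B (G.toComp (Sum.inl (R.strand ⟨some i, k⟩)))
      (G.toComp (Sum.inl (R.strand ⟨some i, (f (some i)).toFun k⟩))))
    {s t : R.strands} (hst : R.StrandRel f A s t) :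
    (R.comp i P G).StrandRel h B (G.toComp (Sum.inl s)) (G.toComp (Sum.inl t)) := by
  refine Relation.EqvGen.map (f := fun s => G.toComp (Sum.inl s)) ?_ hst
  rintro _ _ ⟨⟨_ | j, k⟩, hA, rfl, rfl⟩
  · rw [← G.strand_comp_none]
    refine (StrandRel.fill (f := h) (x := ⟨none, k⟩) (hB0 hA)).trans _ _ _ (StrandRel.of_eq ?_)
    refine Eq.trans ?_ (G.strand_comp_none ((f none).toFun k))
    rw [← h0]
    rfl
  · by_cases hj : j = i
    · subst hj
      exact hi hA k
    · rw [← G.strand_comp_inl ⟨j, hj⟩ k]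
      refine (StrandRel.fill (f := h) (x := ⟨some (Sum.inl ⟨j, hj⟩), k⟩)
        (hBl ⟨j, hj⟩ hA)).trans _ _ _ (StrandRel.of_eq ?_)
      refine Eq.trans ?_ (G.strand_comp_inl ⟨j, hj⟩ ((f (some j)).toFun k))
      rw [← hl ⟨j, hj⟩]
      rfl

theorem strandRel_inr_of_fill {g : Filling (n' i) n} {h : Filling n₀' (compSig n' i n)}
    (hr : ∀ k, h (some (Sum.inr k)) = g (some k))
    {A : Set (Option ι)} {B : Set (Option ({j : ι' // j ≠ i} ⊕ ι))}
    (hBr : ∀ k, some k ∈ A → some (Sum.inr k) ∈ B)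
    (hi : none ∈ A → ∀ k, (R.comp i P G).StrandRel h B (G.toComp (Sum.inr (P.strand ⟨none, k⟩)))
      (G.toComp (Sum.inr (P.strand ⟨none, (g none).toFun k⟩))))
    {s t : P.strands} (hst : P.StrandRel g A s t) :
    (R.comp i P G).StrandRel h B (G.toComp (Sum.inr s)) (G.toComp (Sum.inr t)) := by
  refine Relation.EqvGen.map (f := fun s => G.toComp (Sum.inr s)) ?_ hst
  rintro _ _ ⟨⟨_ | j, k⟩, hA, rfl, rfl⟩
  · exact hi hA k
  · rw [← G.strand_comp_inr j k]
    refine (StrandRel.fill (f := h) (x := ⟨some (Sum.inr j), k⟩) (hBr j hA)).trans _ _ _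
      (StrandRel.of_eq ?_)
    refine Eq.trans ?_ (G.strand_comp_inr j ((g (some j)).toFun k))
    rw [← hr j]
    rfl

variable {f : Filling n₀' n'} {g : Filling (n' i) n} {h : Filling n₀' (compSig n' i n)}

/-- The circle of `R ∘ᵢ P` that contains a strand of `R` or `P`. -/
noncomputable def circleOf (G : GluingMap R i P) (h : Filling n₀' (compSig n' i n))
    (a : R.strands ⊕ P.strands) : (R.comp i P G).Circles h :=
  (R.comp i P G).circle h (G.toComp a)

theorem circleOf_surjective (h : Filling n₀' (compSig n' i n)) :
    Function.Surjective (G.circleOf h) :=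
  (circle_surjective h).comp G.toComp_surjective

theorem circleOf_glue (k : Fin (2 * n' i)) :
    G.circleOf h (Sum.inl (R.strand ⟨some i, k⟩)) = G.circleOf h (Sum.inr (P.strand ⟨none, k⟩)) :=
  congrArg ((R.comp i P G).circle h) (G.toComp_glue k)

open Classical in
/-- The circles of `R ∘ᵢ P`, described as the circles of `R` and the circles of `P` that do not meet
the glued circle. -/
noncomputable def circleCode (R : PlanarDiagram D' n₀' n') (i : ι') (P : PlanarDiagram D (n' i) n)
    (f : Filling n₀' n') (g : Filling (n' i) n) :
    R.strands ⊕ P.strands → R.Circles f ⊕ P.Circles g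
  | Sum.inl s => Sum.inl (R.circle f s)
  | Sum.inr s =>
    if hs : ∃ k, P.circle g (P.strand ⟨none, k⟩) = P.circle g s then
      Sum.inl (R.circle f (R.strand ⟨some i, hs.choose⟩))
    else Sum.inr (P.circle g s)

theorem circleCode_of_not_meets {s : P.strands}
    (hs : ¬ ∃ k, P.circle g (P.strand ⟨none, k⟩) = P.circle g s) :
    circleCode R i P f g (Sum.inr s) = Sum.inr (P.circle g s) := by
  simp only [circleCode]
  rw [dif_neg hs]

variable [Finite ι] [Finite ι']

/-- Connections in `R` persist in `R ∘ᵢ P`, where the filling of the `i`-th disc is realized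
by `P`. -/
theorem Compatible.strandRel_inl (hc : Compatible R i P f g h)
    {A : Set (Option ι')} {B : Set (Option ({j : ι' // j ≠ i} ⊕ ι))}
    (hB0 : none ∈ A → none ∈ B) (hBl : ∀ j : {j : ι' // j ≠ i}, some j.1 ∈ A → some (Sum.inl j) ∈ B)
    (hi : some i ∈ A → ∀ k, some (Sum.inr k) ∈ B)
    {s t : R.strands} (hst : R.StrandRel f A s t) :
    (R.comp i P G).StrandRel h B (G.toComp (Sum.inl s)) (G.toComp (Sum.inl t)) := by
  refine strandRel_inl_of_fill hc.fill_none hc.fill_inl hB0 hBl (fun hA k => ?_) hst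
  rw [G.toComp_glue k, hc.left]
  refine Eq.mpr (congrArg _ (G.toComp_glue _)) ?_
  exact strandRel_inr_of_fill hc.fill_inr (A := {none}ᶜ) (fun j _ => hi hA j)
    (fun h => absurd rfl h) (rel_induced g none k)

theorem Compatible.strandRel_inr (hc : Compatible R i P f g h)
    {A : Set (Option ι)} {B : Set (Option ({j : ι' // j ≠ i} ⊕ ι))}
    (hBr : ∀ k, some k ∈ A → some (Sum.inr k) ∈ B)
    (hi : none ∈ A → none ∈ B ∧ ∀ j, some (Sum.inl j) ∈ B)
    {s t : P.strands} (hst : P.StrandRel g A s t) :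
    (R.comp i P G).StrandRel h B (G.toComp (Sum.inr s)) (G.toComp (Sum.inr t)) := by
  refine strandRel_inr_of_fill hc.fill_inr hBr (fun hA k => ?_) hst
  rw [← G.toComp_glue k, hc.right]
  refine Eq.mpr (congrArg _ (G.toComp_glue _).symm) ?_
  exact strandRel_inl_of_fill hc.fill_none hc.fill_inl (A := {some i}ᶜ) (fun _ => (hi hA).1)
    (fun j _ => (hi hA).2 j) (fun h => absurd rfl h) (rel_induced f (some i) k)

theorem Compatible.circleOf_inl (hc : Compatible R i P f g h) {s t : R.strands}
    (hst : R.circle f s = R.circle f t) :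
    G.circleOf h (Sum.inl s) = G.circleOf h (Sum.inl t) :=
  circle_eq_iff.2 (hc.strandRel_inl (fun _ => mem_univ _) (fun _ _ => mem_univ _)
    (fun _ _ => mem_univ _) (circle_eq_iff.1 hst))

theorem Compatible.circleOf_inr (hc : Compatible R i P f g h) {s t : P.strands}
    (hst : P.circle g s = P.circle g t) :
    G.circleOf h (Sum.inr s) = G.circleOf h (Sum.inr t) :=
  circle_eq_iff.2 (hc.strandRel_inr (fun _ _ => mem_univ _)
    (fun _ => ⟨mem_univ _, fun _ => mem_univ _⟩) (circle_eq_iff.1 hst))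

/-- The circles of `R` and of `P` that meet the glued circle correspond to each other. -/
theorem Compatible.circle_eq_iff (hc : Compatible R i P f g h) (k l : Fin (2 * n' i)) :
    R.circle f (R.strand ⟨some i, k⟩) = R.circle f (R.strand ⟨some i, l⟩) ↔
      P.circle g (P.strand ⟨none, k⟩) = P.circle g (P.strand ⟨none, l⟩) := by
  refine circle_eq_iff_eqvGen.trans (Iff.trans ?_ circle_eq_iff_eqvGen.symm)
  have : (fun k l : Fin (2 * n' i) =>
      (f (some i)).toFun k = l ∨ (R.induced f (some i)).toFun k = l) =
      fun k l => (g none).toFun k = l ∨ (P.induced g none).toFun k = l := by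
    funext k l
    rw [hc.left, hc.right, or_comm]
  exact iff_of_eq (congrArg (fun r => Relation.EqvGen r k l) this)

theorem Compatible.circleCode_of_meets (hc : Compatible R i P f g h) {s : P.strands}
    {k : Fin (2 * n' i)} (hk : P.circle g (P.strand ⟨none, k⟩) = P.circle g s) :
    circleCode R i P f g (Sum.inr s) = Sum.inl (R.circle f (R.strand ⟨some i, k⟩)) := by
  have hs : ∃ k, P.circle g (P.strand ⟨none, k⟩) = P.circle g s := ⟨k, hk⟩
  simp only [circleCode]
  rw [dif_pos hs]
  exact congrArg Sum.inl ((hc.circle_eq_iff _ _).2 (hs.choose_spec.trans hk.symm))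

theorem Compatible.circleCode_inr_congr (hc : Compatible R i P f g h) {s t : P.strands}
    (hst : P.circle g s = P.circle g t) :
    circleCode R i P f g (Sum.inr s) = circleCode R i P f g (Sum.inr t) := by
  by_cases hs : ∃ k, P.circle g (P.strand ⟨none, k⟩) = P.circle g s
  · obtain ⟨k, hk⟩ := hs
    rw [hc.circleCode_of_meets hk, hc.circleCode_of_meets (hk.trans hst)]
  · rw [circleCode_of_not_meets hs, circleCode_of_not_meets (by rwa [← hst]), hst]

/-- The code of a strand depends only on its circle in `R ∘ᵢ P`.  So distinct circles of `R`, or of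
`P`, are not joined to each other by the gluing. -/
theorem Compatible.circleCode_eq (hc : Compatible R i P f g h) {a b : R.strands ⊕ P.strands}
    (hab : G.circleOf h a = G.circleOf h b) :
    circleCode R i P f g a = circleCode R i P f g b := by
  have hglue : ∀ {a b}, G.toComp a = G.toComp b →
      circleCode R i P f g a = circleCode R i P f g b := fun {a b} hab =>
    G.eq_of_toComp_eq (u := circleCode R i P f g)
      (fun k => (hc.circleCode_of_meets (k := k) rfl).symm) hab
  suffices key : ∀ s t, (R.comp i P G).StrandRel h univ s t → ∀ a b, G.toComp a = s →
      G.toComp b = t → circleCode R i P f g a = circleCode R i P f g b from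
    key _ _ (PlanarDiagram.circle_eq_iff.1 hab) a b rfl rfl
  intro s t hst
  induction hst with
  | rel s t hst =>
    obtain ⟨⟨_ | j | j, k⟩, -, rfl, rfl⟩ := hst
    · intro a b ha hb
      rw [G.strand_comp_none] at ha
      replace hb := hb.trans (G.strand_comp_none ((h none).toFun k))
      rw [hglue ha, hglue hb, hc.fill_none]
      exact congrArg Sum.inl (circle_fill f ⟨none, k⟩)
    · intro a b ha hb
      rw [G.strand_comp_inl] at ha
      replace hb := hb.trans (G.strand_comp_inl j ((h (some (Sum.inl j))).toFun k))
      rw [hglue ha, hglue hb, hc.fill_inl]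
      exact congrArg Sum.inl (circle_fill f ⟨some j.1, k⟩)
    · intro a b ha hb
      rw [G.strand_comp_inr] at ha
      replace hb := hb.trans (G.strand_comp_inr j ((h (some (Sum.inr j))).toFun k))
      rw [hglue ha, hglue hb, hc.fill_inr]
      exact hc.circleCode_inr_congr (circle_fill g ⟨some j, k⟩)
  | refl s => exact fun a b ha hb => hglue (ha.trans hb.symm)
  | symm s t _ ih => exact fun a b ha hb => (ih b a hb ha).symm
  | trans s t u _ _ ih1 ih2 =>
    intro a b ha hb
    obtain ⟨c, hcc⟩ := G.toComp_surjective t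
    exact (ih1 a c ha hcc).trans (ih2 c b hcc hb)

theorem Compatible.circleOf_inl_iff (hc : Compatible R i P f g h) {s t : R.strands} :
    G.circleOf h (Sum.inl s) = G.circleOf h (Sum.inl t) ↔ R.circle f s = R.circle f t :=
  ⟨fun hst => Sum.inl_injective (hc.circleCode_eq hst), hc.circleOf_inl⟩

/-- A circle of `R ∘ᵢ P` with strands of both diagrams meets the glued circle. -/
theorem Compatible.circleOf_inl_inr (hc : Compatible R i P f g h) {s : R.strands} {t : P.strands}
    (hst : G.circleOf h (Sum.inl s) = G.circleOf h (Sum.inr t)) :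
    ∃ k, R.circle f (R.strand ⟨some i, k⟩) = R.circle f s ∧
      P.circle g (P.strand ⟨none, k⟩) = P.circle g t := by
  have h1 := hc.circleCode_eq hst
  by_cases ht : ∃ k, P.circle g (P.strand ⟨none, k⟩) = P.circle g t
  · obtain ⟨k, hk⟩ := ht
    rw [hc.circleCode_of_meets hk] at h1
    exact ⟨k, (Sum.inl_injective h1).symm, hk⟩
  · rw [circleCode_of_not_meets ht] at h1
    exact absurd h1 Sum.inl_ne_inr

theorem Compatible.circleOf_inr_iff (hc : Compatible R i P f g h) {s t : P.strands} :
    G.circleOf h (Sum.inr s) = G.circleOf h (Sum.inr t) ↔ P.circle g s = P.circle g t := by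
  refine ⟨fun hst => ?_, hc.circleOf_inr⟩
  by_cases hs : ∃ k, P.circle g (P.strand ⟨none, k⟩) = P.circle g s
  · obtain ⟨k, hk⟩ := hs
    have h1 : G.circleOf h (Sum.inl (R.strand ⟨some i, k⟩)) = G.circleOf h (Sum.inr t) := by
      rw [circleOf_glue (G := G) k, hc.circleOf_inr hk, hst]
    obtain ⟨l, hl1, hl2⟩ := hc.circleOf_inl_inr h1
    exact hk.symm.trans (((hc.circle_eq_iff l k).1 hl1).symm.trans hl2)
  · have h1 := hc.circleCode_eq hst
    rw [circleCode_of_not_meets hs] at h1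
    by_cases ht : ∃ k, P.circle g (P.strand ⟨none, k⟩) = P.circle g t
    · obtain ⟨k, hk⟩ := ht
      rw [hc.circleCode_of_meets hk] at h1
      exact absurd h1 Sum.inr_ne_inl
    · rw [circleCode_of_not_meets ht] at h1
      exact Sum.inr_injective h1

end GluingMap

/-! ### Gluing decorated links -/

/-- The matching induced at a disc does not depend on the filling of that disc. -/
theorem PlanarDiagram.induced_congr {ι : Type*} [Finite ι] {D : DiscConfiguration ι} {n₀ : ℕ}
    {n : ι → ℕ} (P : PlanarDiagram D n₀ n) {f g : Filling n₀ n} {o : Option ι}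
    (h : ∀ o', o' ≠ o → f o' = g o') : P.induced f o = P.induced g o := by
  refine P.eq_induced fun k => ?_
  refine Relation.EqvGen.map (f := id) ?_ (P.away_induced f o k)
  rintro x y (hs | ⟨hx, rfl⟩)
  · exact .rel _ _ (Or.inl hs)
  · exact .rel _ _ (Or.inr ⟨hx, by simp only [id]; rw [h _ hx]⟩)

/-- Neighbouring points can be matched with each other. -/
instance (m : ℕ) : Nonempty (NCMatching (2 * m)) :=
  ⟨{ toFun := fun k => ⟨if (k : ℕ) % 2 = 0 then k + 1 else k - 1, by split_ifs <;> omega⟩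
     involutive := by
       intro k
       ext
       simp only
       split_ifs <;> omega
     ne := by
       intro k h
       have := congrArg Fin.val h
       simp only at this
       split_ifs at this <;> omega
     noncrossing := by
       intro a b h1 h2 _
       rw [Fin.lt_def] at h1 h2
       simp only at h2
       split_ifs at h2 <;> omega }⟩

namespace MultiplyCleavedLink

open PlanarDiagram

open Classical in
theorem discCount_eq {ι : Type*} [Fintype ι] {D : DiscConfiguration ι} {n₀ : ℕ} {n : ι → ℕ}
    {P : PlanarDiagram D n₀ n} (M : MultiplyCleavedLink P) (C : P.Circles M.filling) :
    M.discCount C =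
      ∑ o : Option ι, if ∃ k, P.circle M.filling (P.strand ⟨o, k⟩) = C then 1 else 0 := by
  have : {o : Option ι | ∃ (k : _) (s : P.strands), P.pt o k ∈ s.1 ∧ Quot.mk _ s = C} =
      {o : Option ι | ∃ k, P.circle M.filling (P.strand ⟨o, k⟩) = C} := by
    ext o
    refine exists_congr fun k => ⟨?_, fun h => ⟨_, P.pt_mem_strand ⟨o, k⟩, h⟩⟩
    rintro ⟨s, hs, rfl⟩
    rw [(P.pt_mem_iff ⟨o, k⟩ s).1 hs]
    rfl
  rw [discCount, this, Set.ncard_eq_toFinset_card', ← Finset.card_filter]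
  congr 1
  ext o
  simp

end MultiplyCleavedLink

theorem Fintype.prod_fiber_of_injective {α β M : Type*} [Fintype α] [DecidableEq β] [CommMonoid M]
    {r : α → β} (hr : Function.Injective r) (f : α → M) (a : α) :
    ∏ x : {x // r x = r a}, f x = f a := by
  have : Subsingleton {x // r x = r a} :=
    ⟨fun x y => Subtype.ext (hr (x.2.trans y.2.symm))⟩
  exact Fintype.prod_subsingleton _ (⟨a, rfl⟩ : {x // r x = r a})

namespace GluingMap

open PlanarDiagram MultiplyCleavedLink

variable {ι ι' : Type*} {D : DiscConfiguration ι} {D' : DiscConfiguration ι'}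
  {n : ι → ℕ} {n₀' : ℕ} {n' : ι' → ℕ} {R : PlanarDiagram D' n₀' n'} {i : ι'}
  {P : PlanarDiagram D (n' i) n} {G : GluingMap R i P}

/-- The decorated link `Q` on `R ∘ᵢ P` is obtained by gluing the decorated links `N` on `R` and `M`
on `P`. -/
structure Glues [Finite ι] [Finite ι'] (G : GluingMap R i P) (N : MultiplyCleavedLink R)
    (M : MultiplyCleavedLink P) (Q : MultiplyCleavedLink (R.comp i P G)) : Prop where
  compatible : Compatible R i P N.filling M.filling Q.filling
  sign_inl : ∀ s, Q.sign (G.toComp (Sum.inl s)) = N.sign s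
  sign_inr : ∀ s, Q.sign (G.toComp (Sum.inr s)) = M.sign s

section Finite

variable [Finite ι] [Finite ι'] {N N' : MultiplyCleavedLink R} {M M' : MultiplyCleavedLink P}
  {Q Q' : MultiplyCleavedLink (R.comp i P G)}

/-- Decorated links on `P` and `R` have the same boundary on the glued circle if each is filled
there with the matching that the other one induces, and the signs agree at the glued points. -/
theorem boundary_eq_iff : M.boundary none = N.boundary (some i) ↔
    N.filling (some i) = P.induced M.filling none ∧
      M.filling none = R.induced N.filling (some i) ∧
      ∀ k, N.sign (R.strand ⟨some i, k⟩) = M.sign (P.strand ⟨none, k⟩) := by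
  constructor
  · intro h
    have h1 : (N.boundary (some i)).inside = (M.boundary none).inside :=
      congrArg CleavedLink.inside h.symm
    have h2 : (M.boundary none).outside = (N.boundary (some i)).outside :=
      congrArg CleavedLink.outside h
    refine ⟨h1, h2, fun k => ?_⟩
    have h3 : ∀ L L' : CleavedLink (n' i), L = L' →
        L.deco (Quot.mk _ k) = L'.deco (Quot.mk _ k) := by
      rintro L _ rfl
      rfl
    exact h3 _ _ h.symm
  · rintro ⟨h1, h2, h3⟩
    exact CleavedLink.ext_of_deco (n := n' i) h1.symm h2 fun k => (h3 k).symm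

theorem Glues.boundary_eq (h : G.Glues N M Q) : M.boundary none = N.boundary (some i) := by
  refine boundary_eq_iff.2 ⟨h.compatible.left, h.compatible.right, fun k => ?_⟩
  rw [← h.sign_inl, ← h.sign_inr, G.toComp_glue]

theorem Glues.unique_comp (h : G.Glues N M Q) (h' : G.Glues N M Q') : Q = Q' := by
  refine ext_of_sign (funext ?_) fun t => ?_
  · rintro (_ | j | k)
    · rw [h.compatible.fill_none, h'.compatible.fill_none]
    · rw [h.compatible.fill_inl, h'.compatible.fill_inl]
    · rw [h.compatible.fill_inr, h'.compatible.fill_inr]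
  · obtain ⟨s | s, rfl⟩ := G.toComp_surjective t
    · rw [h.sign_inl, h'.sign_inl]
    · rw [h.sign_inr, h'.sign_inr]

theorem Glues.unique_parts (h : G.Glues N M Q) (h' : G.Glues N' M' Q) : N = N' ∧ M = M' := by
  have hN : ∀ o, o ≠ some i → N.filling o = N'.filling o := by
    rintro (_ | j) hj
    · rw [← h.compatible.fill_none, ← h'.compatible.fill_none]
    · have hj : j ≠ i := fun e => hj (congrArg some e)
      exact (h.compatible.fill_inl ⟨j, hj⟩).symm.trans (h'.compatible.fill_inl ⟨j, hj⟩)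
  have hM : ∀ o, o ≠ none → M.filling o = M'.filling o := by
    rintro (_ | k) hk
    · exact absurd rfl hk
    · rw [← h.compatible.fill_inr, ← h'.compatible.fill_inr]
  constructor
  · refine ext_of_sign (funext fun o => ?_) fun s => by rw [← h.sign_inl, ← h'.sign_inl]
    by_cases ho : o = some i
    · subst ho
      exact h.compatible.left.trans ((P.induced_congr hM).trans h'.compatible.left.symm)
    · exact hN o ho
  · refine ext_of_sign (funext fun o => ?_) fun s => by rw [← h.sign_inr, ← h'.sign_inr]
    by_cases ho : o = none
    · subst ho
      exact h.compatible.right.trans ((R.induced_congr hN).trans h'.compatible.right.symm)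
    · exact hM o ho

/-- Decorated links with the same boundary on the glued circle can be glued. -/
theorem exists_glues (h : M.boundary none = N.boundary (some i)) :
    ∃ Q : MultiplyCleavedLink (R.comp i P G), G.Glues N M Q := by
  obtain ⟨h1, h2, h3⟩ := boundary_eq_iff.1 h
  let u : (R.comp i P G).strands → ℤˣ := fun t =>
    Sum.elim N.sign M.sign (G.toComp_surjective t).choose
  have hu : ∀ a, u (G.toComp a) = Sum.elim N.sign M.sign a := fun a =>
    G.eq_of_toComp_eq h3 (G.toComp_surjective (G.toComp a)).choose_spec
  let q : Filling n₀' (compSig n' i n) := fun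
    | none => N.filling none
    | some (Sum.inl j) => N.filling (some j.1)
    | some (Sum.inr k) => M.filling (some k)
  refine ⟨ofSign q u ?_, ⟨rfl, fun _ => rfl, fun _ => rfl, h1, h2⟩,
    fun s => hu (Sum.inl s), fun s => hu (Sum.inr s)⟩
  rintro ⟨_ | j | k, m⟩
  · rw [G.strand_comp_none, hu]
    refine (N.sign_fill ⟨none, m⟩).trans
      ((hu (Sum.inl (R.strand (N.filling.map ⟨none, m⟩)))).symm.trans (congrArg u ?_))
    exact (G.strand_comp_none _).symm
  · rw [G.strand_comp_inl, hu]
    refine (N.sign_fill ⟨some j.1, m⟩).trans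
      ((hu (Sum.inl (R.strand (N.filling.map ⟨some j.1, m⟩)))).symm.trans (congrArg u ?_))
    exact (G.strand_comp_inl j _).symm
  · rw [G.strand_comp_inr, hu]
    refine (M.sign_fill ⟨some k, m⟩).trans
      ((hu (Sum.inr (P.strand (M.filling.map ⟨some k, m⟩)))).symm.trans (congrArg u ?_))
    exact (G.strand_comp_inr k _).symm

/-- Cutting a decorated link along the glued circle. -/
theorem exists_parts (Q : MultiplyCleavedLink (R.comp i P G)) : ∃ N M, G.Glues N M Q := by
  classical
  -- the matchings on the glued circle are induced from the other side, so that their values in the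
  -- first fillings `f₀` and `g₀` do not matter
  let f₀ : Filling n₀' n' := fun
    | none => Q.filling none
    | some j => if hj : j = i then Classical.arbitrary _ else Q.filling (some (Sum.inl ⟨j, hj⟩))
  let g₀ : Filling (n' i) n := fun
    | none => Classical.arbitrary _
    | some k => Q.filling (some (Sum.inr k))
  let f : Filling n₀' n' := Function.update f₀ (some i) (P.induced g₀ none)
  let g : Filling (n' i) n := Function.update g₀ none (R.induced f₀ (some i))
  have hf : ∀ o, o ≠ some i → f o = f₀ o := fun o ho => Function.update_of_ne ho _ _
  have hg : ∀ o, o ≠ none → g o = g₀ o := fun o ho => Function.update_of_ne ho _ _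
  have hc : Compatible R i P f g Q.filling := by
    refine ⟨(hf none (Option.some_ne_none i).symm).symm, fun j => ?_,
      fun k => (hg (some k) (Option.some_ne_none k)).symm, ?_, ?_⟩
    · rw [hf (some j.1) fun e => j.2 (Option.some_injective _ e)]
      simp only [f₀]
      rw [dif_neg j.2]
    · exact (Function.update_self _ _ _).trans (P.induced_congr hg).symm
    · exact (Function.update_self _ _ _).trans (R.induced_congr hf).symm
  refine ⟨ofSign f (fun s => Q.sign (G.toComp (Sum.inl s))) fun x => ?_,
    ofSign g (fun s => Q.sign (G.toComp (Sum.inr s))) fun x => ?_, hc, fun _ => rfl, fun _ => rfl⟩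
  · exact congrArg Q.deco (hc.circleOf_inl (circle_fill f x))
  · exact congrArg Q.deco (hc.circleOf_inr (circle_fill g x))

theorem Glues.boundary_none (h : G.Glues N M Q) : Q.boundary none = N.boundary none := by
  refine CleavedLink.ext_of_deco (n := n₀') ?_ h.compatible.fill_none fun k => ?_
  · refine ((R.comp i P G).eq_induced (o := none) (g := R.induced N.filling none)
      fun k => away_iff.2 ?_).symm
    have := h.compatible.strandRel_inl (G := G) (B := {none}ᶜ) (fun h => absurd rfl h)
      (fun _ _ => Option.some_ne_none _) (fun _ _ => Option.some_ne_none _)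
      (rel_induced N.filling none k)
    rwa [← G.strand_comp_none, ← G.strand_comp_none] at this
  · exact (congrArg Q.sign (G.strand_comp_none k)).trans (h.sign_inl _)

theorem Glues.boundary_inl (h : G.Glues N M Q) (j : {j : ι' // j ≠ i}) :
    Q.boundary (some (Sum.inl j)) = N.boundary (some j.1) := by
  refine CleavedLink.ext_of_deco (n := n' j) (h.compatible.fill_inl j) ?_ fun k => ?_
  · refine ((R.comp i P G).eq_induced (o := some (Sum.inl j))
      (g := R.induced N.filling (some j.1)) fun k => away_iff.2 ?_).symm
    have := h.compatible.strandRel_inl (G := G) (A := {some j.1}ᶜ) (B := {some (Sum.inl j)}ᶜ)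
      (fun _ => (Option.some_ne_none _).symm)
      (fun j' hj' e => hj' (by rw [Sum.inl_injective (Option.some_injective _ e)]; rfl))
      (fun _ k e => Sum.inr_ne_inl (Option.some_injective _ e))
      (rel_induced N.filling (some j.1) k)
    rwa [← G.strand_comp_inl, ← G.strand_comp_inl] at this
  · exact (congrArg Q.sign (G.strand_comp_inl j k)).trans (h.sign_inl _)

theorem Glues.boundary_inr (h : G.Glues N M Q) (j : ι) :
    Q.boundary (some (Sum.inr j)) = M.boundary (some j) := by
  refine CleavedLink.ext_of_deco (n := n j) (h.compatible.fill_inr j) ?_ fun k => ?_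
  · refine ((R.comp i P G).eq_induced (o := some (Sum.inr j))
      (g := P.induced M.filling (some j)) fun k => away_iff.2 ?_).symm
    have := h.compatible.strandRel_inr (G := G) (A := {some j}ᶜ) (B := {some (Sum.inr j)}ᶜ)
      (fun j' hj' e => hj' (by rw [Sum.inr_injective (Option.some_injective _ e)]; rfl))
      (fun _ => ⟨(Option.some_ne_none _).symm,
        fun j e => Sum.inl_ne_inr (Option.some_injective _ e)⟩)
      (rel_induced M.filling (some j) k)
    rwa [← G.strand_comp_inr, ← G.strand_comp_inr] at this
  · exact (congrArg Q.sign (G.strand_comp_inr j k)).trans (h.sign_inr _)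

end Finite

end GluingMap

namespace GluingMap

open PlanarDiagram MultiplyCleavedLink

variable {ι ι' : Type*} [Fintype ι] [Fintype ι'] {D : DiscConfiguration ι}
  {D' : DiscConfiguration ι'} {n : ι → ℕ} {n₀' : ℕ} {n' : ι' → ℕ} {R : PlanarDiagram D' n₀' n'}
  {i : ι'} {P : PlanarDiagram D (n' i) n} {G : GluingMap R i P} {N : MultiplyCleavedLink R}
  {M : MultiplyCleavedLink P} {Q : MultiplyCleavedLink (R.comp i P G)}

/-! ### The weight of a glued link -/

open Classical in
/-- The number of circles `∂D'ⱼ`, `j ≠ i`, or `∂D'₀` that meet a circle of the glued link. -/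
noncomputable def leftCount (G : GluingMap R i P) (Q : MultiplyCleavedLink (R.comp i P G))
    (C : (R.comp i P G).Circles Q.filling) : ℕ :=
  (if ∃ k, G.circleOf Q.filling (Sum.inl (R.strand ⟨none, k⟩)) = C then 1 else 0) +
    ∑ j : {j : ι' // j ≠ i},
      if ∃ k, G.circleOf Q.filling (Sum.inl (R.strand ⟨some j.1, k⟩)) = C then 1 else 0

open Classical in
/-- The number of circles `∂Dₖ` of the inner diagram that meet a circle of the glued link. -/
noncomputable def rightCount (G : GluingMap R i P) (Q : MultiplyCleavedLink (R.comp i P G))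
    (C : (R.comp i P G).Circles Q.filling) : ℕ :=
  ∑ j : ι, if ∃ k, G.circleOf Q.filling (Sum.inr (P.strand ⟨some j, k⟩)) = C then 1 else 0

theorem discCount_comp (C : (R.comp i P G).Circles Q.filling) :
    Q.discCount C = G.leftCount Q C + G.rightCount Q C := by
  classical
  rw [discCount_eq, Fintype.sum_option, Fintype.sum_sum_type, ← add_assoc, leftCount, rightCount]
  congr 1
  · congr 1
    · refine if_congr (exists_congr fun k => ?_) rfl rfl
      rw [G.strand_comp_none, circleOf]
    · refine Finset.sum_congr rfl fun j _ => if_congr (exists_congr fun k => ?_) rfl rfl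
      rw [G.strand_comp_inl, circleOf]
  · refine Finset.sum_congr rfl fun j _ => if_congr (exists_congr fun k => ?_) rfl rfl
    rw [G.strand_comp_inr, circleOf]

open Classical in
/-- A circle of `R` meets the same discs as its extension, apart from the inner discs of `P`, and
possibly the glued circle. -/
theorem Glues.discCount_left (h : G.Glues N M Q) (s : R.strands) :
    N.discCount (R.circle N.filling s) = G.leftCount Q (G.circleOf Q.filling (Sum.inl s)) +
      if ∃ k, R.circle N.filling (R.strand ⟨some i, k⟩) = R.circle N.filling s then 1 else 0 := by
  rw [discCount_eq, Fintype.sum_option, Fintype.sum_eq_add_sum_subtype_ne _ i, leftCount]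
  simp only [h.compatible.circleOf_inl_iff]
  ring

open Classical in
theorem Glues.discCount_right (h : G.Glues N M Q) (s : P.strands) :
    M.discCount (P.circle M.filling s) = G.rightCount Q (G.circleOf Q.filling (Sum.inr s)) +
      if ∃ k, P.circle M.filling (P.strand ⟨none, k⟩) = P.circle M.filling s then 1 else 0 := by
  rw [discCount_eq, Fintype.sum_option, rightCount]
  simp only [h.compatible.circleOf_inr_iff]
  ring

/-- A circle of the glued link is cut into at most one circle of each part.  If it is cut, both
pieces meet the glued circle, so the numbers of discs add up to two more; as each circle has a
summand `2` in the exponent of its weight, the exponents add up. -/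
theorem Glues.weight_eq (h : G.Glues N M Q) : Q.weight = N.weight * M.weight := by
  classical
  -- `r` and `p` embed the circles of the two parts into those of the glued link; the three products
  -- are compared circle by circle over the glued link
  let r : R.Circles N.filling → (R.comp i P G).Circles Q.filling := fun C =>
    G.circleOf Q.filling (Sum.inl (circle_surjective _ C).choose)
  let p : P.Circles M.filling → (R.comp i P G).Circles Q.filling := fun C =>
    G.circleOf Q.filling (Sum.inr (circle_surjective _ C).choose)
  have hr : ∀ s, r (R.circle N.filling s) = G.circleOf Q.filling (Sum.inl s) := fun s =>
    h.compatible.circleOf_inl (circle_surjective _ (R.circle N.filling s)).choose_spec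
  have hp : ∀ s, p (P.circle M.filling s) = G.circleOf Q.filling (Sum.inr s) := fun s =>
    h.compatible.circleOf_inr (circle_surjective _ (P.circle M.filling s)).choose_spec
  have hri : Function.Injective r := by
    intro C C' hCC
    obtain ⟨s, rfl⟩ := circle_surjective _ C
    obtain ⟨t, rfl⟩ := circle_surjective _ C'
    rw [hr, hr] at hCC
    exact h.compatible.circleOf_inl_iff.1 hCC
  have hpi : Function.Injective p := by
    intro C C' hCC
    obtain ⟨s, rfl⟩ := circle_surjective _ C
    obtain ⟨t, rfl⟩ := circle_surjective _ C'
    rw [hp, hp] at hCC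
    exact h.compatible.circleOf_inr_iff.1 hCC
  rw [weight, weight, weight, ← Fintype.prod_fiberwise r, ← Fintype.prod_fiberwise p,
    ← Finset.prod_mul_distrib]
  refine Finset.prod_congr rfl fun C _ => ?_
  rw [discCount_comp]
  -- circles of the glued link that contain no strand of one of the diagrams
  have hemptyR : (∀ s, G.circleOf Q.filling (Sum.inl s) ≠ C) → IsEmpty {x // r x = C} := by
    refine fun hC => ⟨fun ⟨x, hx⟩ => ?_⟩
    obtain ⟨s, rfl⟩ := circle_surjective _ x
    exact hC s ((hr s).symm.trans hx)
  have hemptyP : (∀ s, G.circleOf Q.filling (Sum.inr s) ≠ C) → IsEmpty {x // p x = C} := by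
    refine fun hC => ⟨fun ⟨x, hx⟩ => ?_⟩
    obtain ⟨s, rfl⟩ := circle_surjective _ x
    exact hC s ((hp s).symm.trans hx)
  by_cases hR : ∃ s, G.circleOf Q.filling (Sum.inl s) = C <;>
    by_cases hP : ∃ t, G.circleOf Q.filling (Sum.inr t) = C
  · obtain ⟨s, hs⟩ := hR
    obtain ⟨t, ht⟩ := hP
    obtain ⟨k, hk1, hk2⟩ := h.compatible.circleOf_inl_inr (hs.trans ht.symm)
    have e1 := h.discCount_left s
    have e2 := h.discCount_right t
    rw [if_pos ⟨k, hk1⟩, hs] at e1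
    rw [if_pos ⟨k, hk2⟩, ht] at e2
    have hs' : r (R.circle N.filling s) = C := (hr s).trans hs
    have ht' : p (P.circle M.filling t) = C := (hp t).trans ht
    have d1 : N.deco (R.circle N.filling s) = Q.deco C := by rw [← hs]; exact (h.sign_inl s).symm
    have d2 : M.deco (P.circle M.filling t) = Q.deco C := by rw [← ht]; exact (h.sign_inr t).symm
    have p1 := Fintype.prod_fiber_of_injective hri
      (fun C => (T ((N.deco C : ℤ) * (2 - (N.discCount C : ℤ))) : QRing)) (R.circle N.filling s)
    have p2 := Fintype.prod_fiber_of_injective hpi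
      (fun C => (T ((M.deco C : ℤ) * (2 - (M.discCount C : ℤ))) : QRing)) (P.circle M.filling t)
    rw [hs'] at p1
    rw [ht'] at p2
    rw [p1, p2, d1, d2, ← T_add, e1, e2]
    congr 1
    push_cast
    ring
  · obtain ⟨s, hs⟩ := hR
    have hP' : ∀ t, G.circleOf Q.filling (Sum.inr t) ≠ C := fun t ht => hP ⟨t, ht⟩
    have e1 := h.discCount_left s
    rw [if_neg, hs] at e1
    · have hs' : r (R.circle N.filling s) = C := (hr s).trans hs
      have d1 : N.deco (R.circle N.filling s) = Q.deco C := by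
        rw [← hs]; exact (h.sign_inl s).symm
      have p1 := Fintype.prod_fiber_of_injective hri
        (fun C => (T ((N.deco C : ℤ) * (2 - (N.discCount C : ℤ))) : QRing)) (R.circle N.filling s)
      have := hemptyP hP'
      rw [hs'] at p1
      have h0 : G.rightCount Q C = 0 := by simp [rightCount, hP']
      rw [p1, d1, e1, h0, Fintype.prod_empty, mul_one]
    · rintro ⟨k, hk⟩
      refine hP' (P.strand ⟨none, k⟩) ?_
      rw [← circleOf_glue (G := G), h.compatible.circleOf_inl hk, hs]
  · obtain ⟨t, ht⟩ := hP
    have hR' : ∀ s, G.circleOf Q.filling (Sum.inl s) ≠ C := fun s hs => hR ⟨s, hs⟩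
    have e2 := h.discCount_right t
    rw [if_neg, ht] at e2
    · have ht' : p (P.circle M.filling t) = C := (hp t).trans ht
      have d2 : M.deco (P.circle M.filling t) = Q.deco C := by
        rw [← ht]; exact (h.sign_inr t).symm
      have p2 := Fintype.prod_fiber_of_injective hpi
        (fun C => (T ((M.deco C : ℤ) * (2 - (M.discCount C : ℤ))) : QRing)) (P.circle M.filling t)
      have := hemptyR hR'
      rw [ht'] at p2
      have h0 : G.leftCount Q C = 0 := by simp [leftCount, hR']
      rw [p2, d2, e2, h0, Fintype.prod_empty, one_mul, zero_add, add_zero]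
    · rintro ⟨k, hk⟩
      refine hR' (R.strand ⟨some i, k⟩) ?_
      rw [circleOf_glue (G := G), h.compatible.circleOf_inr hk, ht]
  · obtain ⟨s | t, hst⟩ := circleOf_surjective (G := G) Q.filling C
    · exact absurd ⟨s, hst⟩ hR
    · exact absurd ⟨t, hst⟩ hP

end GluingMap

/-! ### The composition formula -/

open PlanarDiagram MultiplyCleavedLink

section

variable {ι : Type*} [Finite ι] {D : DiscConfiguration ι} {n₀ : ℕ} {n : ι → ℕ}

open Classical in
/-- The decorated links with prescribed boundaries at the inner discs. -/
noncomputable def PlanarDiagram.linksWithBoundary (P : PlanarDiagram D n₀ n)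
    (L : ∀ i, CleavedLink (n i)) : Finset (MultiplyCleavedLink P) :=
  Finset.univ.filter fun M => ∀ i, L i = M.boundary (some i)

theorem PlanarDiagram.mem_linksWithBoundary {P : PlanarDiagram D n₀ n}
    {L : ∀ i, CleavedLink (n i)} {M : MultiplyCleavedLink P} :
    M ∈ P.linksWithBoundary L ↔ ∀ i, L i = M.boundary (some i) := by
  simp [linksWithBoundary]

/-- Since each decorated link has exactly one boundary at each disc, the double sum in the
definition of the partition map is a sum over decorated links. -/
theorem PlanarDiagram.genValue_eq (P : PlanarDiagram D n₀ n) (L : ∀ i, CleavedLink (n i)) :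
    P.genValue L =
      ∑ M ∈ P.linksWithBoundary L, Finsupp.single (M.boundary none) M.weight := by
  classical
  rw [genValue, linksWithBoundary, Finset.sum_filter]
  refine Finset.sum_congr rfl fun M _ => ?_
  simp only [isBoundary_iff]
  rw [Finset.sum_eq_single (M.boundary none)]
  · simp
  · intro L₀ _ hL
    exact if_neg fun h => hL h.1
  · simp

end

/-- The family of cleaved links with entry `x` at the index `i`. -/
noncomputable def insertLink {ι' : Type*} {n' : ι' → ℕ} (i : ι')
    (a : ∀ j : {j : ι' // j ≠ i}, CleavedLink (n' j)) (x : CleavedLink (n' i)) (j : ι') :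
    CleavedLink (n' j) :=
  open Classical in if h : j = i then h ▸ x else a ⟨j, h⟩

theorem insertLink_self {ι' : Type*} {n' : ι' → ℕ} (i : ι')
    (a : ∀ j : {j : ι' // j ≠ i}, CleavedLink (n' j)) (x : CleavedLink (n' i)) :
    insertLink i a x i = x := by
  simp [insertLink]

theorem insertLink_of_ne {ι' : Type*} {n' : ι' → ℕ} {i : ι'}
    (a : ∀ j : {j : ι' // j ≠ i}, CleavedLink (n' j)) (x : CleavedLink (n' i)) {j : ι'}
    (h : j ≠ i) : insertLink i a x j = a ⟨j, h⟩ := by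
  simp [insertLink, h]

theorem insertEntry_single {ι' : Type*} {n' : ι' → ℕ} (i : ι')
    (a : ∀ j : {j : ι' // j ≠ i}, CleavedLink (n' j)) (x : CleavedLink (n' i)) :
    insertEntry (V := CleavedModule) i (fun j => Finsupp.single (a j) 1) (Finsupp.single x 1) =
      fun j => Finsupp.single (insertLink i a x j) 1 := by
  funext j
  by_cases h : j = i
  · subst h
    simp [insertEntry, insertLink_self]
  · simp [insertEntry, h, insertLink_of_ne]

/-- The `i`-th entry can be prescribed separately from the other ones. -/
theorem forall_insertLink_iff {ι' : Type*} {n' : ι' → ℕ} {i : ι'}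
    {a : ∀ j : {j : ι' // j ≠ i}, CleavedLink (n' j)} {x : CleavedLink (n' i)}
    {b : ∀ j, CleavedLink (n' j)} :
    (∀ j, insertLink i a x j = b j) ↔ x = b i ∧ ∀ j : {j : ι' // j ≠ i}, a j = b j := by
  constructor
  · intro h
    exact ⟨by rw [← h i, insertLink_self], fun j => by rw [← h j, insertLink_of_ne a x j.2]⟩
  · rintro ⟨h1, h2⟩ j
    by_cases h : j = i
    · subst h
      rw [insertLink_self, h1]
    · rw [insertLink_of_ne a x h, h2]

section

variable {ι ι' : Type*} [Fintype ι] [Fintype ι'] {D : DiscConfiguration ι}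
  {D' : DiscConfiguration ι'} {n : ι → ℕ} {n₀' : ℕ} {n' : ι' → ℕ}

/-- The composite of two partition maps on generators. -/
theorem partitionMap_insertEntry (R : PlanarDiagram D' n₀' n') (i : ι')
    (a : ∀ j : {j : ι' // j ≠ i}, CleavedLink (n' j)) {α : Type*} (s : Finset α)
    (x : α → CleavedLink (n' i)) (w : α → QRing) :
    R.partitionMap (PiTensorProduct.tprod QRing (insertEntry (V := CleavedModule) i
      (fun j => Finsupp.single (a j) 1) (∑ m ∈ s, Finsupp.single (x m) (w m)))) =
    ∑ m ∈ s, w m • R.genValue (insertLink i a (x m)) := by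
  classical
  let F : CleavedModule (n' i) →ₗ[QRing] CleavedModule n₀' :=
    (R.partitionMap.compMultilinearMap (PiTensorProduct.tprod QRing)).toLinearMap
      (insertEntry (V := CleavedModule) i (fun j => Finsupp.single (a j) 1) 0) i
  have hF : ∀ v, R.partitionMap (PiTensorProduct.tprod QRing (insertEntry (V := CleavedModule) i
      (fun j => Finsupp.single (a j) 1) v)) = F v := by
    intro v
    rw [insertEntry_update_right _ 0 v]
    simp only [F, MultilinearMap.toLinearMap_apply, LinearMap.compMultilinearMap_apply]
  rw [hF, map_sum]
  refine Finset.sum_congr rfl fun m _ => ?_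
  rw [← mul_one (w m), ← smul_eq_mul, ← Finsupp.smul_single, map_smul, ← hF, insertEntry_single,
    partitionMap_tprod_single, smul_eq_mul, mul_one]

end

/-- Let `R` and `P` be planar diagrams such that the outer signature of `P` is the `i`-th inner
signature of `R`, and let `R ∘ᵢ P` be the diagram obtained from them by a gluing map.  Then
`Z_{R ∘ᵢ P} = Z_R ∘ᵢ Z_P`. -/
theorem theorem1 {ι ι' : Type*} [Fintype ι] [Fintype ι'] [DecidableEq ι']
    {D : DiscConfiguration ι} {D' : DiscConfiguration ι'}
    {n : ι → ℕ} {n₀' : ℕ} {n' : ι' → ℕ}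
    (R : PlanarDiagram D' n₀' n') (i : ι') (P : PlanarDiagram D (n' i) n)
    (G : GluingMap R i P) :
    (R.comp i P G).partitionMap =
      operadicComp (A := QRing) (V := CleavedModule) R.partitionMap i P.partitionMap := by
  classical
  refine PiTensorProduct.ext (Module.Basis.ext_multilinear
    (fun _ => Finsupp.basisSingleOne) fun v => ?_)
  simp only [Finsupp.coe_basisSingleOne, LinearMap.compMultilinearMap_apply]
  rw [partitionMap_tprod_single]
  have hrec : (fun k => Finsupp.single (v k) (1 : QRing)) =
      (Sum.rec (fun j => Finsupp.single (v (Sum.inl j)) 1)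
        (fun k => Finsupp.single (v (Sum.inr k)) 1) :
          ∀ k, CleavedModule (compSig n' i n k)) := by
    funext k
    rcases k with j | k <;> rfl
  rw [hrec, operadicComp_tprod, partitionMap_tprod_single, genValue_eq, genValue_eq,
    partitionMap_insertEntry]
  simp only [genValue_eq, Finset.smul_sum, Finsupp.smul_single, smul_eq_mul]
  rw [Finset.sum_sigma']
  have hmem : ∀ p : (_ : MultiplyCleavedLink P) × MultiplyCleavedLink R,
      p ∈ (P.linksWithBoundary fun k => v (Sum.inr k)).sigma (fun M =>
        R.linksWithBoundary (insertLink i (fun j => v (Sum.inl j)) (M.boundary none))) ↔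
      (∀ k, v (Sum.inr k) = p.1.boundary (some k)) ∧
        p.1.boundary none = p.2.boundary (some i) ∧
          ∀ j : {j : ι' // j ≠ i}, v (Sum.inl j) = p.2.boundary (some j.1) := by
    intro p
    rw [Finset.mem_sigma, mem_linksWithBoundary, mem_linksWithBoundary]
    exact and_congr_right fun _ => forall_insertLink_iff
  have hglue : ∀ p : (_ : MultiplyCleavedLink P) × MultiplyCleavedLink R,
      p ∈ (P.linksWithBoundary fun k => v (Sum.inr k)).sigma (fun M =>
        R.linksWithBoundary (insertLink i (fun j => v (Sum.inl j)) (M.boundary none))) →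
      ∃ Q : MultiplyCleavedLink (R.comp i P G), G.Glues p.2 p.1 Q :=
    fun p hp => GluingMap.exists_glues ((hmem p).1 hp).2.1
  -- gluing is a bijection from the pairs that contribute to the composite to the links that
  -- contribute to `Z_{R ∘ᵢ P}`
  symm
  refine Finset.sum_bij (fun p hp => (hglue p hp).choose) (fun p hp => ?_)
    (fun p hp p' hp' h => ?_) (fun Q hQ => ?_) (fun p hp => ?_)
  · have h := (hglue p hp).choose_spec
    obtain ⟨h1, -, h3⟩ := (hmem p).1 hp
    rw [mem_linksWithBoundary]
    rintro (j | k)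
    · exact (h3 j).trans (h.boundary_inl j).symm
    · exact (h1 k).trans (h.boundary_inr k).symm
  · have h1 := (hglue p hp).choose_spec
    have h2 := (hglue p' hp').choose_spec
    rw [h] at h1
    obtain ⟨hN, hM⟩ := h1.unique_parts h2
    exact Sigma.ext hM (heq_of_eq hN)
  · rw [mem_linksWithBoundary] at hQ
    obtain ⟨N, M, h⟩ := GluingMap.exists_parts Q
    have hp := (hmem ⟨M, N⟩).2 ⟨fun k => (hQ (Sum.inr k)).trans (h.boundary_inr k),
      h.boundary_eq, fun j => (hQ (Sum.inl j)).trans (h.boundary_inl j)⟩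
    exact ⟨⟨M, N⟩, hp, (hglue _ hp).choose_spec.unique_comp h⟩
  · have h := (hglue p hp).choose_spec
    rw [h.boundary_none, h.weight_eq, mul_comm]
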